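/- Let $X$ be a compact connected complex manifold of dimension $n$, $L\to X$ a holomorphic line bundle and $h_0$ a smooth Hermitian metric on $L$ whose curvature form $\omega=-\sqrt{-1}\,\partial\bar\partial\log h_0$ is positive. Let $G$ be a subgroup of the group $\mathrm{Aut}(X,L)$ of holomorphic automorphisms of the pair $(X,L)$ that leaves $\omega$ invariant (for instance a compact one, or the trivial one). Let $\mathcal H$ be the set of smooth $\phi:X\to\mathbb R$ with $\omega_\phi=\omega+\sqrt{-1}\,\partial\bar\partial\phi>0$, and $\mathcal H^G$ the set of $G$-invariant elements of $\mathcal H$. For $\phi\in\mathcal H$ write $d\mu_\phi=\omega_\phi^n/n!$ and $\Delta_\phi=-g_\phi^{i\bar j}\partial_i\partial_{\bar j}$, where $\omega_\phi=\sqrt{-1}\sum g_{\phi,i\bar j}\,dz_i\wedge d\bar z_j$; the metric $(e^{-\phi}h_0)^k$ on $L^{\otimes k}$ has curvature form $\omega_{k\phi}:=k\,\omega_\phi$. Let $k\ge 1$ be such that $L^{\otimes k}$ has no base points and put $N_k=\dim H^0(X,L^{\otimes k})$. For $\phi\in\mathcal H$ let $\mathrm{Hilb}_k(\phi)$ be the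 Hermitian form $(s,t)\mapsto\int_X\langle s,t\rangle_{(e^{-\phi}h_0)^k}\,d\mu_\phi$ on $H^0(X,L^{\otimes k})$. For a positive definite Hermitian form $H$ on $H^0(X,L^{\otimes k})$ with orthonormal basis $(s_\alpha)$ let $\mathrm{FS}_k(H)=\frac1k\log\big(\frac1{N_k}\sum_\alpha|s_\alpha|^2_{h_0^k}\big)$, and let $I_k(H)=\log\det H$, the determinant being taken in a fixed basis of $H^0(X,L^{\otimes k})$. Let $\rho_k(\phi)=\sum_\alpha|s_\alpha|^2_{(e^{-\phi}h_0)^k}$ for an orthonormal basis $(s_\alpha)$ of $\mathrm{Hilb}_k(\phi)$. Let $\sigma_k(t)$ be a one-parameter subgroup of $\mathrm{Aut}(X,L)$. For $\phi\in\mathcal H$ let $\psi_k(\phi)$ be the smooth real function determined by $$\sigma_k(1)^*\omega_{k\phi}=\omega_{k\phi}+\sqrt{-1}\,\partial\bar\partial\psi_k(\phi),\qquad \int_X e^{\psi_k(\phi)}\,d\mu_\phi=\frac{N_k}{k^n},$$ and for a smooth function $\delta\phi$ let $$\delta I_k^\sigma(\phi)(\delta\phi)=\int_X k\,\delta\phi\,\Big(1+\frac{\Delta_\phi}{k}\Big)e^{\psi_k(\phi)}\,k^n\,d\mu_\phi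 .$$ The functional $I_k^\sigma$ is the integral of this one-form along smooth paths in $\mathcal H^G$ that start at $0$, and $\mathcal L_k^\sigma=I_k\circ\mathrm{Hilb}_k+I_k^\sigma$. Suppose that $\phi\in\mathcal H^G$ is a $k$-th $\sigma_k$-balanced metric, that is, $\omega_{k\,\mathrm{FS}_k(\mathrm{Hilb}_k(\phi))}=\sigma_k(1)^*\omega_{k\phi}$. Then: 1. $\rho_k(\phi)=k^n e^{\psi_k(\phi)}$. 2. The first variation of $\mathcal L_k^\sigma$ vanishes at $\phi$: for every smooth $G$-invariant $\delta\phi$ the function $t\mapsto I_k(\mathrm{Hilb}_k(\phi+t\,\delta\phi))$ is differentiable at $t=0$, and its derivative there plus $\delta I_k^\sigma(\phi)(\delta\phi)$ is $0$. 3. $\phi$ is a critical point of $\mathcal L_k^\sigma$: for every smooth path $(\gamma_t)_{t\in\mathbb R}$ in $\mathcal H^G$ with $\gamma_0=0$ and every $t_0$ with $\gamma_{t_0}=\phi$, the function $$t\mapsto I_k(\mathrm{Hilb}_k(\gamma_t))+\int_0^t\delta I_k^\sigma(\gamma_s)(\dot\gamma_s)\,ds$$ is differentiable at $t_0$ with derivative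 $0$. -/

import Mathlib

open scoped Manifold ContDiff TensorProduct ComplexOrder

noncomputable section

namespace SigmaBalanced

open Bundle MeasureTheory

/-! ### Calculus on a complex manifold of dimension `n`

A complex manifold is a space charted on `Fin n → ℂ` with complex analytic coordinate changes.
The same charts, with the model `𝓘(ℝ, Fin n → ℂ)`, give the underlying smooth manifold. -/

section Manifold

variable {n : ℕ} {X : Type*} [TopologicalSpace X] [ChartedSpace (Fin n → ℂ) X]

/-- `∂F/∂zᵢ = (∂F/∂xᵢ - √-1 ∂F/∂yᵢ) / 2` on `ℂⁿ`. -/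
def dz (i : Fin n) (F : (Fin n → ℂ) → ℂ) (z : Fin n → ℂ) : ℂ :=
  (1 / 2) * (fderiv ℝ F z (Pi.single i 1) - Complex.I * fderiv ℝ F z (Pi.single i Complex.I))

/-- `∂F/∂z̄ᵢ = (∂F/∂xᵢ + √-1 ∂F/∂yᵢ) / 2` on `ℂⁿ`. -/
def dzbar (i : Fin n) (F : (Fin n → ℂ) → ℂ) (z : Fin n → ℂ) : ℂ :=
  (1 / 2) * (fderiv ℝ F z (Pi.single i 1) + Complex.I * fderiv ℝ F z (Pi.single i Complex.I))

/-- The complex Hessian `(∂²f / ∂zᵢ ∂z̄ⱼ)` at `x` in the chart `c`. -/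
def complexHess (c : OpenPartialHomeomorph X (Fin n → ℂ)) (f : X → ℝ) (x : X) :
    Matrix (Fin n) (Fin n) ℂ :=
  Matrix.of fun i j => dz i (dzbar j fun z => (f (c.symm z) : ℂ)) (c x)

variable (n X) in
/-- A real `(1,1)`-form `√-1 ∑ aᵢⱼ dzᵢ ∧ dz̄ⱼ`, given at each point `x` by its Hermitian matrix
`(aᵢⱼ)` in the chart `chartAt x`, that is, in the coordinates used by `TangentSpace` at `x`. -/
abbrev Form11 : Type _ := X → Matrix (Fin n) (Fin n) ℂ

/-- The form `√-1 ∂∂̄ f`. -/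
def ddbar (f : X → ℝ) : Form11 n X :=
  fun x => complexHess (chartAt (Fin n → ℂ) x) f x

/-- The Hermitian form `∑ aᵢⱼ vᵢ w̄ⱼ`. -/
def hermForm (A : Matrix (Fin n) (Fin n) ℂ) (v w : Fin n → ℂ) : ℂ :=
  ∑ i, ∑ j, A i j * v i * (starRingEnd ℂ) (w j)

/-- The `i`-th coordinate vector in the holomorphic tangent space at `x`. -/
def coordVec (x : X) (i : Fin n) : TangentSpace 𝓘(ℂ, Fin n → ℂ) x :=
  (Pi.single i 1 : Fin n → ℂ)

/-- The pull-back `f^* α` of a `(1,1)`-form by a holomorphic map `f`. -/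
def pullback (f : X → X) (α : Form11 n X) : Form11 n X :=
  fun x => Matrix.of fun i j =>
    hermForm (α (f x))
      (mfderiv 𝓘(ℂ, Fin n → ℂ) 𝓘(ℂ, Fin n → ℂ) f x (coordVec x i))
      (mfderiv 𝓘(ℂ, Fin n → ℂ) 𝓘(ℂ, Fin n → ℂ) f x (coordVec x j))

/-- Smooth real functions on the manifold. -/
def IsSmooth (f : X → ℝ) : Prop :=
  ContMDiff 𝓘(ℝ, Fin n → ℂ) 𝓘(ℝ, ℝ) ∞ f

variable (n X) in
theorem exists_chartCover [CompactSpace X] :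
    ∃ t : Finset X, ⋃ p ∈ t, (chartAt (Fin n → ℂ) p).source = Set.univ := by
  obtain ⟨t, ht⟩ := isCompact_univ.elim_finite_subcover
    (fun p : X => (chartAt (Fin n → ℂ) p).source)
    (fun p => (chartAt (Fin n → ℂ) p).open_source)
    (fun x _ => Set.mem_iUnion.2 ⟨x, mem_chart_source (Fin n → ℂ) x⟩)
  exact ⟨t, Set.univ_subset_iff.1 ht⟩

variable (n X) in
/-- A finite set of points whose preferred charts cover the manifold. -/
def chartCover [CompactSpace X] : Finset X := (exists_chartCover n X).choose

open Classical in
/-- The number of charts of the finite cover that contain `x`. -/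
def chartMultiplicity [CompactSpace X] (x : X) : ℕ :=
  ((chartCover n X).filter fun p => x ∈ (chartAt (Fin n → ℂ) p).source).card

end Manifold

/-! ### Holomorphic line bundles, their powers and their metrics -/

section LineBundle

variable {n : ℕ} {X : Type*} [TopologicalSpace X] [ChartedSpace (Fin n → ℂ) X]
  {L : X → Type*} [∀ x, AddCommGroup (L x)] [∀ x, Module ℂ (L x)] [∀ x, TopologicalSpace (L x)]
  [TopologicalSpace (TotalSpace ℂ L)] [FiberBundle ℂ L] [VectorBundle ℂ ℂ L]

variable (L) in
/-- A smooth Hermitian metric on a line bundle, given by `v ↦ |v|²`. -/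
structure HermitianMetric where
  normSq : ∀ x, L x → ℝ
  normSq_smul : ∀ x (c : ℂ) (v : L x), normSq x (c • v) = ‖c‖ ^ 2 * normSq x v
  normSq_pos : ∀ x (v : L x), v ≠ 0 → 0 < normSq x v
  smooth : ∀ p : X, ContMDiffOn 𝓘(ℝ, Fin n → ℂ) 𝓘(ℝ, ℝ) ∞
    (fun x => normSq x ((trivializationAt ℂ L p).symm x 1)) (trivializationAt ℂ L p).baseSet

/-- The squared norm `|e|²_h` of the local holomorphic frame `e` of the bundle around `p`. -/
def HermitianMetric.weight (h : HermitianMetric (n := n) L) (p x : X) : ℝ :=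
  h.normSq x ((trivializationAt ℂ L p).symm x 1)

/-- The matrix `(gᵢⱼ)` at `x`, in the chart `c`, of
`ω_φ = -√-1 ∂∂̄ log (e^{-φ} h) = ω_h + √-1 ∂∂̄ φ = √-1 ∑ gᵢⱼ dzᵢ ∧ dz̄ⱼ`. -/
def metricMatrix (h : HermitianMetric (n := n) L) (φ : X → ℝ)
    (c : OpenPartialHomeomorph X (Fin n → ℂ)) (x : X) : Matrix (Fin n) (Fin n) ℂ :=
  -complexHess c (fun y => Real.log (h.weight x y)) x + complexHess c φ x

/-- The curvature form `ω_φ` of the metric `e^{-φ} h` on the line bundle. -/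
def curvForm (h : HermitianMetric (n := n) L) (φ : X → ℝ) : Form11 n X :=
  fun x => metricMatrix h φ (chartAt (Fin n → ℂ) x) x

/-- The space `ℋ` of Kähler potentials with respect to the curvature form of `h`. -/
def IsKahlerPotential (h : HermitianMetric (n := n) L) (φ : X → ℝ) : Prop :=
  IsSmooth (n := n) φ ∧ ∀ x, (curvForm h φ x).PosDef

/-- The complex Laplacian `Δ_φ f = -g^{i j̄} ∂²f / ∂zᵢ ∂z̄ⱼ` of the metric of `ω_φ`. -/
def laplacian (h : HermitianMetric (n := n) L) (φ f : X → ℝ) (x : X) : ℝ :=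
  -((curvForm h φ x)⁻¹ * ddbar (n := n) f x).trace.re

/-- The volume measure `dμ_φ = ω_φ^n / n!`. In a chart it is `2^n det (gᵢⱼ)` times Lebesgue
measure on `ℂⁿ`; the pieces in the charts of a finite cover are added up, each divided by the
number of charts that contain the point. -/
def volumeMeasure [CompactSpace X] [MeasurableSpace X]
    (h : HermitianMetric (n := n) L) (φ : X → ℝ) : Measure X :=
  ∑ p ∈ chartCover n X,
    (((volume.restrict (chartAt (Fin n → ℂ) p).target).withDensity fun z =>
        ENNReal.ofReal (2 ^ n * (metricMatrix h φ (chartAt (Fin n → ℂ) p)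
          ((chartAt (Fin n → ℂ) p).symm z)).det.re)).map
      (chartAt (Fin n → ℂ) p).symm).withDensity
    fun x => ((chartMultiplicity (n := n) x : ENNReal))⁻¹

/-- The coordinate on the fibre of `L^{⊗k}` at `x` induced by the trivialization of `L`
around `p`: it sends `v₁ ⊗ ⋯ ⊗ v_k` to the product of the coordinates of the `vᵢ`. -/
def powCoord (k : ℕ) (p x : X) : (⨂[ℂ]^k (L x)) →ₗ[ℂ] ℂ :=
  (PiTensorProduct.lift (MultilinearMap.mkPiAlgebra ℂ (Fin k) ℂ)).comp
    (PiTensorProduct.map fun _ => (trivializationAt ℂ L p).linearMapAt ℂ x)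

variable (n L) in
/-- The space `H⁰(X, L^{⊗k})` of holomorphic sections. -/
def holSections (k : ℕ) : Submodule ℂ (∀ x, ⨂[ℂ]^k (L x)) where
  carrier := {s | ∀ p : X, ContMDiffOn 𝓘(ℂ, Fin n → ℂ) 𝓘(ℂ, ℂ) ω
    (fun x => powCoord k p x (s x)) (trivializationAt ℂ L p).baseSet}
  add_mem' := by
    intro s t hs ht p
    have := (hs p).add (ht p)
    simp only [Pi.add_apply, map_add]
    exact this
  zero_mem' := by
    intro p
    simpa using contMDiffOn_const
  smul_mem' := by
    intro c s hs p
    have := (contMDiffOn_const (c := c)).mul (hs p)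
    simp only [Pi.smul_apply, map_smul, smul_eq_mul]
    exact this

variable (n L) in
/-- `N_k = dim H⁰(X, L^{⊗k})`. -/
def numSections (k : ℕ) : ℕ := Module.finrank ℂ (holSections n L k)

/-- The pointwise Hermitian product `⟨s, t⟩` at `x` for the metric `(e^{-φ} h)^k` on
`L^{⊗k}`. -/
def pairing (h : HermitianMetric (n := n) L) (k : ℕ) (φ : X → ℝ)
    (s t : holSections n L k) (x : X) : ℂ :=
  powCoord k x x (s.1 x) * (starRingEnd ℂ) (powCoord k x x (t.1 x)) *
    (((Real.exp (-φ x) * h.weight x x) ^ k : ℝ) : ℂ)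

/-- `Hilb_k(φ)`: the `L²` Hermitian form on `H⁰(X, L^{⊗k})`. -/
def Hilb [CompactSpace X] [MeasurableSpace X] (h : HermitianMetric (n := n) L) (k : ℕ)
    (φ : X → ℝ) (s t : holSections n L k) : ℂ :=
  ∫ x, pairing h k φ s t x ∂(volumeMeasure h φ)

/-- `s` is an orthonormal basis of `H⁰(X, L^{⊗k})` for the Hermitian form `H`. -/
def IsOrthonormalBasis {k : ℕ} (H : holSections n L k → holSections n L k → ℂ)
    (s : Fin (numSections n L k) → holSections n L k) : Prop :=
  (∀ α β, H (s α) (s β) = if α = β then 1 else 0) ∧ LinearIndependent ℂ s ∧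
    Submodule.span ℂ (Set.range s) = ⊤

/-- A choice of an orthonormal basis. The sums formed with it below do not depend on it. -/
def orthonormalBasis {k : ℕ} (H : holSections n L k → holSections n L k → ℂ) :
    Fin (numSections n L k) → holSections n L k :=
  Classical.epsilon (IsOrthonormalBasis H)

/-- `FS_k(H) = (1/k) log ((1/N_k) ∑ |s_α|²_{h^k})` for an orthonormal basis of `H`. -/
def FS (h : HermitianMetric (n := n) L) (k : ℕ)
    (H : holSections n L k → holSections n L k → ℂ) (x : X) : ℝ :=
  (1 / (k : ℝ)) * Real.log ((1 / (numSections n L k : ℝ)) *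
    ∑ α, (pairing h k 0 (orthonormalBasis H α) (orthonormalBasis H α) x).re)

/-- The Bergman function `ρ_k(φ) = ∑ |s_α|²` in the metric `(e^{-φ} h)^k`, for an orthonormal
basis of `Hilb_k(φ)`. -/
def bergman [CompactSpace X] [MeasurableSpace X] (h : HermitianMetric (n := n) L) (k : ℕ)
    (φ : X → ℝ) (x : X) : ℝ :=
  ∑ α, (pairing h k φ (orthonormalBasis (Hilb h k φ) α)
    (orthonormalBasis (Hilb h k φ) α) x).re

/-- `I_k = log ∘ det`, where the determinant is taken in the basis `b` of `H⁰(X, L^{⊗k})`. -/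
def logDet {k : ℕ} (b : Module.Basis (Fin (numSections n L k)) ℂ (holSections n L k))
    (H : holSections n L k → holSections n L k → ℂ) : ℝ :=
  Real.log (Matrix.of fun α β => H (b α) (b β)).det.re

/-! ### Automorphisms of the pair `(X, L)` -/

variable (n) in
/-- A holomorphic map of the total space of `L` that is linear from fibres to fibres. -/
def IsHolBundleMap (F : TotalSpace ℂ L → TotalSpace ℂ L) : Prop :=
  ContMDiff (𝓘(ℂ, Fin n → ℂ).prod 𝓘(ℂ, ℂ)) (𝓘(ℂ, Fin n → ℂ).prod 𝓘(ℂ, ℂ)) ω F ∧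
    ∃ (f : X → X) (l : ∀ x, L x →ₗ[ℂ] L (f x)), ∀ x (v : L x), F ⟨x, v⟩ = ⟨f x, l x v⟩

set_option linter.unusedSectionVars false in
theorem IsHolBundleMap.comp {F G : TotalSpace ℂ L → TotalSpace ℂ L}
    (hF : IsHolBundleMap n F) (hG : IsHolBundleMap n G) : IsHolBundleMap n (F ∘ G) := by
  obtain ⟨hF, f, l, hfl⟩ := hF
  obtain ⟨hG, g, m, hgm⟩ := hG
  refine ⟨hF.comp hG, fun x => f (g x), fun x => (l (g x)).comp (m x), fun x v => ?_⟩
  simp [hgm, hfl]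

set_option linter.unusedSectionVars false in
variable (n L) in
theorem IsHolBundleMap.id : IsHolBundleMap n (id : TotalSpace ℂ L → TotalSpace ℂ L) :=
  ⟨contMDiff_id, fun x => x, fun _ => LinearMap.id, fun _ _ => rfl⟩

variable (n L) in
/-- The group `Aut(X, L)`. -/
def autGroup : Subgroup (Equiv.Perm (TotalSpace ℂ L)) where
  carrier := {F | IsHolBundleMap n (F : TotalSpace ℂ L → TotalSpace ℂ L) ∧
    IsHolBundleMap n (F.symm : TotalSpace ℂ L → TotalSpace ℂ L)}
  mul_mem' := fun hF hG => ⟨hF.1.comp hG.1, hG.2.comp hF.2⟩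
  one_mem' := ⟨IsHolBundleMap.id n L, IsHolBundleMap.id n L⟩
  inv_mem' := fun hF => ⟨hF.2, hF.1⟩

/-- The automorphism of `X` that underlies an automorphism of `(X, L)`. -/
def baseMap (F : autGroup n L) (x : X) : X := (F.1 ⟨x, 0⟩).proj

variable (n L) in
/-- A one-parameter subgroup of `Aut(X, L)`. By continuity it stays in the identity
component. -/
structure OneParamSubgroup where
  toFun : ℝ → autGroup n L
  map_add : ∀ s t, toFun (s + t) = toFun s * toFun t
  continuous : Continuous fun p : ℝ × TotalSpace ℂ L => (toFun p.1).1 p.2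

/-- The space `ℋ^G` of `G`-invariant Kähler potentials. -/
def IsInvariantPotential (G : Subgroup (autGroup n L)) (h : HermitianMetric (n := n) L)
    (φ : X → ℝ) : Prop :=
  IsKahlerPotential h φ ∧ ∀ g ∈ G, ∀ x, φ (baseMap g x) = φ x

/-! ### Balanced metrics and the functionals

The metric `(e^{-φ} h)^k` on `L^{⊗k}` has curvature form `ω_{kφ} = k ω_φ`. -/

variable [CompactSpace X] [MeasurableSpace X]

/-- `φ` is a `k`-th `σ`-balanced metric: `ω_{k FS_k(Hilb_k(φ))} = σ(1)^* ω_{kφ}`. -/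
def IsBalanced (h : HermitianMetric (n := n) L) (k : ℕ) (σ : OneParamSubgroup n L)
    (φ : X → ℝ) : Prop :=
  IsKahlerPotential h φ ∧
    (k : ℂ) • curvForm h (FS h k (Hilb h k φ)) =
      pullback (baseMap (σ.toFun 1)) ((k : ℂ) • curvForm h φ)

/-- `ψ` is the potential of `σ(1)^* ω_{kφ} - ω_{kφ}`, normalized by
`∫ e^ψ dμ_φ = N_k / k^n`. -/
def IsNormalizedPotential (h : HermitianMetric (n := n) L) (k : ℕ) (σ : OneParamSubgroup n L)
    (φ ψ : X → ℝ) : Prop :=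
  IsSmooth (n := n) ψ ∧
    pullback (baseMap (σ.toFun 1)) ((k : ℂ) • curvForm h φ) =
      (k : ℂ) • curvForm h φ + ddbar ψ ∧
    ∫ x, Real.exp (ψ x) ∂(volumeMeasure h φ) = (numSections n L k : ℝ) / (k : ℝ) ^ n

/-- The normalized potential `ψ_k(φ)`, which is unique on a compact connected manifold. -/
def psi (h : HermitianMetric (n := n) L) (k : ℕ) (σ : OneParamSubgroup n L)
    (φ : X → ℝ) : X → ℝ :=
  Classical.epsilon (IsNormalizedPotential h k σ φ)

/-- The one-form
`δI_k^σ(φ)(δφ) = ∫ k δφ (1 + Δ_φ / k) e^{ψ_k(φ)} k^n dμ_φ`. -/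
def deltaI (h : HermitianMetric (n := n) L) (k : ℕ) (σ : OneParamSubgroup n L)
    (φ δφ : X → ℝ) : ℝ :=
  ∫ x, (k : ℝ) * δφ x *
      (Real.exp (psi h k σ φ x) +
        laplacian h φ (fun y => Real.exp (psi h k σ φ y)) x / (k : ℝ)) * (k : ℝ) ^ n
    ∂(volumeMeasure h φ)

/-- A smooth path in `ℋ^G` that starts at the base point `0`. -/
def IsPathFromZero (G : Subgroup (autGroup n L)) (h : HermitianMetric (n := n) L)
    (γ : ℝ → X → ℝ) : Prop :=
  ContMDiff (𝓘(ℝ, ℝ).prod 𝓘(ℝ, Fin n → ℂ)) 𝓘(ℝ, ℝ) ∞ (fun p : ℝ × X => γ p.1 p.2) ∧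
    (∀ t, IsInvariantPotential G h (γ t)) ∧ γ 0 = 0

/-- The value of `I_k^σ` at `γ(t)`, obtained by integrating the one-form `δI_k^σ` along the
path `γ` from `γ(0) = 0` to `γ(t)`. -/
def integralI (h : HermitianMetric (n := n) L) (k : ℕ) (σ : OneParamSubgroup n L)
    (γ : ℝ → X → ℝ) (t : ℝ) : ℝ :=
  ∫ s in (0 : ℝ)..t, deltaI h k σ (γ s) fun x => deriv (fun r => γ r x) s

/-- The value of `ℒ_k^σ = I_k ∘ Hilb_k + I_k^σ` at `γ(t)`. -/
def functionalL (h : HermitianMetric (n := n) L) (k : ℕ) (σ : OneParamSubgroup n L)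
    (b : Module.Basis (Fin (numSections n L k)) ℂ (holSections n L k))
    (γ : ℝ → X → ℝ) (t : ℝ) : ℝ :=
  logDet b (Hilb h k (γ t)) + integralI h k σ γ t

/-- `φ` is a critical point of `ℒ_k^σ` on `ℋ^G`: its derivative along every smooth path in `ℋ^G`
vanishes where the path passes through `φ`. -/
def IsCriticalPoint (G : Subgroup (autGroup n L)) (h : HermitianMetric (n := n) L) (k : ℕ)
    (σ : OneParamSubgroup n L)
    (b : Module.Basis (Fin (numSections n L k)) ℂ (holSections n L k)) (φ : X → ℝ) : Prop :=
  ∀ γ : ℝ → X → ℝ, IsPathFromZero G h γ → ∀ t : ℝ, γ t = φ →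
    HasDerivAt (functionalL h k σ b γ) 0 t

end LineBundle

end SigmaBalanced

end

open scoped Manifold ContDiff TensorProduct ComplexOrder

noncomputable section

namespace SigmaBalanced

open Bundle MeasureTheory

set_option linter.unusedSectionVars false

/-! ### The Levi form of a real function on a complex vector space -/

section Levi

open Filter Topology

variable {E E' : Type*} [NormedAddCommGroup E] [NormedSpace ℂ E] [NormedSpace ℝ E]
  [IsScalarTower ℝ ℂ E] [NormedAddCommGroup E'] [NormedSpace ℂ E'] [NormedSpace ℝ E']
  [IsScalarTower ℝ ℂ E']

/-! Let ρ be the Bergman function of φ. Taking logarithms of the defining sums gives log ρ = k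
FS_k(Hilb_k(φ)) + log N_k - kφ (`log_bergman`), so the balanced condition says that √-1 ∂∂̄ log ρ =
σ_k(1)^*ω_{kφ} - ω_{kφ}. Moreover ∫ ρ dμ_φ = N_k, since ρ is the sum of the pointwise squared norms
of N_k unit vectors. Hence log(ρ / k^n) meets both conditions that define ψ_k(φ)
(`isNormalizedPotential_log_bergman`). They have only one solution, because a pluriharmonic function
on a compact connected manifold is constant (`eq_const_of_ddbar_eq_zero`). This gives ρ = k^n e^ψ.

For the first variation, the volume form changes by δ(dμ_φ) = -Δ_φ(δφ) dμ_φ (`tderiv_volRatio`,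
which is Jacobi's formula for the determinant). So the weight e^{-kφ} dμ_φ is multiplied by -(k δφ +
Δ_φ δφ). In an orthonormal basis of Hilb_k(φ) the derivative of log det is a trace, and the
pointwise sum over the basis is ρ. Therefore δ(log det Hilb_k) = -∫ ρ (k δφ + Δ_φ δφ) dμ_φ
(`hasDerivAt_logDet_Hilb`). The Laplacian is symmetric (`integral_mul_laplacian`), so it can be
moved onto ρ = k^n e^ψ, and the result is -δI_k^σ (`deltaI_eq`).

Along a path, I_k^σ is an integral of the one-form, and its derivative is the integrand once the
integrand is continuous in the parameter (`continuous_deltaI`). This needs ψ_k at every point of the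
path and not only at φ. Because σ_k(1) lifts to an automorphism F of L over a map f of X, the
function φ∘f - φ - log(F^*h_0 / h_0) is a potential of f^*ω_φ - ω_φ (`pullback_curvForm`). So ψ_k is
k times this function plus a constant fixed by the normalization (`exists_exp_psi_eq`).

The analysis is done in charts. Naturality of the Levi form under holomorphic maps makes the
curvature form, the Laplacian and the volume measure independent of charts and frames. Symmetry of
the Laplacian reduces, by a partition of unity, to an identity on ℂⁿ in which the adjugate of a
complex Hessian is free of divergence. -/

/-- The sesquilinear part of a real bilinear form. -/
def leviPart (B : E →L[ℝ] E →L[ℝ] ℝ) (v w : E) : ℂ :=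
  (1 / 4) * (B v w + B (Complex.I • v) (Complex.I • w) +
    Complex.I * (B v (Complex.I • w) - B (Complex.I • v) w))

/-- The Levi form `∑ (∂²F / ∂zᵢ ∂z̄ⱼ) vᵢ w̄ⱼ`. -/
def leviForm (F : E → ℝ) (z v w : E) : ℂ := leviPart (fderiv ℝ (fderiv ℝ F) z) v w

lemma leviPart_add_left (B : E →L[ℝ] E →L[ℝ] ℝ) (v v' w : E) :
    leviPart B (v + v') w = leviPart B v w + leviPart B v' w := by
  simp only [leviPart, smul_add, map_add, add_apply, Complex.ofReal_add]
  ring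

lemma leviPart_add_right (B : E →L[ℝ] E →L[ℝ] ℝ) (v w w' : E) :
    leviPart B v (w + w') = leviPart B v w + leviPart B v w' := by
  simp only [leviPart, smul_add, map_add, Complex.ofReal_add]
  ring

lemma smul_eq_re_add_im (c : ℂ) (v : E) : c • v = c.re • v + c.im • (Complex.I • v) := by
  conv_lhs => rw [← Complex.re_add_im c]
  rw [add_smul, mul_smul]
  simp only [← algebraMap_smul ℂ (_ : ℝ) v, ← algebraMap_smul ℂ (_ : ℝ) (Complex.I • v)]
  rfl

lemma I_smul_smul (c : ℂ) (v : E) :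
    Complex.I • (c • v) = c.re • (Complex.I • v) - c.im • v := by
  rw [smul_comm, smul_eq_re_add_im c (Complex.I • v), smul_smul Complex.I, Complex.I_mul_I,
    neg_one_smul, smul_neg, sub_eq_add_neg]

/-- Replacing v by √-1 v permutes the four terms up to sign and multiplies the combination by √-1;
with real linearity this gives linearity over ℂ. The same check in the second variable produces a
conjugate. -/
lemma leviPart_smul_left (B : E →L[ℝ] E →L[ℝ] ℝ) (c : ℂ) (v w : E) :
    leviPart B (c • v) w = c * leviPart B v w := by
  simp only [leviPart, I_smul_smul]
  simp only [smul_eq_re_add_im c v, map_add, map_sub, map_smul, add_apply, sub_apply, smul_apply,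
    smul_eq_mul]
  conv_rhs => rw [← Complex.re_add_im c]
  push_cast
  linear_combination (1 / 4 * c.im * ((B (Complex.I • v)) w - (B v) (Complex.I • w)) : ℂ) *
    Complex.I_mul_I

lemma leviPart_smul_right (B : E →L[ℝ] E →L[ℝ] ℝ) (c : ℂ) (v w : E) :
    leviPart B v (c • w) = (starRingEnd ℂ) c * leviPart B v w := by
  simp only [leviPart, I_smul_smul]
  simp only [smul_eq_re_add_im c w, map_add, map_sub, map_smul, smul_eq_mul]
  conv_rhs => rw [← Complex.re_add_im c]
  simp only [map_add, map_mul, Complex.conj_ofReal, Complex.conj_I]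
  push_cast
  linear_combination (-1 / 4 * c.im * ((B (Complex.I • v)) w - (B v) (Complex.I • w)) : ℂ) *
    Complex.I_mul_I

lemma leviForm_sum {n : ℕ} (F : (Fin n → ℂ) → ℝ) (z v w : Fin n → ℂ) :
    leviForm F z v w =
      ∑ i, ∑ j, leviForm F z (Pi.single i 1) (Pi.single j 1) * v i * (starRingEnd ℂ) (w j) := by
  have key : ∀ B : (Fin n → ℂ) →L[ℝ] (Fin n → ℂ) →L[ℝ] ℝ, leviPart B v w =
      ∑ i, ∑ j, leviPart B (Pi.single i 1) (Pi.single j 1) * v i * (starRingEnd ℂ) (w j) := by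
    intro B
    -- Bundling the sesquilinearity lets `map_sum` perform the expansion in the standard basis.
    let Lv : (Fin n → ℂ) →ₗ[ℂ] (Fin n → ℂ) →ₛₗ[starRingEnd ℂ] ℂ :=
      LinearMap.mk₂'ₛₗ (RingHom.id ℂ) (starRingEnd ℂ) (leviPart B) (leviPart_add_left B)
        (leviPart_smul_left B) (leviPart_add_right B) (leviPart_smul_right B)
    have hv : v = ∑ i, v i • (Pi.single i 1 : Fin n → ℂ) := by
      conv_lhs => rw [← Finset.univ_sum_single v]
      refine Finset.sum_congr rfl fun i _ => ?_
      rw [← Pi.single_smul, smul_eq_mul, mul_one]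
    have hw : w = ∑ i, w i • (Pi.single i 1 : Fin n → ℂ) := by
      conv_lhs => rw [← Finset.univ_sum_single w]
      refine Finset.sum_congr rfl fun i _ => ?_
      rw [← Pi.single_smul, smul_eq_mul, mul_one]
    change Lv v w = ∑ i, ∑ j, Lv (Pi.single i 1) (Pi.single j 1) * v i * (starRingEnd ℂ) (w j)
    conv_lhs => rw [hv, hw]
    simp only [map_sum, LinearMap.sum_apply, map_smul, LinearMap.smul_apply, LinearMap.map_smulₛₗ,
      smul_eq_mul]
    simp only [Finset.mul_sum]
    rw [Finset.sum_comm]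
    refine Finset.sum_congr rfl fun i _ => Finset.sum_congr rfl fun j _ => ?_
    ring
  exact key _

lemma leviForm_congr {F G : E → ℝ} {z : E} (h : F =ᶠ[𝓝 z] G) (v w : E) :
    leviForm F z v w = leviForm G z v w := by
  rw [leviForm, leviForm, h.fderiv.fderiv_eq]

lemma leviForm_const (c : ℝ) (z v w : E) : leviForm (fun _ : E => c) z v w = 0 := by
  have : fderiv ℝ (fun _ : E => c) = fun _ => 0 := by ext; simp
  simp [leviForm, leviPart, this]

lemma differentiableAt_fderiv_of_contDiffAt {F : E → ℝ} {z : E} (h : ContDiffAt ℝ 2 F z) :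
    DifferentiableAt ℝ (fderiv ℝ F) z :=
  (h.fderiv_right (m := 1) (by norm_num)).differentiableAt (by norm_num)

lemma eventually_differentiableAt_of_contDiffAt {F : E → ℝ} {z : E} (h : ContDiffAt ℝ 2 F z) :
    ∀ᶠ y in 𝓝 z, DifferentiableAt ℝ F y :=
  (h.eventually (by simp)).mono fun _ hy => hy.differentiableAt (by norm_num)

lemma leviForm_add {F G : E → ℝ} {z : E} (hF : ContDiffAt ℝ 2 F z) (hG : ContDiffAt ℝ 2 G z)
    (v w : E) : leviForm (fun y => F y + G y) z v w = leviForm F z v w + leviForm G z v w := by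
  have h1 : fderiv ℝ (fun y => F y + G y) =ᶠ[𝓝 z] fun y => fderiv ℝ F y + fderiv ℝ G y := by
    filter_upwards [eventually_differentiableAt_of_contDiffAt hF,
      eventually_differentiableAt_of_contDiffAt hG] with y h h'
    exact fderiv_fun_add h h'
  have h2 : fderiv ℝ (fderiv ℝ fun y => F y + G y) z =
      fderiv ℝ (fderiv ℝ F) z + fderiv ℝ (fderiv ℝ G) z := by
    rw [h1.fderiv_eq, fderiv_fun_add (differentiableAt_fderiv_of_contDiffAt hF)
      (differentiableAt_fderiv_of_contDiffAt hG)]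
  simp only [leviForm, leviPart, h2, add_apply, Complex.ofReal_add]
  ring

lemma leviForm_const_mul {F : E → ℝ} {z : E} (hF : ContDiffAt ℝ 2 F z) (c : ℝ) (v w : E) :
    leviForm (fun y => c * F y) z v w = c * leviForm F z v w := by
  have h1 : fderiv ℝ (fun y => c * F y) =ᶠ[𝓝 z] fun y => c • fderiv ℝ F y := by
    filter_upwards [eventually_differentiableAt_of_contDiffAt hF] with y h
    exact fderiv_const_mul h c
  have h2 : fderiv ℝ (fderiv ℝ fun y => c * F y) z = c • fderiv ℝ (fderiv ℝ F) z := by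
    rw [h1.fderiv_eq, fderiv_fun_const_smul (differentiableAt_fderiv_of_contDiffAt hF)]
  simp only [leviForm, leviPart, h2, smul_apply, smul_eq_mul,
    Complex.ofReal_mul]
  ring

/-- The Levi form is natural under holomorphic maps. -/
lemma leviForm_comp {F : E' → ℝ} {T : E → E'} {z : E} (hF : ContDiffAt ℝ 2 F (T z))
    (hT : ContDiffAt ℂ 2 T z) (v w : E) :
    leviForm (fun y => F (T y)) z v w =
      leviForm F (T z) (fderiv ℂ T z v) (fderiv ℂ T z w) := by
  have hTev : ∀ᶠ y in 𝓝 z, DifferentiableAt ℂ T y :=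
    (hT.eventually (by simp)).mono fun _ hy => hy.differentiableAt (by norm_num)
  have hTR : ContDiffAt ℝ 2 T z := hT.restrict_scalars ℝ
  have hF' : ∀ᶠ y in 𝓝 z, DifferentiableAt ℝ F (T y) :=
    hT.continuousAt.eventually (eventually_differentiableAt_of_contDiffAt hF)
  have h1 : fderiv ℝ (fun y => F (T y)) =ᶠ[𝓝 z]
      fun y => (fderiv ℝ F (T y)).comp ((fderiv ℂ T y).restrictScalars ℝ) := by
    filter_upwards [hTev, hF'] with y hy hy'
    exact (hy'.hasFDerivAt.comp y (hy.hasFDerivAt.restrictScalars ℝ)).fderiv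
  have hT' : DifferentiableAt ℂ (fderiv ℂ T) z :=
    (hT.fderiv_right (m := 1) (by norm_num)).differentiableAt (by norm_num)
  have h2 : HasFDerivAt (fun y => (fderiv ℂ T y).restrictScalars ℝ)
      ((ContinuousLinearMap.restrictScalarsL ℂ E E' ℝ ℝ).comp
        ((fderiv ℂ (fderiv ℂ T) z).restrictScalars ℝ)) z :=
    (ContinuousLinearMap.restrictScalarsL ℂ E E' ℝ ℝ).hasFDerivAt.comp z
      (hT'.hasFDerivAt.restrictScalars ℝ)
  have h3 : HasFDerivAt (fun y => fderiv ℝ F (T y))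
      ((fderiv ℝ (fderiv ℝ F) (T z)).comp ((fderiv ℂ T z).restrictScalars ℝ)) z :=
    (differentiableAt_fderiv_of_contDiffAt hF).hasFDerivAt.comp z
      (hTev.self_of_nhds.hasFDerivAt.restrictScalars ℝ)
  -- The chain rule leaves an extra term dF(D²T(a, b)). As D²T is complex bilinear, it changes sign
  -- when both arguments are multiplied by √-1, and the factor √-1 may sit on either argument; so
  -- the extra term cancels in `leviPart`.
  have h4 : ∀ a b, fderiv ℝ (fderiv ℝ fun y => F (T y)) z a b =
      fderiv ℝ (fderiv ℝ F) (T z) (fderiv ℂ T z a) (fderiv ℂ T z b) +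
        fderiv ℝ F (T z) (fderiv ℂ (fderiv ℂ T) z a b) := by
    intro a b
    rw [h1.fderiv_eq, (h3.clm_comp h2).fderiv]
    simp [add_comm]
  simp only [leviForm, leviPart, h4, map_smul, smul_apply, smul_smul,
    Complex.I_mul_I, neg_one_smul, map_neg]
  push_cast
  ring

lemma leviForm_re (z v w : ℂ) : leviForm Complex.re z v w = 0 := by
  have : fderiv ℝ Complex.re = fun _ => Complex.reCLM := by
    ext1 x; exact Complex.reCLM.hasFDerivAt.fderiv
  simp [leviForm, leviPart, this]

/-- `log |g|²` is pluriharmonic where the holomorphic function `g` has no zero. -/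
lemma leviForm_log_norm_sq {g : E → ℂ} {z : E} (hg : ContDiffAt ℂ 2 g z) (h0 : g z ≠ 0)
    (v w : E) : leviForm (fun y => Real.log (‖g y‖ ^ 2)) z v w = 0 := by
  have hne : ∀ᶠ y in 𝓝 z, g y ≠ 0 := hg.continuousAt.eventually_ne h0
  -- Dividing by g(z) places the argument of the logarithm near 1, away from the branch cut. Only a
  -- constant is lost, and log |g|² becomes twice the real part of a holomorphic function plus that
  -- constant.
  have hT : ContDiffAt ℂ 2 (fun y => Complex.log (g y / g z)) z := by
    refine (Complex.contDiffAt_log ?_).comp z (hg.div_const _)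
    simp [h0]
  have hev : (fun y => Real.log (‖g y‖ ^ 2)) =ᶠ[𝓝 z]
      fun y => 2 * (Complex.log (g y / g z)).re + 2 * Real.log ‖g z‖ := by
    filter_upwards [hne] with y hy
    rw [Complex.log_re, norm_div, Real.log_div (by simpa using hy) (by simpa using h0),
      Real.log_pow]
    push_cast
    ring
  have hre : ContDiffAt ℝ 2 (fun y => (Complex.log (g y / g z)).re) z :=
    Complex.reCLM.contDiff.contDiffAt.comp z (hT.restrict_scalars ℝ)
  rw [leviForm_congr hev, leviForm_add (contDiffAt_const.mul hre) contDiffAt_const,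
    leviForm_const_mul hre, leviForm_const,
    leviForm_comp (F := Complex.re) Complex.reCLM.contDiff.contDiffAt hT, leviForm_re]
  simp

/-- The maximum principle for pluriharmonic functions on a ball. -/
lemma eqOn_ball_of_leviForm_eq_zero {F : E → ℝ} {z : E} {r : ℝ}
    (hF : ∀ y ∈ Metric.ball z r, ContDiffAt ℝ 2 F y)
    (hL : ∀ y ∈ Metric.ball z r, ∀ v w, leviForm F y v w = 0)
    (hmax : ∀ y ∈ Metric.ball z r, F y ≤ F z) :
    ∀ y ∈ Metric.ball z r, F y = F z := by
  intro y hy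
  set u := y - z with hu
  -- The function is restricted to the complex line ζ ↦ z + ζu. With R slightly larger than 1, the
  -- disc |ζ| < R still maps into the ball and contains both ζ = 0 (the point z) and ζ = 1 (the
  -- point y).
  obtain ⟨R, hR1, hR⟩ : ∃ R : ℝ, 1 < R ∧ R * ‖u‖ < r := by
    have hur : ‖u‖ < r := by rwa [Metric.mem_ball, dist_eq_norm] at hy
    have : ∀ᶠ R : ℝ in 𝓝[>] 1, R * ‖u‖ < r := by
      have hc : Tendsto (fun R : ℝ => R * ‖u‖) (𝓝 1) (𝓝 (1 * ‖u‖)) :=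
        (continuous_id.mul continuous_const).tendsto (1 : ℝ)
      exact nhdsWithin_le_nhds (hc.eventually_lt_const (by simpa using hur))
    obtain ⟨R, h1, h2⟩ := (this.and self_mem_nhdsWithin).exists
    exact ⟨R, h2, h1⟩
  let T : ℂ → E := fun ζ => z + ζ • u
  have hTball : ∀ ζ ∈ Metric.ball (0 : ℂ) R, T ζ ∈ Metric.ball z r := by
    intro ζ hζ
    rw [mem_ball_zero_iff] at hζ
    rw [Metric.mem_ball, dist_eq_norm, add_sub_cancel_left, norm_smul]
    exact lt_of_le_of_lt (by gcongr) hR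
  have hT : ContDiff ℂ 2 T := by fun_prop
  let f : ℂ → ℝ := fun ζ => F (T ζ)
  have hfc : ∀ ζ ∈ Metric.ball (0 : ℂ) R, ContDiffAt ℝ 2 f ζ := fun ζ hζ =>
    (hF _ (hTball ζ hζ)).comp ζ (hT.contDiffAt.restrict_scalars ℝ)
  have hharm : InnerProductSpace.HarmonicOnNhd f (Metric.ball 0 R) := by
    intro ζ hζ
    refine ⟨hfc ζ hζ, ?_⟩
    filter_upwards [Metric.isOpen_ball.mem_nhds hζ] with ξ hξ
    -- On ℂ, with both vectors equal to 1, symmetry of the second derivative removes the imaginary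
    -- part and leaves a quarter of the Laplacian of f.
    have h0 : leviForm f ξ 1 1 = 0 := by
      rw [leviForm_comp (hF _ (hTball ξ hξ)) hT.contDiffAt]
      exact hL _ (hTball ξ hξ) _ _
    have hsymm : fderiv ℝ (fderiv ℝ f) ξ 1 Complex.I = fderiv ℝ (fderiv ℝ f) ξ Complex.I 1 :=
      (hfc ξ hξ).isSymmSndFDerivAt (by simp) 1 Complex.I
    rw [InnerProductSpace.laplacian_eq_iteratedFDeriv_complexPlane]
    simp only [iteratedFDeriv_two_apply, Pi.zero_apply, Matrix.cons_val_zero, Matrix.cons_val_one]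
    rw [leviForm, leviPart, smul_eq_mul, mul_one, hsymm, sub_self, mul_zero, add_zero] at h0
    have h0' : (1 / 4 : ℂ) ≠ 0 := by norm_num
    exact_mod_cast (mul_eq_zero.1 h0).resolve_left h0'
  obtain ⟨g, hg, hgf⟩ := hharm.exists_analyticOnNhd_ball_re_eq
  have h0R : (0 : ℂ) ∈ Metric.ball (0 : ℂ) R := by simp; linarith
  have h1R : (1 : ℂ) ∈ Metric.ball (0 : ℂ) R := by simp; linarith
  -- Here f is the real part of a holomorphic g, so |e^g| = e^f has a maximum at the centre and the
  -- maximum modulus principle applies to e^g.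
  have hmaxg : IsMaxOn (norm ∘ fun ζ => Complex.exp (g ζ)) (Metric.ball 0 R) 0 := by
    intro ζ hζ
    simp only [Set.mem_ofPred_eq, Function.comp, Complex.norm_exp]
    have e1 : (g ζ).re = f ζ := hgf hζ
    have e2 : (g 0).re = f 0 := hgf h0R
    rw [e1, e2]
    refine Real.exp_le_exp.2 ((hmax _ (hTball ζ hζ)).trans_eq ?_)
    simp [f, T]
  have := Complex.norm_eqOn_of_isPreconnected_of_isMaxOn
    (convex_ball (0 : ℂ) R).isPreconnected Metric.isOpen_ball
    (fun ζ hζ => ((hg ζ hζ).differentiableAt.cexp).differentiableWithinAt) h0R hmaxg h1R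
  simp only [Function.comp, Function.const_apply, Complex.norm_exp] at this
  have e1 : (g 1).re = f 1 := hgf h1R
  have e2 : (g 0).re = f 0 := hgf h0R
  rw [e1, e2, Real.exp_eq_exp] at this
  simpa [f, T, hu] using this

end Levi

/-! ### Wirtinger derivatives and the Levi form -/

section Wirtinger

open Filter Topology

variable {n : ℕ}

lemma fderiv_ofReal_apply {E : Type*} [NormedAddCommGroup E] [NormedSpace ℝ E] {F : E → ℝ} {z : E}
    (hF : DifferentiableAt ℝ F z) (v : E) :
    fderiv ℝ (fun y => (F y : ℂ)) z v = fderiv ℝ F z v := by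
  have := (Complex.ofRealCLM.hasFDerivAt.comp z hF.hasFDerivAt).fderiv
  change fderiv ℝ (fun y => (F y : ℂ)) z = _ at this
  rw [this]; rfl

/-- Expanding ∂_i ∂̄_j in real partial derivatives produces four second derivatives along e_i, √-1
e_i and e_j, √-1 e_j; these are the four terms of `leviPart`. This links the coordinate definition
of the Hessian to the coordinate-free Levi form. -/
lemma dz_dzbar_eq_leviForm {F : (Fin n → ℂ) → ℝ} {z : Fin n → ℂ} (hF : ContDiffAt ℝ 2 F z)
    (i j : Fin n) :
    dz i (dzbar j fun y => (F y : ℂ)) z = leviForm F z (Pi.single i 1) (Pi.single j 1) := by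
  have h1 : (dzbar j fun y => (F y : ℂ)) =ᶠ[𝓝 z] fun y =>
      (1 / 2 : ℂ) * ((fderiv ℝ F y (Pi.single j 1) : ℝ) +
        Complex.I * (fderiv ℝ F y (Pi.single j Complex.I) : ℝ)) := by
    filter_upwards [eventually_differentiableAt_of_contDiffAt hF] with y hy
    rw [dzbar, fderiv_ofReal_apply hy, fderiv_ofReal_apply hy]
  have hd := differentiableAt_fderiv_of_contDiffAt hF
  have h2 : ∀ v : Fin n → ℂ, HasFDerivAt (fun y => ((fderiv ℝ F y v : ℝ) : ℂ))
      (Complex.ofRealCLM.comp ((fderiv ℝ (fderiv ℝ F) z).flip v)) z := fun v =>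
    Complex.ofRealCLM.hasFDerivAt.comp z (hd.hasFDerivAt.clm_apply (hasFDerivAt_const v z) |>.congr_fderiv (by
      ext w; simp))
  have hI : (Pi.single j Complex.I : Fin n → ℂ) = Complex.I • Pi.single j 1 := by
    rw [← Pi.single_smul, smul_eq_mul, mul_one]
  have hI' : (Pi.single i Complex.I : Fin n → ℂ) = Complex.I • Pi.single i 1 := by
    rw [← Pi.single_smul, smul_eq_mul, mul_one]
  rw [dz, h1.fderiv_eq, (((h2 (Pi.single j 1)).fun_add
    ((h2 (Pi.single j Complex.I)).const_mul Complex.I)).const_mul (1 / 2 : ℂ)).fderiv]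
  simp only [leviForm, leviPart, hI, hI']
  simp only [smul_apply, add_apply,
    ContinuousLinearMap.comp_apply, ContinuousLinearMap.flip_apply, Complex.ofRealCLM_apply,
    smul_eq_mul]
  linear_combination (-1 / 4 * (((fderiv ℝ (fderiv ℝ F) z) (Complex.I • Pi.single i 1))
    (Complex.I • Pi.single j 1) : ℂ)) * Complex.I_mul_I

end Wirtinger

/-! ### Derivatives of determinants and the Green formula on `ℂⁿ` -/

section Determinant

variable {n : ℕ} {W : Type*} [NormedAddCommGroup W] [NormedSpace ℝ W]

lemma det_updateRow_eq_sum (A : Matrix (Fin n) (Fin n) ℂ) (k : Fin n) (v : Fin n → ℂ) :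
    (A.updateRow k v).det = ∑ l, v l * A.adjugate l k := by
  rw [Matrix.det_eq_sum_mul_adjugate_row _ k]
  refine Finset.sum_congr rfl fun l _ => ?_
  rw [Matrix.adjugate_apply, Matrix.adjugate_apply, Matrix.updateRow_self,
    Matrix.updateRow_idem]

/-- The determinant is multilinear in the rows, so its derivative replaces one row at a time;
expanding along the replaced row gives the adjugate. This is Jacobi's formula. -/
lemma hasFDerivAt_det {A : W → Matrix (Fin n) (Fin n) ℂ}
    {A' : Fin n → Fin n → W →L[ℝ] ℂ} {w : W}
    (hA : ∀ k l, HasFDerivAt (fun y => A y k l) (A' k l) w) :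
    HasFDerivAt (fun y => (A y).det) (∑ k, ∑ l, (A w).adjugate l k • A' k l) w := by
  let d : MultilinearMap ℝ (fun _ : Fin n => Fin n → ℂ) ℂ :=
    (Matrix.detRowAlternating (R := ℂ) (n := Fin n)).toMultilinearMap.restrictScalars ℝ
  let D : ContinuousMultilinearMap ℝ (fun _ : Fin n => Fin n → ℂ) ℂ :=
    ⟨d, by
      change Continuous fun M : Fin n → Fin n → ℂ => Matrix.det (Matrix.of M)
      exact Continuous.matrix_det (continuous_id)⟩
  have hA' : HasFDerivAt (fun y => (A y : Fin n → Fin n → ℂ))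
      (ContinuousLinearMap.pi fun k => ContinuousLinearMap.pi fun l => A' k l) w :=
    hasFDerivAt_pi.2 fun k => hasFDerivAt_pi.2 fun l => hA k l
  have := (D.hasFDerivAt (A w)).comp w hA'
  refine this.congr_fderiv ?_
  ext v
  change D.linearDeriv (A w) (fun k l => A' k l v) = _
  refine (ContinuousMultilinearMap.linearDeriv_apply D _ _).trans ?_
  simp only [sum_apply, smul_apply, smul_eq_mul]
  refine Finset.sum_congr rfl fun k _ => ?_
  have := det_updateRow_eq_sum (A w) k (fun l => A' k l v)
  refine Eq.trans (Eq.trans ?_ this) (Finset.sum_congr rfl fun l _ => mul_comm _ _)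
  rfl

/-- The first order operator `(∂_a + c ∂_b) / 2`. -/
def wirt (c : ℂ) (a b : W) (F : W → ℂ) (z : W) : ℂ :=
  (1 / 2) * (fderiv ℝ F z a + c * fderiv ℝ F z b)

open Filter Topology

lemma wirt_congr {c : ℂ} {a b : W} {F G : W → ℂ} {z : W} (h : F =ᶠ[𝓝 z] G) :
    wirt c a b F z = wirt c a b G z := by
  rw [wirt, wirt, h.fderiv_eq]

lemma wirt_sum {ι : Type*} (s : Finset ι) {c : ℂ} {a b : W} {F : ι → W → ℂ} {z : W}
    (h : ∀ i ∈ s, DifferentiableAt ℝ (F i) z) :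
    wirt c a b (fun y => ∑ i ∈ s, F i y) z = ∑ i ∈ s, wirt c a b (F i) z := by
  simp only [wirt]
  rw [fderiv_fun_sum h]
  simp only [sum_apply, Finset.mul_sum, ← Finset.sum_add_distrib]

lemma wirt_mul {c : ℂ} {a b : W} {F G : W → ℂ} {z : W} (hF : DifferentiableAt ℝ F z)
    (hG : DifferentiableAt ℝ G z) :
    wirt c a b (fun y => F y * G y) z = wirt c a b F z * G z + F z * wirt c a b G z := by
  simp only [wirt]
  rw [fderiv_fun_mul hF hG]
  simp only [add_apply, smul_apply, smul_eq_mul]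
  ring

lemma wirt_const (c : ℂ) (a b : W) (x : ℂ) (z : W) : wirt c a b (fun _ => x) z = 0 := by
  simp [wirt]

lemma contDiffAt_wirt {c : ℂ} {a b : W} {F : W → ℂ} {z : W} (hF : ContDiffAt ℝ ∞ F z) :
    ContDiffAt ℝ ∞ (wirt c a b F) z := by
  have h : ContDiffAt ℝ ∞ (fderiv ℝ F) z := hF.fderiv_right (by simp)
  exact contDiffAt_const.mul ((h.clm_apply contDiffAt_const).add
    (contDiffAt_const.mul (h.clm_apply contDiffAt_const)))

lemma fderiv_wirt_apply {c : ℂ} {a b : W} {F : W → ℂ} {z : W} (hF : ContDiffAt ℝ 2 F z) (v : W) :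
    fderiv ℝ (wirt c a b F) z v =
      (1 / 2) * (fderiv ℝ (fderiv ℝ F) z v a + c * fderiv ℝ (fderiv ℝ F) z v b) := by
  have hd : DifferentiableAt ℝ (fderiv ℝ F) z :=
    (hF.fderiv_right (m := 1) (by norm_num)).differentiableAt (by norm_num)
  have h : ∀ a, HasFDerivAt (fun y => fderiv ℝ F y a) ((fderiv ℝ (fderiv ℝ F) z).flip a) z :=
    fun a => (hd.hasFDerivAt.clm_apply (hasFDerivAt_const a z)).congr_fderiv (by ext w; simp)
  have := (((h a).fun_add ((h b).const_mul c)).const_mul (1 / 2 : ℂ)).fderiv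
  change fderiv ℝ (wirt c a b F) z = _ at this
  rw [this]
  simp only [add_apply, smul_apply, smul_eq_mul, ContinuousLinearMap.flip_apply]

/-- Both operators have constant coefficients, so symmetry of the second derivative is enough. -/
lemma wirt_comm {c c' : ℂ} {a b a' b' : W} {F : W → ℂ} {z : W} (hF : ContDiffAt ℝ 2 F z) :
    wirt c a b (wirt c' a' b' F) z = wirt c' a' b' (wirt c a b F) z := by
  have hs := hF.isSymmSndFDerivAt (by simp)
  rw [wirt, wirt, fderiv_wirt_apply hF, fderiv_wirt_apply hF, fderiv_wirt_apply hF,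
    fderiv_wirt_apply hF, hs a a', hs a b', hs b a', hs b b']
  ring

lemma wirt_det {A : W → Matrix (Fin n) (Fin n) ℂ} {c : ℂ} {a b w : W}
    (hA : ∀ k l, DifferentiableAt ℝ (fun y => A y k l) w) :
    wirt c a b (fun y => (A y).det) w =
      ∑ k, ((A w).updateRow k fun l => wirt c a b (fun y => A y k l) w).det := by
  rw [wirt, (hasFDerivAt_det fun k l => (hA k l).hasFDerivAt).fderiv]
  simp only [det_updateRow_eq_sum, sum_apply, smul_apply, smul_eq_mul, wirt,
    Finset.mul_sum, ← Finset.sum_add_distrib]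
  refine Finset.sum_congr rfl fun k _ => Finset.sum_congr rfl fun l _ => ?_
  ring

/-- The two matrices differ by exchanging rows i and k. This sign drives the cancellation in
`sum_wirt_adjugate`. -/
lemma det_swap_updateRow (A : Matrix (Fin n) (Fin n) ℂ) {i k : Fin n} (h : k ≠ i)
    (e v : Fin n → ℂ) :
    ((A.updateRow i e).updateRow k v).det = -((A.updateRow k e).updateRow i v).det := by
  have hs : ((A.updateRow k e).updateRow i v).submatrix (Equiv.swap i k) id =
      (A.updateRow i e).updateRow k v := by
    ext r l
    rw [Matrix.submatrix_apply, id]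
    rcases eq_or_ne r i with rfl | hi
    · rw [Equiv.swap_apply_left, Matrix.updateRow_ne h, Matrix.updateRow_self,
        Matrix.updateRow_ne h.symm, Matrix.updateRow_self]
    · rcases eq_or_ne r k with rfl | hk
      · rw [Equiv.swap_apply_right, Matrix.updateRow_self, Matrix.updateRow_self]
      · rw [Equiv.swap_apply_of_ne_of_ne hi hk, Matrix.updateRow_ne hi, Matrix.updateRow_ne hk,
          Matrix.updateRow_ne hk, Matrix.updateRow_ne hi]
  rw [← hs, Matrix.det_permute, Equiv.Perm.sign_swap h.symm]
  simp

/-- The adjugate of a matrix field which is symmetric in the derivative and the row index is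
free of divergence. -/
lemma sum_wirt_adjugate {A : W → Matrix (Fin n) (Fin n) ℂ} {c : ℂ} {a b : Fin n → W} {w : W}
    (hA : ∀ k l, DifferentiableAt ℝ (fun y => A y k l) w)
    (hsymm : ∀ i k l, wirt c (a i) (b i) (fun y => A y k l) w =
      wirt c (a k) (b k) (fun y => A y i l) w) (j : Fin n) :
    ∑ i, wirt c (a i) (b i) (fun y => (A y).adjugate j i) w = 0 := by
  -- The entry f i k is the contribution to the i-th term in which the derivative falls on row k.
  -- For k = i it is zero, because row i has been replaced by a constant vector.
  let f : Fin n → Fin n → ℂ := fun i k => if k = i then 0 else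
    (((A w).updateRow i (Pi.single j 1)).updateRow k
      fun l => wirt c (a i) (b i) (fun y => A y k l) w).det
  have h1 : ∀ i, wirt c (a i) (b i) (fun y => (A y).adjugate j i) w = ∑ k, f i k := by
    intro i
    simp only [Matrix.adjugate_apply]
    have hne : ∀ k, k ≠ i → ∀ l, (fun y => (A y).updateRow i (Pi.single j 1) k l) =
        fun y => A y k l := by
      intro k hk l; ext y; rw [Matrix.updateRow_ne hk]
    have heq : ∀ l, (fun y => (A y).updateRow i (Pi.single j 1) i l) =
        fun _ => (Pi.single j 1 : Fin n → ℂ) l := by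
      intro l; ext y; rw [Matrix.updateRow_self]
    rw [wirt_det]
    · refine Finset.sum_congr rfl fun k _ => ?_
      by_cases hk : k = i
      · subst hk
        simp only [f, if_true, heq, wirt_const]
        exact Matrix.det_eq_zero_of_row_eq_zero k fun l => by rw [Matrix.updateRow_self]
      · simp only [f, if_neg hk, hne k hk]
    · intro k l
      by_cases hk : k = i
      · subst hk; rw [heq]; exact differentiableAt_const _
      · rw [hne k hk]; exact hA k l
  -- Exchanging the two rows changes the sign, while `hsymm` exchanges the derivative index with the
  -- row index. The double sum is then its own negative.
  have h2 : ∀ i k, f i k = -f k i := by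
    intro i k
    by_cases hk : k = i
    · simp [f, hk]
    · simp only [f, if_neg hk, if_neg (Ne.symm hk)]
      rw [det_swap_updateRow _ hk]
      simp only [hsymm i k]
  have h3 : ∑ i, ∑ k, f i k = -∑ i, ∑ k, f i k := by
    conv_lhs => rw [Finset.sum_comm]
    rw [← Finset.sum_neg_distrib]
    refine Finset.sum_congr rfl fun i _ => ?_
    rw [← Finset.sum_neg_distrib]
    exact Finset.sum_congr rfl fun k _ => h2 _ _
  rw [Finset.sum_congr rfl fun i _ => h1 i]
  exact self_eq_neg.1 h3

lemma contDiffAt_matrix_det {A : W → Matrix (Fin n) (Fin n) ℂ} {w : W} {m : WithTop ℕ∞}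
    (hA : ∀ k l, ContDiffAt ℝ m (fun y => A y k l) w) :
    ContDiffAt ℝ m (fun y => (A y).det) w := by
  simp only [Matrix.det_apply, Units.smul_def, zsmul_eq_mul]
  exact ContDiffAt.sum fun σ _ => contDiffAt_const.mul (contDiffAt_prod fun i _ => hA _ _)

lemma contDiffAt_adjugate {A : W → Matrix (Fin n) (Fin n) ℂ} {w : W} {m : WithTop ℕ∞}
    (hA : ∀ k l, ContDiffAt ℝ m (fun y => A y k l) w) (i j : Fin n) :
    ContDiffAt ℝ m (fun y => (A y).adjugate i j) w := by
  simp only [Matrix.adjugate_apply]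
  refine contDiffAt_matrix_det fun k l => ?_
  by_cases hk : k = j
  · subst hk; simp only [Matrix.updateRow_self]; exact contDiffAt_const
  · simp only [Matrix.updateRow_ne hk]; exact hA k l

end Determinant

/-! ### Integration by parts on ℂⁿ -/

section Green

open Filter Topology

variable {n : ℕ}

lemma dz_eq_wirt (i : Fin n) (F : (Fin n → ℂ) → ℂ) :
    dz i F = wirt (-Complex.I) (Pi.single i 1) (Pi.single i Complex.I) F := by
  ext z; rw [dz, wirt]; ring

lemma dzbar_eq_wirt (i : Fin n) (F : (Fin n → ℂ) → ℂ) :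
    dzbar i F = wirt Complex.I (Pi.single i 1) (Pi.single i Complex.I) F := rfl

/-- Integration by parts against the constant function 1; there is no boundary term because of the
compact support. -/
lemma integral_wirt_eq_zero {W : Type*} [NormedAddCommGroup W] [NormedSpace ℝ W]
    [FiniteDimensional ℝ W] [MeasurableSpace W] [BorelSpace W] {μ : Measure W}
    [μ.IsAddHaarMeasure] (c : ℂ) (a b : W) {F : W → ℂ}
    (hF : ContDiff ℝ 1 F) (hc : HasCompactSupport F) :
    Integrable (wirt c a b F) μ ∧ ∫ z, wirt c a b F z ∂μ = 0 := by
  have hi : ∀ v, Integrable (fun z => fderiv ℝ F z v) μ := fun v =>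
    ((hF.continuous_fderiv (by norm_num)).clm_apply continuous_const).integrable_of_hasCompactSupport
      (hc.fderiv_apply ℝ v)
  have h0 : ∀ v, ∫ z, fderiv ℝ F z v ∂μ = 0 := by
    intro v
    have := integral_mul_fderiv_eq_neg_fderiv_mul_of_integrable (μ := μ) (f := fun _ => (1 : ℂ))
      (g := F) (v := v) (by simp) (by simpa using hi v)
      (by simpa using hF.continuous.integrable_of_hasCompactSupport hc)
      (fun x _ => differentiableAt_const _) (fun x _ => (hF.differentiable (by norm_num)) x)
    simpa using this
  refine ⟨((hi a).add ((hi b).const_mul c)).const_mul _, ?_⟩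
  simp only [wirt]
  rw [integral_const_mul, integral_add (hi a) ((hi b).const_mul c), integral_const_mul, h0, h0]
  simp

/-- The complex Hessian on `ℂⁿ`. -/
def hessMat (F : (Fin n → ℂ) → ℝ) (z : Fin n → ℂ) : Matrix (Fin n) (Fin n) ℂ :=
  Matrix.of fun i j => dz i (dzbar j fun y => (F y : ℂ)) z

/-- Off its closed support the function vanishes locally. This makes globally smooth functions out
of products with a cut-off whose other factors are smooth only on an open set. -/
lemma contDiff_of_tsupport {W V : Type*} [NormedAddCommGroup W] [NormedSpace ℝ W]
    [NormedAddCommGroup V] [NormedSpace ℝ V] {F : W → V} {m : WithTop ℕ∞}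
    (h : ∀ z ∈ tsupport F, ContDiffAt ℝ m F z) : ContDiff ℝ m F := by
  refine contDiff_iff_contDiffAt.2 fun z => ?_
  by_cases hz : z ∈ tsupport F
  · exact h z hz
  · exact contDiffAt_const.congr_of_eventuallyEq (notMem_tsupport_iff_eventuallyEq.1 hz)

lemma contDiffAt_ofReal_comp {W : Type*} [NormedAddCommGroup W] [NormedSpace ℝ W]
    {F : W → ℝ} {z : W} {m : WithTop ℕ∞} (hF : ContDiffAt ℝ m F z) :
    ContDiffAt ℝ m (fun y => (F y : ℂ)) z :=
  Complex.ofRealCLM.contDiff.contDiffAt.comp z hF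

lemma contDiffAt_hessMat {F : (Fin n → ℂ) → ℝ} {z : Fin n → ℂ} (hF : ContDiffAt ℝ ∞ F z)
    (i j : Fin n) : ContDiffAt ℝ ∞ (fun y => hessMat F y i j) z := by
  simp only [hessMat, Matrix.of_apply, dz_eq_wirt, dzbar_eq_wirt]
  exact contDiffAt_wirt (contDiffAt_wirt (contDiffAt_ofReal_comp hF))

/-- The Green formula on `ℂⁿ` for the operator `adj(∂∂̄P)^{ij} ∂ᵢ∂̄ⱼ`. -/
theorem integral_mul_trace_adjugate_hessMat {U : Set (Fin n → ℂ)} (hU : IsOpen U)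
    {P u v : (Fin n → ℂ) → ℝ} (hP : ∀ z ∈ U, ContDiffAt ℝ ∞ P z)
    (hv : ∀ z ∈ U, ContDiffAt ℝ ∞ v z) (hu : ∀ z ∈ U, ContDiffAt ℝ ∞ u z)
    (hc : HasCompactSupport u) (hsub : tsupport u ⊆ U) :
    ∫ z, (u z : ℂ) * ((hessMat P z).adjugate * hessMat v z).trace =
      ∫ z, (v z : ℂ) * ((hessMat P z).adjugate * hessMat u z).trace := by
  have hu' : ContDiff ℝ ∞ (fun z => (u z : ℂ)) :=
    Complex.ofRealCLM.contDiff.comp (contDiff_of_tsupport fun z hz => hu z (hsub hz))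
  set uc : (Fin n → ℂ) → ℂ := fun z => (u z : ℂ) with huc
  set vc : (Fin n → ℂ) → ℂ := fun z => (v z : ℂ) with hvc
  set Pc : (Fin n → ℂ) → ℂ := fun z => (P z : ℂ) with hPc
  have htc : tsupport uc ⊆ tsupport u := by
    refine closure_mono fun z hz => ?_
    simpa [huc] using hz
  have hcc : HasCompactSupport uc := hc.of_isClosed_subset (isClosed_tsupport _) htc
  have hvc' : ∀ z ∈ U, ContDiffAt ℝ ∞ vc z := fun z hz => contDiffAt_ofReal_comp (hv z hz)
  have hPc' : ∀ z ∈ U, ContDiffAt ℝ ∞ Pc z := fun z hz => contDiffAt_ofReal_comp (hP z hz)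
  have hadj : ∀ z ∈ U, ∀ j i, ContDiffAt ℝ ∞ (fun y => (hessMat P y).adjugate j i) z :=
    fun z hz j i => contDiffAt_adjugate (contDiffAt_hessMat (hP z hz)) j i
  have htop1 : (1 : WithTop ℕ∞) ≤ ∞ := by simp
  have htop2 : (2 : WithTop ℕ∞) ≤ ∞ := WithTop.coe_le_coe.2 le_top
  have hne : (∞ : WithTop ℕ∞) ≠ 0 := by simp
  let a : Fin n → Fin n → ℂ := fun i => Pi.single i 1
  let b : Fin n → Fin n → ℂ := fun i => Pi.single i Complex.I
  -- With A the adjugate of the Hessian of P, the fields are G_i = u ∑_j A_{ji} ∂̄_j v and H_j = v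
  -- ∑_i A_{ji} ∂_i u. In ∑ ∂_i G_i - ∑ ∂̄_j H_j the terms with one derivative on each of u and v
  -- cancel, the derivatives of A sum to zero, and the difference of the two integrands remains.
  let G : Fin n → (Fin n → ℂ) → ℂ := fun i z =>
    uc z * ∑ j, (hessMat P z).adjugate j i * wirt Complex.I (a j) (b j) vc z
  let H : Fin n → (Fin n → ℂ) → ℂ := fun j z =>
    ∑ i, ((hessMat P z).adjugate j i * wirt (-Complex.I) (a i) (b i) uc z) * vc z
  have hdu0 : ∀ z ∉ tsupport uc, ∀ c a b, wirt c a b uc z = 0 := by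
    intro z hz c a b
    have : uc =ᶠ[𝓝 z] fun _ => 0 := notMem_tsupport_iff_eventuallyEq.1 hz
    rw [wirt_congr this, wirt_const]
  have hsuppG : ∀ i, tsupport (G i) ⊆ tsupport uc := fun i => tsupport_mul_subset_left
  have hsuppH : ∀ j, tsupport (H j) ⊆ tsupport uc := by
    intro j
    refine closure_minimal (fun z hz => ?_) (isClosed_tsupport _)
    by_contra hz'
    exact hz (by simp [H, hdu0 z hz'])
  have hGd : ∀ i, ContDiff ℝ ∞ (G i) := by
    intro i
    refine contDiff_of_tsupport fun z hz => ?_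
    have hzU : z ∈ U := hsub (htc (hsuppG i hz))
    exact hu'.contDiffAt.mul (ContDiffAt.sum fun j _ =>
      (hadj z hzU j i).mul (contDiffAt_wirt (hvc' z hzU)))
  have hHd : ∀ j, ContDiff ℝ ∞ (H j) := by
    intro j
    refine contDiff_of_tsupport fun z hz => ?_
    have hzU : z ∈ U := hsub (htc (hsuppH j hz))
    exact ContDiffAt.sum fun i _ => ((hadj z hzU j i).mul
      (contDiffAt_wirt hu'.contDiffAt)).mul (hvc' z hzU)
  have hGi := fun i => integral_wirt_eq_zero (μ := volume) (-Complex.I) (a i) (b i)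
    ((hGd i).of_le htop1) (hcc.of_isClosed_subset (isClosed_tsupport _) (hsuppG i))
  have hHi := fun j => integral_wirt_eq_zero (μ := volume) Complex.I (a j) (b j)
    ((hHd j).of_le htop1) (hcc.of_isClosed_subset (isClosed_tsupport _) (hsuppH j))
  -- the divergence of the difference
  have hdiv : ∀ z, uc z * ((hessMat P z).adjugate * hessMat v z).trace =
      vc z * ((hessMat P z).adjugate * hessMat u z).trace +
        (∑ i, wirt (-Complex.I) (a i) (b i) (G i) z - ∑ j, wirt Complex.I (a j) (b j) (H j) z) := by
    intro z
    by_cases hz : z ∈ tsupport uc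
    swap
    · have h1 : uc z = 0 := image_eq_zero_of_notMem_tsupport hz
      have h2 : hessMat u z = 0 := by
        ext i j
        have : uc =ᶠ[𝓝 z] fun _ => 0 := notMem_tsupport_iff_eventuallyEq.1 hz
        have h3 : wirt Complex.I (a j) (b j) uc =ᶠ[𝓝 z] fun _ => 0 := by
          filter_upwards [(isClosed_tsupport uc).isOpen_compl.mem_nhds hz] with y hy
          exact hdu0 y hy _ _ _
        rw [hessMat, Matrix.of_apply, dz_eq_wirt, dzbar_eq_wirt, wirt_congr h3, wirt_const]
        rfl
      have h3 : ∀ i, wirt (-Complex.I) (a i) (b i) (G i) z = 0 := by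
        intro i
        have : G i =ᶠ[𝓝 z] fun _ => 0 :=
          notMem_tsupport_iff_eventuallyEq.1 fun h => hz (hsuppG i h)
        rw [wirt_congr this, wirt_const]
      have h4 : ∀ i, wirt Complex.I (a i) (b i) (H i) z = 0 := by
        intro i
        have : H i =ᶠ[𝓝 z] fun _ => 0 :=
          notMem_tsupport_iff_eventuallyEq.1 fun h => hz (hsuppH i h)
        rw [wirt_congr this, wirt_const]
      simp [h1, h2, h3, h4]
    · have hzU : z ∈ U := hsub (htc hz)
      have dA : ∀ k l, DifferentiableAt ℝ (fun y => hessMat P y k l) z := fun k l =>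
        (contDiffAt_hessMat (hP z hzU) k l).differentiableAt hne
      have dadj : ∀ j i, DifferentiableAt ℝ (fun y => (hessMat P y).adjugate j i) z := fun j i =>
        (hadj z hzU j i).differentiableAt hne
      have dv : ∀ c a b, DifferentiableAt ℝ (wirt c a b vc) z := fun c a b =>
        (contDiffAt_wirt (hvc' z hzU)).differentiableAt hne
      have du : ∀ c a b, DifferentiableAt ℝ (wirt c a b uc) z := fun c a b =>
        (contDiffAt_wirt hu'.contDiffAt).differentiableAt hne
      have du0 : DifferentiableAt ℝ uc z := hu'.contDiffAt.differentiableAt hne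
      have dv0 : DifferentiableAt ℝ vc z := (hvc' z hzU).differentiableAt hne
      have hP2 : ∀ᶠ y in 𝓝 z, ContDiffAt ℝ 2 Pc y := by
        filter_upwards [hU.mem_nhds hzU] with y hy
        exact (hPc' y hy).of_le htop2
      -- the divergence of the adjugate
      have p1 : ∀ j, ∑ i, wirt (-Complex.I) (a i) (b i) (fun y => (hessMat P y).adjugate j i) z
          = 0 := by
        refine sum_wirt_adjugate dA fun i k l => ?_
        simp only [hessMat, Matrix.of_apply, dz_eq_wirt, dzbar_eq_wirt]
        exact wirt_comm ((contDiffAt_wirt (hPc' z hzU)).of_le htop2)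
      -- Transposition exchanges the roles of the holomorphic and antiholomorphic indices. The
      -- required symmetry is now that of ∂̄_r ∂̄_k, after commuting ∂̄_r past ∂_l.
      have p2 : ∀ i, ∑ j, wirt Complex.I (a j) (b j) (fun y => (hessMat P y).adjugate j i) z
          = 0 := by
        intro i
        have : ∀ j, (fun y => (hessMat P y).adjugate j i) =
            fun y => ((hessMat P y).transpose).adjugate i j := by
          intro j; ext y; rw [← Matrix.adjugate_transpose]; rfl
        simp only [this]
        refine sum_wirt_adjugate (fun k l => dA l k) (fun r k l => ?_) i
        simp only [hessMat, Matrix.of_apply, dz_eq_wirt, dzbar_eq_wirt]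
        have c1 : ∀ r, wirt (-Complex.I) (a l) (b l) (wirt Complex.I (a r) (b r) Pc) =ᶠ[𝓝 z]
            wirt Complex.I (a r) (b r) (wirt (-Complex.I) (a l) (b l) Pc) := by
          intro r
          filter_upwards [hP2] with y hy
          exact wirt_comm hy
        rw [wirt_congr (c1 k), wirt_congr (c1 r)]
        exact wirt_comm ((contDiffAt_wirt (hPc' z hzU)).of_le htop2)
      have e1 : ∀ i, wirt (-Complex.I) (a i) (b i) (G i) z =
          ∑ j, (wirt (-Complex.I) (a i) (b i) uc z *
              ((hessMat P z).adjugate j i * wirt Complex.I (a j) (b j) vc z) +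
            uc z * (wirt (-Complex.I) (a i) (b i) (fun y => (hessMat P y).adjugate j i) z *
              wirt Complex.I (a j) (b j) vc z) +
            uc z * ((hessMat P z).adjugate j i *
              wirt (-Complex.I) (a i) (b i) (wirt Complex.I (a j) (b j) vc) z)) := by
        intro i
        rw [wirt_mul du0 (DifferentiableAt.fun_sum fun j _ => (dadj j i).fun_mul (dv _ _ _)),
          wirt_sum _ fun j _ => (dadj j i).fun_mul (dv _ _ _), Finset.mul_sum, Finset.mul_sum,
          ← Finset.sum_add_distrib]
        refine Finset.sum_congr rfl fun j _ => ?_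
        rw [wirt_mul (dadj j i) (dv _ _ _)]
        ring
      have e2 : ∀ j, wirt Complex.I (a j) (b j) (H j) z =
          ∑ i, ((wirt Complex.I (a j) (b j) (fun y => (hessMat P y).adjugate j i) z *
              wirt (-Complex.I) (a i) (b i) uc z) * vc z +
            ((hessMat P z).adjugate j i *
              wirt (-Complex.I) (a i) (b i) (wirt Complex.I (a j) (b j) uc) z) * vc z +
            wirt (-Complex.I) (a i) (b i) uc z *
              ((hessMat P z).adjugate j i * wirt Complex.I (a j) (b j) vc z)) := by
        intro j
        rw [wirt_sum _ fun i _ => ((dadj j i).fun_mul (du _ _ _)).fun_mul dv0]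
        refine Finset.sum_congr rfl fun i _ => ?_
        rw [wirt_mul ((dadj j i).fun_mul (du _ _ _)) dv0, wirt_mul (dadj j i) (du _ _ _),
          wirt_comm (hu'.contDiffAt.of_le htop2)]
        ring
      have t : ∀ w : (Fin n → ℂ) → ℝ, ((hessMat P z).adjugate * hessMat w z).trace =
          ∑ i, ∑ j, (hessMat P z).adjugate j i * wirt (-Complex.I) (a i) (b i)
            (wirt Complex.I (a j) (b j) fun y => (w y : ℂ)) z := by
        intro w
        rw [Matrix.trace, Finset.sum_comm]
        refine Finset.sum_congr rfl fun j _ => ?_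
        rw [Matrix.diag_apply, Matrix.mul_apply]
        simp only [hessMat, Matrix.of_apply, dz_eq_wirt, dzbar_eq_wirt, a, b]
      have z1 : ∑ i, ∑ j, uc z * (wirt (-Complex.I) (a i) (b i)
          (fun y => (hessMat P y).adjugate j i) z * wirt Complex.I (a j) (b j) vc z) = 0 := by
        rw [Finset.sum_comm]
        refine Finset.sum_eq_zero fun j _ => ?_
        rw [← Finset.mul_sum, ← Finset.sum_mul, p1 j]
        simp
      have z2 : ∑ j, ∑ i, (wirt Complex.I (a j) (b j) (fun y => (hessMat P y).adjugate j i) z *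
          wirt (-Complex.I) (a i) (b i) uc z) * vc z = 0 := by
        rw [Finset.sum_comm]
        refine Finset.sum_eq_zero fun i _ => ?_
        rw [← Finset.sum_mul, ← Finset.sum_mul, p2 i]
        simp
      rw [Finset.sum_congr rfl fun i _ => e1 i, Finset.sum_congr rfl fun j _ => e2 j, t u, t v]
      simp only [Finset.sum_add_distrib]
      rw [z1, z2]
      simp only [Finset.mul_sum]
      rw [Finset.sum_comm (f := fun j i => wirt (-Complex.I) (a i) (b i) uc z *
        ((hessMat P z).adjugate j i * wirt Complex.I (a j) (b j) vc z)),
        Finset.sum_comm (f := fun j i => ((hessMat P z).adjugate j i *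
              wirt (-Complex.I) (a i) (b i) (wirt Complex.I (a j) (b j) uc) z) * vc z)]
      have comm : ∀ i j, ((hessMat P z).adjugate j i *
              wirt (-Complex.I) (a i) (b i) (wirt Complex.I (a j) (b j) uc) z) * vc z =
          vc z * ((hessMat P z).adjugate j i *
              wirt (-Complex.I) (a i) (b i) (wirt Complex.I (a j) (b j) uc) z) :=
        fun i j => mul_comm _ _
      simp only [comm]
      ring
  have hdivint : ∫ z, (∑ i, wirt (-Complex.I) (a i) (b i) (G i) z -
      ∑ j, wirt Complex.I (a j) (b j) (H j) z) = 0 := by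
    rw [integral_sub (integrable_finsetSum _ fun i _ => (hGi i).1)
      (integrable_finsetSum _ fun i _ => (hHi i).1),
      integral_finsetSum _ fun i _ => (hGi i).1, integral_finsetSum _ fun i _ => (hHi i).1]
    simp [(hGi _).2, (hHi _).2]
  have hdi : Integrable (fun z => ∑ i, wirt (-Complex.I) (a i) (b i) (G i) z -
      ∑ j, wirt Complex.I (a j) (b j) (H j) z) :=
    (integrable_finsetSum _ fun i _ => (hGi i).1).sub
      (integrable_finsetSum _ fun i _ => (hHi i).1)
  -- The two integrands differ by an integrable function of integral zero. So they are integrable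
  -- together; otherwise both integrals are 0 by convention.
  by_cases hint : Integrable fun z => vc z * ((hessMat P z).adjugate * hessMat u z).trace
  · rw [integral_congr_ae (Eventually.of_forall hdiv), integral_add hint hdi, hdivint, add_zero]
  · rw [integral_undef hint, integral_undef]
    intro h
    refine hint ((h.sub hdi).congr (Eventually.of_forall fun z => ?_))
    simp only [Pi.sub_apply]
    rw [hdiv z]
    ring

end Green

/-! ### Functions and Hessians in charts -/

section Charts

open Filter Topology

section General

variable {𝕜 E V : Type*} [NontriviallyNormedField 𝕜] [NormedAddCommGroup E] [NormedSpace 𝕜 E]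
  [NormedAddCommGroup V] [NormedSpace 𝕜 V]
  {X : Type*} [TopologicalSpace X] [ChartedSpace E X] {m : WithTop ℕ∞} [IsManifold 𝓘(𝕜, E) m X]

lemma contMDiffAt_chart_symm {c : OpenPartialHomeomorph X E} (hc : c ∈ atlas E X) {x : X}
    (hx : x ∈ c.source) : ContMDiffAt 𝓘(𝕜, E) 𝓘(𝕜, E) m c.symm (c x) :=
  contMDiffAt_symm_of_mem_maximalAtlas (IsManifold.subset_maximalAtlas hc) (c.map_source hx)

lemma contMDiffAt_chart {c : OpenPartialHomeomorph X E} (hc : c ∈ atlas E X) {x : X}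
    (hx : x ∈ c.source) : ContMDiffAt 𝓘(𝕜, E) 𝓘(𝕜, E) m c x :=
  contMDiffAt_of_mem_maximalAtlas (IsManifold.subset_maximalAtlas hc) hx

lemma contMDiffAt_iff_chart {c : OpenPartialHomeomorph X E} (hc : c ∈ atlas E X) {x : X}
    (hx : x ∈ c.source) {f : X → V} :
    ContMDiffAt 𝓘(𝕜, E) 𝓘(𝕜, V) m f x ↔ ContDiffAt 𝕜 m (fun z => f (c.symm z)) (c x) := by
  constructor
  · intro h
    rw [← contMDiffAt_iff_contDiffAt]
    refine ContMDiffAt.comp (c x) (I' := 𝓘(𝕜, E)) (g := f) ?_ (contMDiffAt_chart_symm hc hx)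
    rwa [c.left_inv hx]
  · intro h
    have h2 := ContMDiffAt.comp x (I' := 𝓘(𝕜, E)) (g := fun z => f (c.symm z)) (f := c)
      (contMDiffAt_iff_contDiffAt.2 h) (contMDiffAt_chart hc hx)
    refine h2.congr_of_eventuallyEq ?_
    filter_upwards [c.open_source.mem_nhds hx] with y hy
    simp [c.left_inv hy]

lemma contDiffAt_chart_comp {f : X → X} {c c' : OpenPartialHomeomorph X E} (hc : c ∈ atlas E X)
    (hc' : c' ∈ atlas E X) {x : X} (hx : x ∈ c.source) (hfx : f x ∈ c'.source)
    (hf : ContMDiffAt 𝓘(𝕜, E) 𝓘(𝕜, E) m f x) :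
    ContDiffAt 𝕜 m (fun z => c' (f (c.symm z))) (c x) := by
  rw [← contMDiffAt_iff_chart (f := fun y => c' (f y)) hc hx]
  exact ContMDiffAt.comp x (I' := 𝓘(𝕜, E)) (g := c') (contMDiffAt_chart hc' hfx) hf

end General

variable {n : ℕ} {X : Type*} [TopologicalSpace X] [ChartedSpace (Fin n → ℂ) X]
  [IsManifold 𝓘(ℂ, Fin n → ℂ) ω X]

variable (n X) in
/-- The smooth manifold that underlies a complex manifold. -/
theorem isManifold_real : IsManifold 𝓘(ℝ, Fin n → ℂ) ∞ X := by
  refine isManifold_of_contDiffOn _ _ _ fun e e' he he' => ?_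
  have h := HasGroupoid.compatible (G := contDiffGroupoid ω 𝓘(ℂ, Fin n → ℂ)) he he'
  rw [contDiffGroupoid, mem_groupoid_of_pregroupoid] at h
  have h1 : ContDiffOn ℂ ω _ _ := h.1
  exact (h1.of_le le_top).restrict_scalars ℝ

/-- The matrix of `∑ aₖₗ (J v)ₖ (J w)ₗ‾` is `Jᵀ A J̄`. -/
lemma hermForm_mul (A J : Matrix (Fin n) (Fin n) ℂ) (i j : Fin n) :
    hermForm A (fun k => J k i) (fun l => J l j) =
      (J.transpose * A * J.map (starRingEnd ℂ)) i j := by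
  rw [hermForm, Finset.sum_comm, Matrix.mul_apply]
  refine Finset.sum_congr rfl fun l _ => ?_
  rw [Matrix.mul_apply, Finset.sum_mul]
  refine Finset.sum_congr rfl fun k _ => ?_
  rw [Matrix.transpose_apply, Matrix.map_apply]
  ring

lemma complexHess_eq_hessMat (c : OpenPartialHomeomorph X (Fin n → ℂ)) (f : X → ℝ) (x : X) :
    complexHess c f x = hessMat (fun z => f (c.symm z)) (c x) := rfl

/-- Real smoothness at a point. -/
abbrev SmoothAt (f : X → ℝ) (x : X) : Prop :=
  ContMDiffAt 𝓘(ℝ, Fin n → ℂ) 𝓘(ℝ, ℝ) ∞ f x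

lemma smoothAt_iff {c : OpenPartialHomeomorph X (Fin n → ℂ)} (hc : c ∈ atlas (Fin n → ℂ) X)
    {x : X} (hx : x ∈ c.source) {f : X → ℝ} :
    SmoothAt (n := n) f x ↔ ContDiffAt ℝ ∞ (fun z => f (c.symm z)) (c x) := by
  have := isManifold_real n X
  exact contMDiffAt_iff_chart hc hx

lemma two_le_infty : (2 : WithTop ℕ∞) ≤ ∞ := WithTop.coe_le_coe.2 le_top

lemma contDiffAt_two {c : OpenPartialHomeomorph X (Fin n → ℂ)} (hc : c ∈ atlas (Fin n → ℂ) X)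
    {x : X} (hx : x ∈ c.source) {f : X → ℝ} (hf : SmoothAt (n := n) f x) :
    ContDiffAt ℝ 2 (fun z => f (c.symm z)) (c x) :=
  ((smoothAt_iff hc hx).1 hf).of_le two_le_infty

lemma complexHess_apply {c : OpenPartialHomeomorph X (Fin n → ℂ)} (hc : c ∈ atlas (Fin n → ℂ) X)
    {x : X} (hx : x ∈ c.source) {f : X → ℝ} (hf : SmoothAt (n := n) f x) (i j : Fin n) :
    complexHess c f x i j =
      leviForm (fun z => f (c.symm z)) (c x) (Pi.single i 1) (Pi.single j 1) :=
  dz_dzbar_eq_leviForm (contDiffAt_two hc hx hf) i j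

lemma leviForm_eq_hermForm {c : OpenPartialHomeomorph X (Fin n → ℂ)}
    (hc : c ∈ atlas (Fin n → ℂ) X)
    {x : X} (hx : x ∈ c.source) {f : X → ℝ} (hf : SmoothAt (n := n) f x) (v w : Fin n → ℂ) :
    leviForm (fun z => f (c.symm z)) (c x) v w = hermForm (complexHess c f x) v w := by
  rw [leviForm_sum, hermForm]
  simp only [complexHess_apply hc hx hf]

lemma complexHess_congr {c : OpenPartialHomeomorph X (Fin n → ℂ)} (hc : c ∈ atlas (Fin n → ℂ) X)
    {x : X} (hx : x ∈ c.source) {f g : X → ℝ} (hf : SmoothAt (n := n) f x) (h : f =ᶠ[𝓝 x] g) :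
    complexHess c f x = complexHess c g x := by
  have hg : SmoothAt (n := n) g x := hf.congr_of_eventuallyEq h.symm
  have hcont : Tendsto c.symm (𝓝 (c x)) (𝓝 x) := by
    have := c.symm.continuousAt (c.map_source hx)
    rwa [ContinuousAt, c.left_inv hx] at this
  ext i j
  rw [complexHess_apply hc hx hf, complexHess_apply hc hx hg]
  exact leviForm_congr (hcont.eventually h) _ _

lemma complexHess_add {c : OpenPartialHomeomorph X (Fin n → ℂ)} (hc : c ∈ atlas (Fin n → ℂ) X)
    {x : X} (hx : x ∈ c.source) {f g : X → ℝ} (hf : SmoothAt (n := n) f x)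
    (hg : SmoothAt (n := n) g x) :
    complexHess c (fun y => f y + g y) x = complexHess c f x + complexHess c g x := by
  have hs : SmoothAt (n := n) (fun y => f y + g y) x := hf.add hg
  ext i j
  rw [complexHess_apply hc hx hs, Matrix.add_apply, complexHess_apply hc hx hf,
    complexHess_apply hc hx hg]
  exact leviForm_add (contDiffAt_two hc hx hf) (contDiffAt_two hc hx hg) _ _

lemma SmoothAt.const_mul {f : X → ℝ} {x : X} (hf : SmoothAt (n := n) f x) (a : ℝ) :
    SmoothAt (n := n) (fun y => a * f y) x :=
  ContMDiffAt.mul (contMDiffAt_const (c := a)) hf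

lemma complexHess_const_mul {c : OpenPartialHomeomorph X (Fin n → ℂ)}
    (hc : c ∈ atlas (Fin n → ℂ) X) {x : X} (hx : x ∈ c.source) {f : X → ℝ}
    (hf : SmoothAt (n := n) f x) (a : ℝ) :
    complexHess c (fun y => a * f y) x = (a : ℂ) • complexHess c f x := by
  ext i j
  rw [complexHess_apply hc hx (hf.const_mul a), Matrix.smul_apply, complexHess_apply hc hx hf]
  exact leviForm_const_mul (contDiffAt_two hc hx hf) _ _ _

lemma complexHess_const {c : OpenPartialHomeomorph X (Fin n → ℂ)}
    (hc : c ∈ atlas (Fin n → ℂ) X) {x : X} (hx : x ∈ c.source) (a : ℝ) :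
    complexHess c (fun _ => a) x = 0 := by
  ext i j
  rw [complexHess_apply hc hx contMDiffAt_const]
  exact leviForm_const _ _ _ _

/-- The complex Hessian is natural under holomorphic maps. -/
theorem complexHess_comp {f : X → X} {c c' : OpenPartialHomeomorph X (Fin n → ℂ)}
    (hc : c ∈ atlas (Fin n → ℂ) X) (hc' : c' ∈ atlas (Fin n → ℂ) X) {x : X} (hx : x ∈ c.source)
    (hfx : f x ∈ c'.source) (hf : ContMDiffAt 𝓘(ℂ, Fin n → ℂ) 𝓘(ℂ, Fin n → ℂ) ω f x)
    {u : X → ℝ} (hu : SmoothAt (n := n) u (f x)) (i j : Fin n) :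
    complexHess c (fun y => u (f y)) x i j = hermForm (complexHess c' u (f x))
      (fderiv ℂ (fun z => c' (f (c.symm z))) (c x) (Pi.single i 1))
      (fderiv ℂ (fun z => c' (f (c.symm z))) (c x) (Pi.single j 1)) := by
  have := isManifold_real n X
  have hT := contDiffAt_chart_comp hc hc' hx hfx hf
  have hTx : c' (f (c.symm (c x))) = c' (f x) := by rw [c.left_inv hx]
  have hcont : Tendsto (fun z => f (c.symm z)) (𝓝 (c x)) (𝓝 (f x)) := by
    have := c.symm.continuousAt (c.map_source hx)
    rw [ContinuousAt, c.left_inv hx] at this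
    exact hf.continuousAt.tendsto.comp this
  have hev : (fun z => u (f (c.symm z))) =ᶠ[𝓝 (c x)]
      fun z => (fun z => u (c'.symm z)) (c' (f (c.symm z))) := by
    filter_upwards [hcont (c'.open_source.mem_nhds hfx)] with z hz
    simp only [c'.left_inv hz]
  have hsm : ContDiffAt ℝ ∞ (fun z => u (f (c.symm z))) (c x) := by
    refine ContDiffAt.congr_of_eventuallyEq ?_ hev
    refine ContDiffAt.comp (c x) (g := fun z => u (c'.symm z)) ?_
      ((hT.of_le le_top).restrict_scalars ℝ)
    rw [hTx]
    exact (smoothAt_iff hc' hfx).1 hu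
  have h2 : ContDiffAt ℝ 2 (fun z => u (c'.symm z)) (c' (f (c.symm (c x)))) := by
    rw [hTx]; exact contDiffAt_two hc' hfx hu
  rw [complexHess_apply hc hx ((smoothAt_iff hc hx).2 hsm), leviForm_congr hev,
    leviForm_comp (F := fun z => u (c'.symm z)) (T := fun z => c' (f (c.symm z))) h2
      (hT.of_le le_top), hTx]
  exact leviForm_eq_hermForm hc' hfx hu _ _

/-- The Jacobian matrix of the coordinate change from `c` to `c'` at `x`. -/
def jacMat (c c' : OpenPartialHomeomorph X (Fin n → ℂ)) (x : X) : Matrix (Fin n) (Fin n) ℂ :=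
  LinearMap.toMatrix' (fderiv ℂ (fun z => c' (c.symm z)) (c x) : (Fin n → ℂ) →ₗ[ℂ] (Fin n → ℂ))

/-- Naturality under holomorphic maps, applied to the identity read in two charts. -/
lemma complexHess_chart_change {c c' : OpenPartialHomeomorph X (Fin n → ℂ)}
    (hc : c ∈ atlas (Fin n → ℂ) X) (hc' : c' ∈ atlas (Fin n → ℂ) X) {x : X} (hx : x ∈ c.source)
    (hx' : x ∈ c'.source) {u : X → ℝ} (hu : SmoothAt (n := n) u x) :
    complexHess c u x = (jacMat c c' x).transpose * complexHess c' u x *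
      (jacMat c c' x).map (starRingEnd ℂ) := by
  ext i j
  rw [← hermForm_mul]
  have := complexHess_comp (f := id) hc hc' hx hx' contMDiffAt_id hu i j
  refine this.trans ?_
  simp only [jacMat, LinearMap.toMatrix'_apply]
  rfl

/-- The chain rule applied to a coordinate change followed by its inverse shows that the two
Jacobian matrices are inverse to each other. -/
lemma isUnit_det_jacMat {c c' : OpenPartialHomeomorph X (Fin n → ℂ)}
    (hc : c ∈ atlas (Fin n → ℂ) X) (hc' : c' ∈ atlas (Fin n → ℂ) X) {x : X} (hx : x ∈ c.source)
    (hx' : x ∈ c'.source) : (jacMat c c' x).det ≠ 0 := by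
  have h1 := (contDiffAt_chart_comp (f := id) (m := ω) (𝕜 := ℂ) hc hc' hx hx'
    contMDiffAt_id).differentiableAt (by simp)
  have h2 := (contDiffAt_chart_comp (f := id) (m := ω) (𝕜 := ℂ) hc' hc hx' hx
    contMDiffAt_id).differentiableAt (by simp)
  simp only [id] at h1 h2
  have h3 : c' (c.symm (c x)) = c' x := by rw [c.left_inv hx]
  have hcomp : HasFDerivAt (fun z => c (c'.symm (c' (c.symm z))))
      ((fderiv ℂ (fun z => c (c'.symm z)) (c' x)).comp
        (fderiv ℂ (fun z => c' (c.symm z)) (c x))) (c x) := by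
    refine HasFDerivAt.comp (g := fun z => c (c'.symm z)) (c x) ?_ h1.hasFDerivAt
    rw [h3]; exact h2.hasFDerivAt
  have hcont : Tendsto c.symm (𝓝 (c x)) (𝓝 x) := by
    have := c.symm.continuousAt (c.map_source hx)
    rwa [ContinuousAt, c.left_inv hx] at this
  have hid : (fun z => c (c'.symm (c' (c.symm z)))) =ᶠ[𝓝 (c x)] id := by
    filter_upwards [hcont (c'.open_source.mem_nhds hx'), c.open_target.mem_nhds (c.map_source hx)]
      with z hz hz'
    simp only [c'.left_inv hz, c.right_inv hz', id]
  have h4 : (fderiv ℂ (fun z => c (c'.symm z)) (c' x)).comp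
        (fderiv ℂ (fun z => c' (c.symm z)) (c x)) = ContinuousLinearMap.id ℂ _ :=
    hcomp.unique ((hasFDerivAt_id _).congr_of_eventuallyEq hid)
  have h5 : jacMat c' c x * jacMat c c' x = 1 := by
    rw [jacMat, jacMat, ← LinearMap.toMatrix'_comp]
    refine Eq.trans ?_ LinearMap.toMatrix'_id
    exact congrArg (fun T : (Fin n → ℂ) →L[ℂ] (Fin n → ℂ) => LinearMap.toMatrix' T.toLinearMap) h4
  intro h0
  have := congrArg Matrix.det h5
  rw [Matrix.det_mul, h0, mul_zero, Matrix.det_one] at this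
  exact zero_ne_one this

/-- The factor |det J|² is the real Jacobian of the coordinate change, which is why det(g)
transforms as a density. -/
lemma det_transpose_mul_mul_conj (A J : Matrix (Fin n) (Fin n) ℂ) :
    (J.transpose * A * J.map (starRingEnd ℂ)).det = ((‖J.det‖ ^ 2 : ℝ) : ℂ) * A.det := by
  rw [Matrix.det_mul, Matrix.det_mul, Matrix.det_transpose]
  have : (J.map (starRingEnd ℂ)).det = (starRingEnd ℂ) J.det :=
    (RingHom.map_det (starRingEnd ℂ) J).symm
  rw [this, mul_right_comm, Complex.mul_conj, Complex.normSq_eq_norm_sq]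

/-- The factors Jᵀ cancel directly and the conjugate factors cancel by cyclicity of the trace. This
makes the Laplacian independent of the chart. -/
lemma trace_inv_transpose_mul_mul_conj (A B : Matrix (Fin n) (Fin n) ℂ)
    {J : Matrix (Fin n) (Fin n) ℂ} (hJ : J.det ≠ 0) :
    ((J.transpose * A * J.map (starRingEnd ℂ))⁻¹ *
      (J.transpose * B * J.map (starRingEnd ℂ))).trace = (A⁻¹ * B).trace := by
  have hc : (J.map (starRingEnd ℂ)).det ≠ 0 := by
    have : (J.map (starRingEnd ℂ)).det = (starRingEnd ℂ) J.det :=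
      (RingHom.map_det (starRingEnd ℂ) J).symm
    rw [this]; simpa using hJ
  have ht : IsUnit J.transpose.det := by rw [Matrix.det_transpose]; exact hJ.isUnit
  have h1 : (J.map (starRingEnd ℂ)) * (J.map (starRingEnd ℂ))⁻¹ = 1 :=
    Matrix.mul_nonsing_inv _ hc.isUnit
  have h2 : (J.transpose)⁻¹ * J.transpose = 1 := Matrix.nonsing_inv_mul _ ht
  rw [Matrix.mul_inv_rev, Matrix.mul_inv_rev]
  set K := J.map (starRingEnd ℂ)
  calc (K⁻¹ * (A⁻¹ * J.transpose⁻¹) * (J.transpose * B * K)).trace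
      = (K⁻¹ * (A⁻¹ * (J.transpose⁻¹ * J.transpose) * B * K)).trace := by
        simp only [Matrix.mul_assoc]
    _ = (A⁻¹ * B).trace := by
        rw [h2, Matrix.mul_one, Matrix.trace_mul_comm, Matrix.mul_assoc, h1, Matrix.mul_one]

end Charts

/-! ### Frames, weights and the metric matrix -/

section Frames

open Filter Topology

variable {n : ℕ} {X : Type*} [TopologicalSpace X] [ChartedSpace (Fin n → ℂ) X]
  {L : X → Type*} [∀ x, AddCommGroup (L x)] [∀ x, Module ℂ (L x)] [∀ x, TopologicalSpace (L x)]
  [TopologicalSpace (TotalSpace ℂ L)] [FiberBundle ℂ L] [VectorBundle ℂ ℂ L]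

variable (L) in
/-- The local frame around `p`. -/
def frame (p x : X) : L x := (trivializationAt ℂ L p).symm x 1

variable (L) in
/-- The transition function: the coordinate around `p` of the local frame around `q`. -/
def transition (p q x : X) : ℂ :=
  ((trivializationAt ℂ L q).coordChangeL ℂ (trivializationAt ℂ L p) x : ℂ →L[ℂ] ℂ) 1

lemma symmₗ_one {p x : X} (hx : x ∈ (trivializationAt ℂ L p).baseSet) :
    (trivializationAt ℂ L p).symmₗ ℂ x 1 = frame L p x :=
  congrFun ((trivializationAt ℂ L p).coe_symmₗ (R := ℂ) hx) 1

lemma eq_smul_frame {p x : X} (hx : x ∈ (trivializationAt ℂ L p).baseSet) (v : L x) :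
    v = (trivializationAt ℂ L p).linearMapAt ℂ x v • frame L p x := by
  have h := (trivializationAt ℂ L p).symmₗ_linearMapAt (R := ℂ) hx v
  conv_lhs => rw [← h]
  set a := (trivializationAt ℂ L p).linearMapAt ℂ x v
  have : a = a • (1 : ℂ) := by simp
  conv_lhs => rw [this, map_smul, symmₗ_one hx]

lemma linearMapAt_frame {p x : X} (hx : x ∈ (trivializationAt ℂ L p).baseSet) :
    (trivializationAt ℂ L p).linearMapAt ℂ x (frame L p x) = 1 := by
  rw [← symmₗ_one hx]
  exact (trivializationAt ℂ L p).linearMapAt_symmₗ (R := ℂ) hx 1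

lemma frame_ne_zero {p x : X} (hx : x ∈ (trivializationAt ℂ L p).baseSet) : frame L p x ≠ 0 := by
  intro h
  have := linearMapAt_frame (L := L) hx
  rw [h, map_zero] at this
  exact zero_ne_one this

lemma transition_eq {p q x : X} (hp : x ∈ (trivializationAt ℂ L p).baseSet)
    (hq : x ∈ (trivializationAt ℂ L q).baseSet) :
    transition L p q x = (trivializationAt ℂ L p).linearMapAt ℂ x (frame L q x) := by
  have h1 := (trivializationAt ℂ L q).coordChangeL_apply (R := ℂ) (trivializationAt ℂ L p)
    ⟨hq, hp⟩ (1 : ℂ)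
  rw [(trivializationAt ℂ L p).coe_linearMapAt_of_mem (R := ℂ) hp]
  exact h1

lemma frame_eq_transition_smul {p q x : X} (hp : x ∈ (trivializationAt ℂ L p).baseSet)
    (hq : x ∈ (trivializationAt ℂ L q).baseSet) :
    frame L q x = transition L p q x • frame L p x := by
  rw [transition_eq hp hq]
  exact eq_smul_frame hp _

lemma transition_ne_zero {p q x : X} (hp : x ∈ (trivializationAt ℂ L p).baseSet)
    (hq : x ∈ (trivializationAt ℂ L q).baseSet) : transition L p q x ≠ 0 := by
  intro h
  have := frame_eq_transition_smul hp hq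
  rw [h, zero_smul] at this
  exact frame_ne_zero hq this

lemma contMDiffAt_transition [ContMDiffVectorBundle ω ℂ L 𝓘(ℂ, Fin n → ℂ)] {p q x : X}
    (hp : x ∈ (trivializationAt ℂ L p).baseSet) (hq : x ∈ (trivializationAt ℂ L q).baseSet) :
    ContMDiffAt 𝓘(ℂ, Fin n → ℂ) 𝓘(ℂ, ℂ) ω (transition L p q) x :=
  (contMDiffAt_coordChangeL (n := ω) (IB := 𝓘(ℂ, Fin n → ℂ)) hq hp).clm_apply contMDiffAt_const

lemma HermitianMetric.weight_pos (h : HermitianMetric (n := n) L) {p x : X}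
    (hp : x ∈ (trivializationAt ℂ L p).baseSet) : 0 < h.weight p x :=
  h.normSq_pos x _ (frame_ne_zero hp)

lemma HermitianMetric.weight_eq (h : HermitianMetric (n := n) L) {p q x : X}
    (hp : x ∈ (trivializationAt ℂ L p).baseSet) (hq : x ∈ (trivializationAt ℂ L q).baseSet) :
    h.weight q x = ‖transition L p q x‖ ^ 2 * h.weight p x := by
  rw [HermitianMetric.weight, HermitianMetric.weight, ← h.normSq_smul]
  exact congrArg (h.normSq x) (frame_eq_transition_smul hp hq)

lemma HermitianMetric.smoothAt_weight (h : HermitianMetric (n := n) L) {p x : X}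
    (hp : x ∈ (trivializationAt ℂ L p).baseSet) : SmoothAt (n := n) (h.weight p) x :=
  (h.smooth p).contMDiffAt ((trivializationAt ℂ L p).open_baseSet.mem_nhds hp)

lemma smoothAt_comp {V : Type*} [NormedAddCommGroup V] [NormedSpace ℝ V] {g : V → ℝ} {f : X → V}
    {x : X} (hg : ContDiffAt ℝ ∞ g (f x)) (hf : ContMDiffAt 𝓘(ℝ, Fin n → ℂ) 𝓘(ℝ, V) ∞ f x) :
    SmoothAt (n := n) (fun y => g (f y)) x :=
  ContMDiffAt.comp x (I' := 𝓘(ℝ, V)) (contMDiffAt_iff_contDiffAt.2 hg) hf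

lemma HermitianMetric.smoothAt_log_weight (h : HermitianMetric (n := n) L) {p x : X}
    (hp : x ∈ (trivializationAt ℂ L p).baseSet) :
    SmoothAt (n := n) (fun y => Real.log (h.weight p y)) x :=
  smoothAt_comp (Real.contDiffAt_log.2 (h.weight_pos hp).ne') (h.smoothAt_weight hp)

/-- The local potential `φ - log |e|²_h` of `ω_φ` given by the local frame around `p`. -/
def localPotential (h : HermitianMetric (n := n) L) (φ : X → ℝ) (p y : X) : ℝ :=
  φ y + (-1) * Real.log (h.weight p y)

variable [IsManifold 𝓘(ℂ, Fin n → ℂ) ω X] [ContMDiffVectorBundle ω ℂ L 𝓘(ℂ, Fin n → ℂ)]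

lemma smoothAt_localPotential (h : HermitianMetric (n := n) L) {φ : X → ℝ} {p x : X}
    (hφ : SmoothAt (n := n) φ x) (hp : x ∈ (trivializationAt ℂ L p).baseSet) :
    SmoothAt (n := n) (localPotential h φ p) x :=
  hφ.add ((h.smoothAt_log_weight hp).const_mul (-1))

lemma contMDiffAt_restrictScalars {V : Type*} [NormedAddCommGroup V] [NormedSpace ℂ V]
    [NormedSpace ℝ V] [IsScalarTower ℝ ℂ V] {f : X → V} {x : X}
    (hf : ContMDiffAt 𝓘(ℂ, Fin n → ℂ) 𝓘(ℂ, V) ω f x) :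
    ContMDiffAt 𝓘(ℝ, Fin n → ℂ) 𝓘(ℝ, V) ∞ f x := by
  have := isManifold_real n X
  rw [contMDiffAt_iff_chart (chart_mem_atlas _ x) (mem_chart_source _ x)] at hf ⊢
  exact (hf.of_le le_top).restrict_scalars ℝ

lemma smoothAt_log_norm_sq {g : X → ℂ} {x : X}
    (hg : ContMDiffAt 𝓘(ℂ, Fin n → ℂ) 𝓘(ℂ, ℂ) ω g x) (h0 : g x ≠ 0) :
    SmoothAt (n := n) (fun y => Real.log (‖g y‖ ^ 2)) x := by
  refine smoothAt_comp (V := ℂ) (g := fun w => Real.log (‖w‖ ^ 2)) ?_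
    (contMDiffAt_restrictScalars hg)
  exact (Real.contDiffAt_log.2 (by simpa using h0)).comp (g x) (contDiff_norm_sq ℝ).contDiffAt

lemma complexHess_log_norm_sq {c : OpenPartialHomeomorph X (Fin n → ℂ)}
    (hc : c ∈ atlas (Fin n → ℂ) X) {g : X → ℂ} {x : X} (hx : x ∈ c.source)
    (hg : ContMDiffAt 𝓘(ℂ, Fin n → ℂ) 𝓘(ℂ, ℂ) ω g x) (h0 : g x ≠ 0) :
    complexHess c (fun y => Real.log (‖g y‖ ^ 2)) x = 0 := by
  ext i j
  rw [complexHess_apply hc hx (smoothAt_log_norm_sq hg h0)]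
  exact leviForm_log_norm_sq (g := fun z => g (c.symm z))
    (((contMDiffAt_iff_chart hc hx).1 hg).of_le le_top) (by rwa [c.left_inv hx]) _ _

/-- Two frames differ by a nowhere zero holomorphic function g, and log |g|² is pluriharmonic. The
definition of `metricMatrix` uses at each point the frame around that point; this lemma allows one
fixed frame on a neighbourhood. -/
lemma complexHess_log_weight (h : HermitianMetric (n := n) L)
    {c : OpenPartialHomeomorph X (Fin n → ℂ)} (hc : c ∈ atlas (Fin n → ℂ) X) {p q x : X}
    (hx : x ∈ c.source) (hp : x ∈ (trivializationAt ℂ L p).baseSet)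
    (hq : x ∈ (trivializationAt ℂ L q).baseSet) :
    complexHess c (fun y => Real.log (h.weight q y)) x =
      complexHess c (fun y => Real.log (h.weight p y)) x := by
  have hg := contMDiffAt_transition (n := n) hp hq
  have h0 := transition_ne_zero hp hq
  have hev : (fun y => Real.log (h.weight q y)) =ᶠ[𝓝 x]
      fun y => Real.log (‖transition L p q y‖ ^ 2) + Real.log (h.weight p y) := by
    filter_upwards [(trivializationAt ℂ L p).open_baseSet.mem_nhds hp,
      (trivializationAt ℂ L q).open_baseSet.mem_nhds hq] with y hy hy'
    rw [h.weight_eq hy hy', Real.log_mul (by simpa using transition_ne_zero hy hy')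
      (h.weight_pos hy).ne']
  rw [complexHess_congr hc hx (h.smoothAt_log_weight hq) hev,
    complexHess_add hc hx (smoothAt_log_norm_sq hg h0) (h.smoothAt_log_weight hp),
    complexHess_log_norm_sq hc hx hg h0, zero_add]

lemma mem_baseSet_self (x : X) : x ∈ (trivializationAt ℂ L x).baseSet :=
  FiberBundle.mem_baseSet_trivializationAt' x

/-- The metric matrix is the complex Hessian of any local potential. -/
theorem metricMatrix_eq (h : HermitianMetric (n := n) L) {φ : X → ℝ}
    {c : OpenPartialHomeomorph X (Fin n → ℂ)} (hc : c ∈ atlas (Fin n → ℂ) X) {p x : X}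
    (hx : x ∈ c.source) (hφ : SmoothAt (n := n) φ x)
    (hp : x ∈ (trivializationAt ℂ L p).baseSet) :
    metricMatrix h φ c x = complexHess c (localPotential h φ p) x := by
  rw [metricMatrix, complexHess_log_weight h hc hx hp (mem_baseSet_self x)]
  have := complexHess_add hc hx hφ ((h.smoothAt_log_weight hp).const_mul (-1))
  rw [complexHess_const_mul hc hx (h.smoothAt_log_weight hp)] at this
  refine Eq.trans ?_ this.symm
  simp [add_comm]

lemma metricMatrix_chart_change (h : HermitianMetric (n := n) L) {φ : X → ℝ}
    {c c' : OpenPartialHomeomorph X (Fin n → ℂ)} (hc : c ∈ atlas (Fin n → ℂ) X)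
    (hc' : c' ∈ atlas (Fin n → ℂ) X) {x : X} (hx : x ∈ c.source) (hx' : x ∈ c'.source)
    (hφ : SmoothAt (n := n) φ x) :
    metricMatrix h φ c x = (jacMat c c' x).transpose * metricMatrix h φ c' x *
      (jacMat c c' x).map (starRingEnd ℂ) := by
  rw [metricMatrix_eq h hc hx hφ (mem_baseSet_self x),
    metricMatrix_eq h hc' hx' hφ (mem_baseSet_self x)]
  exact complexHess_chart_change hc hc' hx hx' (smoothAt_localPotential h hφ (mem_baseSet_self x))

lemma det_metricMatrix_chart_change (h : HermitianMetric (n := n) L) {φ : X → ℝ}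
    {c c' : OpenPartialHomeomorph X (Fin n → ℂ)} (hc : c ∈ atlas (Fin n → ℂ) X)
    (hc' : c' ∈ atlas (Fin n → ℂ) X) {x : X} (hx : x ∈ c.source) (hx' : x ∈ c'.source)
    (hφ : SmoothAt (n := n) φ x) :
    (metricMatrix h φ c x).det =
      ((‖(jacMat c c' x).det‖ ^ 2 : ℝ) : ℂ) * (metricMatrix h φ c' x).det := by
  rw [metricMatrix_chart_change h hc hc' hx hx' hφ, det_transpose_mul_mul_conj]

/-- The Laplacian can be computed in any chart. -/
lemma laplacian_eq (h : HermitianMetric (n := n) L) {φ f : X → ℝ}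
    {c : OpenPartialHomeomorph X (Fin n → ℂ)} (hc : c ∈ atlas (Fin n → ℂ) X) {x : X}
    (hx : x ∈ c.source) (hφ : SmoothAt (n := n) φ x) (hf : SmoothAt (n := n) f x) :
    laplacian h φ f x = -((metricMatrix h φ c x)⁻¹ * complexHess c f x).trace.re := by
  have hx' := mem_chart_source (Fin n → ℂ) x
  have hc' := chart_mem_atlas (Fin n → ℂ) x
  rw [laplacian, curvForm, ddbar, metricMatrix_chart_change h hc' hc hx' hx hφ,
    complexHess_chart_change hc' hc hx' hx hf,
    trace_inv_transpose_mul_mul_conj _ _ (isUnit_det_jacMat hc' hc hx' hx)]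

lemma posDef_transpose_mul_mul_conj {A J : Matrix (Fin n) (Fin n) ℂ} (hA : A.PosDef)
    (hJ : J.det ≠ 0) : (J.transpose * A * J.map (starRingEnd ℂ)).PosDef := by
  have h1 : J.transpose = (J.map (starRingEnd ℂ)).conjTranspose := by
    ext i j; simp [Matrix.conjTranspose_apply]
  rw [h1]
  refine hA.conjTranspose_mul_mul_same ?_
  refine Matrix.mulVec_injective_of_isUnit ?_
  rw [Matrix.isUnit_iff_isUnit_det]
  have : (J.map (starRingEnd ℂ)).det = (starRingEnd ℂ) J.det :=
    (RingHom.map_det (starRingEnd ℂ) J).symm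
  rw [this]
  simpa using hJ

lemma posDef_metricMatrix (h : HermitianMetric (n := n) L) {φ : X → ℝ}
    (hφ : IsKahlerPotential h φ) {c : OpenPartialHomeomorph X (Fin n → ℂ)}
    (hc : c ∈ atlas (Fin n → ℂ) X) {x : X} (hx : x ∈ c.source) :
    (metricMatrix h φ c x).PosDef := by
  have hx' := mem_chart_source (Fin n → ℂ) x
  have hc' := chart_mem_atlas (Fin n → ℂ) x
  rw [metricMatrix_chart_change h hc hc' hx hx' (hφ.1 x)]
  exact posDef_transpose_mul_mul_conj (hφ.2 x) (isUnit_det_jacMat hc hc' hx hx')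

end Frames

/-! ### Coordinates and Hermitian products on the powers of the bundle -/

section TensorPowers

variable {n : ℕ} {X : Type*} [TopologicalSpace X] [ChartedSpace (Fin n → ℂ) X]
  {L : X → Type*} [∀ x, AddCommGroup (L x)] [∀ x, Module ℂ (L x)] [∀ x, TopologicalSpace (L x)]
  [TopologicalSpace (TotalSpace ℂ L)] [FiberBundle ℂ L] [VectorBundle ℂ ℂ L]

/-- Each of the k tensor factors contributes one transition function; linear maps on the tensor
power are compared on pure tensors. -/
lemma powCoord_change (k : ℕ) {p q x : X} (hp : x ∈ (trivializationAt ℂ L p).baseSet)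
    (hq : x ∈ (trivializationAt ℂ L q).baseSet) (t : ⨂[ℂ]^k (L x)) :
    powCoord k p x t = transition L p q x ^ k * powCoord k q x t := by
  have hlin : ∀ v : L x, (trivializationAt ℂ L p).linearMapAt ℂ x v =
      transition L p q x * (trivializationAt ℂ L q).linearMapAt ℂ x v := by
    intro v
    conv_lhs => rw [eq_smul_frame hq v, map_smul, ← transition_eq hp hq]
    rw [smul_eq_mul, mul_comm]
  have : powCoord (L := L) k p x = (transition L p q x ^ k) • powCoord k q x := by
    refine PiTensorProduct.ext ?_
    ext v
    simp [powCoord, hlin, Finset.prod_mul_distrib]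
  rw [this]
  rfl

/-- A trivialization identifies each fibre with ℂ, and the k-th tensor power of ℂ is ℂ through
multiplication. -/
lemma powCoord_injective (k : ℕ) {p x : X} (hp : x ∈ (trivializationAt ℂ L p).baseSet) :
    Function.Injective (powCoord (L := L) k p x) := by
  have h1 : Function.Injective (PiTensorProduct.lift (MultilinearMap.mkPiAlgebra ℂ (Fin k) ℂ)) :=
    (PiTensorProduct.constantBaseRingEquiv (Fin k) ℂ).injective
  have h2 : PiTensorProduct.map (fun _ : Fin k => (trivializationAt ℂ L p).linearMapAt ℂ x) =
      (PiTensorProduct.congr fun _ : Fin k =>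
        (trivializationAt ℂ L p).linearEquivAt ℂ x hp).toLinearMap := by
    refine PiTensorProduct.ext ?_
    ext v
    simp [(trivializationAt ℂ L p).linearMapAt_def_of_mem (R := ℂ) hp]
  rw [powCoord, h2]
  exact h1.comp (LinearEquiv.injective _)

/-- The factors g^k and ḡ^k from the two coordinates balance the factor |g|^{2k} from the weight. -/
lemma pairing_eq (h : HermitianMetric (n := n) L) (k : ℕ) (φ : X → ℝ) (s t : holSections n L k)
    {p x : X} (hp : x ∈ (trivializationAt ℂ L p).baseSet) :
    pairing h k φ s t x = powCoord k p x (s.1 x) * (starRingEnd ℂ) (powCoord k p x (t.1 x)) *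
      (((Real.exp (-φ x) * h.weight p x) ^ k : ℝ) : ℂ) := by
  have hx : x ∈ (trivializationAt ℂ L x).baseSet := FiberBundle.mem_baseSet_trivializationAt' x
  rw [pairing, powCoord_change k hp hx (s.1 x), powCoord_change k hp hx (t.1 x),
    h.weight_eq hp hx]
  simp only [map_mul, map_pow, mul_pow, Complex.ofReal_mul, Complex.ofReal_pow,
    ← Complex.normSq_eq_norm_sq, Complex.normSq_eq_conj_mul_self]
  ring

end TensorPowers

/-! ### Smooth families of functions -/

section Families

open Filter Topology

variable {n : ℕ} {X : Type*} [TopologicalSpace X] [ChartedSpace (Fin n → ℂ) X]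

/-- A family of functions that is smooth in the parameter and the point. -/
abbrev JointSmooth (u : ℝ → X → ℝ) : Prop :=
  ContMDiff (𝓘(ℝ, ℝ).prod 𝓘(ℝ, Fin n → ℂ)) 𝓘(ℝ, ℝ) ∞ (fun p : ℝ × X => u p.1 p.2)

lemma JointSmooth.isSmooth {u : ℝ → X → ℝ} (hu : JointSmooth (n := n) u) (t : ℝ) :
    IsSmooth (n := n) (u t) :=
  ContMDiff.comp (I' := 𝓘(ℝ, ℝ).prod 𝓘(ℝ, Fin n → ℂ)) (g := fun p : ℝ × X => u p.1 p.2)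
    (f := fun x => (t, x)) hu (contMDiff_const.prodMk contMDiff_id)

lemma IsSmooth.jointSmooth {u : X → ℝ} (hu : IsSmooth (n := n) u) :
    JointSmooth (n := n) (fun _ : ℝ => u) :=
  ContMDiff.comp (I' := 𝓘(ℝ, Fin n → ℂ)) (g := u) (f := fun p : ℝ × X => p.2) hu contMDiff_snd

lemma JointSmooth.continuous {u : ℝ → X → ℝ} (hu : JointSmooth (n := n) u) :
    Continuous fun p : ℝ × X => u p.1 p.2 := ContMDiff.continuous hu

lemma JointSmooth.mul {u v : ℝ → X → ℝ} (hu : JointSmooth (n := n) u)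
    (hv : JointSmooth (n := n) v) : JointSmooth (n := n) fun t x => u t x * v t x :=
  ContMDiff.mul hu hv

lemma JointSmooth.add {u v : ℝ → X → ℝ} (hu : JointSmooth (n := n) u)
    (hv : JointSmooth (n := n) v) : JointSmooth (n := n) fun t x => u t x + v t x :=
  ContMDiff.add hu hv

lemma JointSmooth.const_mul {u : ℝ → X → ℝ} (hu : JointSmooth (n := n) u) (a : ℝ) :
    JointSmooth (n := n) fun t x => a * u t x :=
  ContMDiff.mul contMDiff_const hu

lemma JointSmooth.exp {u : ℝ → X → ℝ} (hu : JointSmooth (n := n) u) :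
    JointSmooth (n := n) fun t x => Real.exp (u t x) :=
  ContMDiff.comp (I' := 𝓘(ℝ, ℝ)) (g := Real.exp) Real.contDiff_exp.contMDiff hu

variable [IsManifold 𝓘(ℂ, Fin n → ℂ) ω X]

lemma contMDiffAt_prod_iff_contDiffAt {F : ℝ × (Fin n → ℂ) → ℝ} {p : ℝ × (Fin n → ℂ)} :
    ContMDiffAt (𝓘(ℝ, ℝ).prod 𝓘(ℝ, Fin n → ℂ)) 𝓘(ℝ, ℝ) ∞ F p ↔ ContDiffAt ℝ ∞ F p := by
  rw [← contMDiffAt_iff_contDiffAt, modelWithCornersSelf_prod, ← chartedSpaceSelf_prod]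

lemma jointSmoothAt_iff {c : OpenPartialHomeomorph X (Fin n → ℂ)} (hc : c ∈ atlas (Fin n → ℂ) X)
    {x : X} (hx : x ∈ c.source) {u : ℝ → X → ℝ} {t : ℝ} :
    ContMDiffAt (𝓘(ℝ, ℝ).prod 𝓘(ℝ, Fin n → ℂ)) 𝓘(ℝ, ℝ) ∞ (fun p : ℝ × X => u p.1 p.2) (t, x) ↔
      ContDiffAt ℝ ∞ (fun p : ℝ × (Fin n → ℂ) => u p.1 (c.symm p.2)) (t, c x) := by
  have := isManifold_real n X
  constructor
  · intro h
    rw [← contMDiffAt_prod_iff_contDiffAt]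
    refine ContMDiffAt.comp (t, c x) (I' := 𝓘(ℝ, ℝ).prod 𝓘(ℝ, Fin n → ℂ))
      (g := fun p : ℝ × X => u p.1 p.2)
      (f := fun p : ℝ × (Fin n → ℂ) => (p.1, c.symm p.2)) ?_ ?_
    · simpa only [c.left_inv hx] using h
    · refine contMDiffAt_fst.prodMk ?_
      exact ContMDiffAt.comp (t, c x) (I' := 𝓘(ℝ, Fin n → ℂ)) (g := c.symm)
        (contMDiffAt_chart_symm hc hx) contMDiffAt_snd
  · intro h
    rw [← contMDiffAt_prod_iff_contDiffAt] at h
    have h2 := ContMDiffAt.comp (t, x) (I' := 𝓘(ℝ, ℝ).prod 𝓘(ℝ, Fin n → ℂ))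
      (I := 𝓘(ℝ, ℝ).prod 𝓘(ℝ, Fin n → ℂ))
      (g := fun p : ℝ × (Fin n → ℂ) => u p.1 (c.symm p.2))
      (f := fun p : ℝ × X => (p.1, c p.2)) h
      (contMDiffAt_fst.prodMk (ContMDiffAt.comp (t, x) (I' := 𝓘(ℝ, Fin n → ℂ)) (g := c)
        (contMDiffAt_chart hc hx) contMDiffAt_snd))
    refine h2.congr_of_eventuallyEq ?_
    have : ∀ᶠ p : ℝ × X in 𝓝 (t, x), p.2 ∈ c.source :=
      continuousAt_snd.eventually (c.open_source.mem_nhds hx)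
    filter_upwards [this] with p hp
    simp [c.left_inv hp]

lemma jointSmooth_iff {u : ℝ → X → ℝ} :
    JointSmooth (n := n) u ↔ ∀ t x, ContDiffAt ℝ ∞
      (fun p : ℝ × (Fin n → ℂ) => u p.1 ((chartAt (Fin n → ℂ) x).symm p.2))
      (t, chartAt (Fin n → ℂ) x x) :=
  ⟨fun h t x => (jointSmoothAt_iff (chart_mem_atlas _ x) (mem_chart_source _ x)).1 (h (t, x)),
    fun h p => (jointSmoothAt_iff (chart_mem_atlas _ p.2) (mem_chart_source _ p.2)).2 (h p.1 p.2)⟩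

lemma continuousAt_of_chart {V : Type*} [TopologicalSpace V]
    {c : OpenPartialHomeomorph X (Fin n → ℂ)} {x : X} (hx : x ∈ c.source) {F : ℝ → X → V} {t : ℝ}
    (h : ContinuousAt (fun p : ℝ × (Fin n → ℂ) => F p.1 (c.symm p.2)) (t, c x)) :
    ContinuousAt (fun p : ℝ × X => F p.1 p.2) (t, x) := by
  have h1 : ContinuousAt (fun p : ℝ × X => (p.1, c p.2)) (t, x) :=
    continuousAt_fst.prodMk ((c.continuousAt hx).comp (f := Prod.snd) continuousAt_snd)
  have h2 : ContinuousAt (fun p : ℝ × X => F p.1 (c.symm (c p.2))) (t, x) :=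
    ContinuousAt.comp (x := (t, x)) (f := fun p : ℝ × X => (p.1, c p.2))
      (g := fun p : ℝ × (Fin n → ℂ) => F p.1 (c.symm p.2)) h h1
  refine h2.congr ?_
  have : ∀ᶠ p : ℝ × X in 𝓝 (t, x), p.2 ∈ c.source :=
    continuousAt_snd.eventually (c.open_source.mem_nhds hx)
  filter_upwards [this] with p hp
  simp [c.left_inv hp]

/-- The derivative of a family with respect to the parameter. -/
def tderiv (u : ℝ → X → ℝ) (t : ℝ) (x : X) : ℝ := deriv (fun r => u r x) t

lemma hasDerivAt_fst {V W : Type*} [NormedAddCommGroup V] [NormedSpace ℝ V] [NormedAddCommGroup W]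
    [NormedSpace ℝ W] {U : ℝ × V → W} {t : ℝ} {z : V} (hU : DifferentiableAt ℝ U (t, z)) :
    HasDerivAt (fun r => U (r, z)) (fderiv ℝ U (t, z) (1, 0)) t := by
  have h : HasDerivAt (fun r : ℝ => (r, z)) ((1 : ℝ), (0 : V)) t :=
    (hasDerivAt_id t).prodMk (hasDerivAt_const t z)
  exact HasFDerivAt.comp_hasDerivAt t hU.hasFDerivAt h

lemma JointSmooth.hasDerivAt {u : ℝ → X → ℝ} (hu : JointSmooth (n := n) u) (t : ℝ) (x : X) :
    HasDerivAt (fun r => u r x) (tderiv u t x) t := by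
  have h := (jointSmooth_iff.1 hu t x).differentiableAt (by simp)
  have h1 := hasDerivAt_fst h
  simp only [(chartAt (Fin n → ℂ) x).left_inv (mem_chart_source _ x)] at h1
  exact h1.differentiableAt.hasDerivAt

lemma tderiv_eq_fderiv {c : OpenPartialHomeomorph X (Fin n → ℂ)} {u : ℝ → X → ℝ} {t : ℝ}
    {z : Fin n → ℂ}
    (hu : DifferentiableAt ℝ (fun p : ℝ × (Fin n → ℂ) => u p.1 (c.symm p.2)) (t, z)) :
    tderiv u t (c.symm z) =
      fderiv ℝ (fun p : ℝ × (Fin n → ℂ) => u p.1 (c.symm p.2)) (t, z) (1, 0) :=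
  (hasDerivAt_fst hu).deriv

lemma JointSmooth.eventually_chart {c : OpenPartialHomeomorph X (Fin n → ℂ)}
    (hc : c ∈ atlas (Fin n → ℂ) X) {x : X} (hx : x ∈ c.source) {u : ℝ → X → ℝ}
    (hu : JointSmooth (n := n) u) (t : ℝ) : ∀ᶠ p : ℝ × (Fin n → ℂ) in 𝓝 (t, c x),
      ContDiffAt ℝ ∞ (fun p : ℝ × (Fin n → ℂ) => u p.1 (c.symm p.2)) p := by
  have : ∀ᶠ p : ℝ × (Fin n → ℂ) in 𝓝 (t, c x), p.2 ∈ c.target :=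
    continuousAt_snd.eventually (c.open_target.mem_nhds (c.map_source hx))
  filter_upwards [this] with p hp
  have := (jointSmoothAt_iff hc (c.map_target hp)).1 (hu (p.1, c.symm p.2))
  rwa [c.right_inv hp] at this

lemma JointSmooth.tderiv {u : ℝ → X → ℝ} (hu : JointSmooth (n := n) u) :
    JointSmooth (n := n) (tderiv u) := by
  rw [jointSmooth_iff] at hu ⊢
  intro t x
  have h := hu t x
  have h1 : ContDiffAt ℝ ∞ (fun p : ℝ × (Fin n → ℂ) => fderiv ℝ (fun p : ℝ × (Fin n → ℂ) =>
      u p.1 ((chartAt (Fin n → ℂ) x).symm p.2)) p ((1 : ℝ), (0 : Fin n → ℂ)))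
      (t, chartAt (Fin n → ℂ) x x) :=
    (h.fderiv_right (by simp)).clm_apply contDiffAt_const
  refine h1.congr_of_eventuallyEq ?_
  filter_upwards [JointSmooth.eventually_chart (chart_mem_atlas _ x) (mem_chart_source _ x)
    (jointSmooth_iff.2 hu) t] with p hp
  exact tderiv_eq_fderiv (hp.differentiableAt (by simp))

lemma wirt_slice {V : Type*} [NormedAddCommGroup V] [NormedSpace ℝ V] {U : ℝ × V → ℂ} {t : ℝ}
    {z : V} {c : ℂ} {a b : V} (hU : DifferentiableAt ℝ U (t, z)) :
    wirt c a b (fun y => U (t, y)) z = wirt c ((0 : ℝ), a) ((0 : ℝ), b) U (t, z) := by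
  have h : HasFDerivAt (fun y : V => (t, y)) (ContinuousLinearMap.inr ℝ ℝ V) z :=
    (hasFDerivAt_const t z).prodMk (hasFDerivAt_id z)
  have := (HasFDerivAt.comp z hU.hasFDerivAt h).fderiv
  change fderiv ℝ (fun y => U (t, y)) z = _ at this
  rw [wirt, wirt, this]
  simp

/-- The complex Hessian in the second variable as a differential operator in both variables. -/
def jointHess (U : ℝ × (Fin n → ℂ) → ℂ) (i j : Fin n) (p : ℝ × (Fin n → ℂ)) : ℂ :=
  wirt (-Complex.I) ((0 : ℝ), (Pi.single i 1 : Fin n → ℂ)) ((0 : ℝ), Pi.single i Complex.I)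
    (wirt Complex.I ((0 : ℝ), Pi.single j 1) ((0 : ℝ), Pi.single j Complex.I) U) p

lemma contDiffAt_jointHess {U : ℝ × (Fin n → ℂ) → ℂ} {p : ℝ × (Fin n → ℂ)}
    (hU : ContDiffAt ℝ ∞ U p) (i j : Fin n) : ContDiffAt ℝ ∞ (jointHess U i j) p :=
  contDiffAt_wirt (contDiffAt_wirt hU)

lemma hessMat_slice {U : ℝ × (Fin n → ℂ) → ℝ} {t : ℝ} {z : Fin n → ℂ}
    (hU : ContDiffAt ℝ ∞ U (t, z)) (i j : Fin n) :
    hessMat (fun y => U (t, y)) z i j = jointHess (fun p => (U p : ℂ)) i j (t, z) := by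
  rw [hessMat, Matrix.of_apply, jointHess, dz_eq_wirt, dzbar_eq_wirt]
  have hUc : ContDiffAt ℝ ∞ (fun p => (U p : ℂ)) (t, z) := contDiffAt_ofReal_comp hU
  have hev : ∀ᶠ y in 𝓝 z, ContDiffAt ℝ 2 (fun p => (U p : ℂ)) (t, y) :=
    (Continuous.prodMk_right t).continuousAt.eventually
      ((hUc.of_le two_le_infty).eventually (by simp))
  rw [← wirt_slice ((contDiffAt_wirt hUc).differentiableAt (by simp))]
  refine wirt_congr ?_
  filter_upwards [hev] with y hy
  exact wirt_slice (hy.differentiableAt (by simp))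

lemma jointHess_congr {U V : ℝ × (Fin n → ℂ) → ℂ} {p : ℝ × (Fin n → ℂ)} (h : U =ᶠ[𝓝 p] V)
    (i j : Fin n) : jointHess U i j p = jointHess V i j p :=
  wirt_congr (h.eventually_nhds.mono fun _ hy => wirt_congr hy)

lemma JointSmooth.contDiffAt_complexHess {c : OpenPartialHomeomorph X (Fin n → ℂ)}
    (hc : c ∈ atlas (Fin n → ℂ) X) {x : X} (hx : x ∈ c.source) {u : ℝ → X → ℝ}
    (hu : JointSmooth (n := n) u) (t : ℝ) (i j : Fin n) :
    ContDiffAt ℝ ∞ (fun p : ℝ × (Fin n → ℂ) => complexHess c (u p.1) (c.symm p.2) i j)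
      (t, c x) := by
  have h := (jointSmoothAt_iff hc hx).1 (hu (t, x))
  refine (contDiffAt_jointHess (contDiffAt_ofReal_comp h) i j).congr_of_eventuallyEq ?_
  have : ∀ᶠ p : ℝ × (Fin n → ℂ) in 𝓝 (t, c x), p.2 ∈ c.target :=
    continuousAt_snd.eventually (c.open_target.mem_nhds (c.map_source hx))
  filter_upwards [this, hu.eventually_chart hc hx t] with p hp hp'
  rw [complexHess_eq_hessMat, c.right_inv hp]
  exact hessMat_slice (U := fun p : ℝ × (Fin n → ℂ) => u p.1 (c.symm p.2)) hp' i j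

/-- The parameter derivative and ∂_i ∂̄_j are constant-coefficient operators on ℝ × ℂⁿ, so they
commute on jointly smooth functions. -/
lemma JointSmooth.hasDerivAt_complexHess {c : OpenPartialHomeomorph X (Fin n → ℂ)}
    (hc : c ∈ atlas (Fin n → ℂ) X) {x : X} (hx : x ∈ c.source) {u : ℝ → X → ℝ}
    (hu : JointSmooth (n := n) u) (t : ℝ) (i j : Fin n) :
    HasDerivAt (fun s => complexHess c (u s) x i j)
      (complexHess c (SigmaBalanced.tderiv u t) x i j) t := by
  set U : ℝ × (Fin n → ℂ) → ℂ := fun p => (u p.1 (c.symm p.2) : ℂ) with hUdef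
  have hall : ∀ s, ContDiffAt ℝ ∞ (fun p : ℝ × (Fin n → ℂ) => u p.1 (c.symm p.2)) (s, c x) :=
    fun s => (jointSmoothAt_iff hc hx).1 (hu (s, x))
  have h1 : ∀ s, complexHess c (u s) x i j = jointHess U i j (s, c x) := fun s =>
    hessMat_slice (U := fun p : ℝ × (Fin n → ℂ) => u p.1 (c.symm p.2)) (hall s) i j
  have hU : ContDiffAt ℝ ∞ U (t, c x) := contDiffAt_ofReal_comp (hall t)
  have h2 := hasDerivAt_fst ((contDiffAt_jointHess hU i j).differentiableAt (by simp))
  simp only [h1]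
  refine h2.congr_deriv ?_
  have h3 : complexHess c (SigmaBalanced.tderiv u t) x i j =
      jointHess (fun p => (SigmaBalanced.tderiv u p.1 (c.symm p.2) : ℂ)) i j (t, c x) :=
    hessMat_slice (U := fun p : ℝ × (Fin n → ℂ) => SigmaBalanced.tderiv u p.1 (c.symm p.2))
      ((jointSmoothAt_iff hc hx).1 (hu.tderiv (t, x))) i j
  -- Writing ∂/∂t as twice a degenerate `wirt` lets `wirt_comm` serve for all the commutations.
  have hw : ∀ (F : ℝ × (Fin n → ℂ) → ℂ) p, fderiv ℝ F p (1, 0) = 2 * wirt 0 (1, 0) 0 F p := by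
    intro F p; simp [wirt]
  have h4 : (fun p : ℝ × (Fin n → ℂ) => (SigmaBalanced.tderiv u p.1 (c.symm p.2) : ℂ))
      =ᶠ[𝓝 (t, c x)] fun p => (2 : ℂ) * wirt 0 (1, 0) 0 U p := by
    filter_upwards [hu.eventually_chart hc hx t] with p hp
    rw [← hw, hUdef, fderiv_ofReal_apply (hp.differentiableAt (by simp)),
      ← tderiv_eq_fderiv (hp.differentiableAt (by simp))]
  have hev2 : ∀ᶠ p in 𝓝 (t, c x), ContDiffAt ℝ ∞ U p :=
    (hu.eventually_chart hc hx t).mono fun p hp => contDiffAt_ofReal_comp hp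
  have hcm : ∀ (c' : ℂ) (a b : ℝ × (Fin n → ℂ)) (F : ℝ × (Fin n → ℂ) → ℂ) p,
      ContDiffAt ℝ ∞ F p → wirt c' a b (fun q => (2 : ℂ) * F q) p = 2 * wirt c' a b F p := by
    intro c' a b F p hF
    rw [wirt_mul (differentiableAt_const _) (hF.differentiableAt (by simp)), wirt_const]
    ring
  rw [h3, jointHess_congr h4, hw]
  unfold jointHess
  have e1 : (wirt Complex.I ((0 : ℝ), Pi.single j 1) ((0 : ℝ), Pi.single j Complex.I)
      fun p => (2 : ℂ) * wirt 0 (1, 0) 0 U p) =ᶠ[𝓝 (t, c x)] fun p => (2 : ℂ) * wirt 0 (1, 0) 0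
        (wirt Complex.I ((0 : ℝ), Pi.single j 1) ((0 : ℝ), Pi.single j Complex.I) U) p := by
    filter_upwards [hev2] with p hp
    rw [hcm _ _ _ _ _ (contDiffAt_wirt hp), wirt_comm (hp.of_le two_le_infty)]
  rw [wirt_congr e1, hcm _ _ _ _ _ (contDiffAt_wirt (contDiffAt_wirt hU)),
    wirt_comm ((contDiffAt_wirt hU).of_le two_le_infty)]

end Families

/-! ### Families of metrics and the ratio of volume forms -/

section VolumeRatio

open Filter Topology

variable {n : ℕ} {X : Type*} [TopologicalSpace X] [ChartedSpace (Fin n → ℂ) X]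
  {L : X → Type*} [∀ x, AddCommGroup (L x)] [∀ x, Module ℂ (L x)] [∀ x, TopologicalSpace (L x)]
  [TopologicalSpace (TotalSpace ℂ L)] [FiberBundle ℂ L] [VectorBundle ℂ ℂ L]

/-- The ratio `ω_Γ^n / ω_φ^n`. -/
def volRatio (h : HermitianMetric (n := n) L) (φ Γ : X → ℝ) (x : X) : ℝ :=
  (metricMatrix h Γ (chartAt (Fin n → ℂ) x) x).det.re /
    (metricMatrix h φ (chartAt (Fin n → ℂ) x) x).det.re

variable [IsManifold 𝓘(ℂ, Fin n → ℂ) ω X] [ContMDiffVectorBundle ω ℂ L 𝓘(ℂ, Fin n → ℂ)]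

/-- Both determinants pick up the same nonzero factor |det J|² under a change of chart. -/
lemma volRatio_eq (h : HermitianMetric (n := n) L) {φ Γ : X → ℝ}
    {c : OpenPartialHomeomorph X (Fin n → ℂ)} (hc : c ∈ atlas (Fin n → ℂ) X) {x : X}
    (hx : x ∈ c.source) (hφ : SmoothAt (n := n) φ x) (hΓ : SmoothAt (n := n) Γ x) :
    volRatio h φ Γ x = (metricMatrix h Γ c x).det.re / (metricMatrix h φ c x).det.re := by
  have hx' := mem_chart_source (Fin n → ℂ) x
  have hc' := chart_mem_atlas (Fin n → ℂ) x
  have hJ : ‖(jacMat (chartAt (Fin n → ℂ) x) c x).det‖ ^ 2 ≠ 0 := by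
    simpa using isUnit_det_jacMat hc' hc hx' hx
  rw [volRatio, det_metricMatrix_chart_change h hc' hc hx' hx hφ,
    det_metricMatrix_chart_change h hc' hc hx' hx hΓ, Complex.re_ofReal_mul, Complex.re_ofReal_mul,
    mul_div_mul_left _ _ hJ]

lemma det_metricMatrix_pos (h : HermitianMetric (n := n) L) {φ : X → ℝ}
    (hφ : IsKahlerPotential h φ) {c : OpenPartialHomeomorph X (Fin n → ℂ)}
    (hc : c ∈ atlas (Fin n → ℂ) X) {x : X} (hx : x ∈ c.source) :
    0 < (metricMatrix h φ c x).det := (posDef_metricMatrix h hφ hc hx).det_pos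

lemma re_det_metricMatrix_pos (h : HermitianMetric (n := n) L) {φ : X → ℝ}
    (hφ : IsKahlerPotential h φ) {c : OpenPartialHomeomorph X (Fin n → ℂ)}
    (hc : c ∈ atlas (Fin n → ℂ) X) {x : X} (hx : x ∈ c.source) :
    0 < (metricMatrix h φ c x).det.re :=
  (Complex.pos_iff.1 (det_metricMatrix_pos h hφ hc hx)).1

lemma det_metricMatrix_eq_re (h : HermitianMetric (n := n) L) {φ : X → ℝ}
    (hφ : IsKahlerPotential h φ) {c : OpenPartialHomeomorph X (Fin n → ℂ)}
    (hc : c ∈ atlas (Fin n → ℂ) X) {x : X} (hx : x ∈ c.source) :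
    (metricMatrix h φ c x).det = ((metricMatrix h φ c x).det.re : ℂ) :=
  Complex.ext rfl (by simpa using (Complex.pos_iff.1 (det_metricMatrix_pos h hφ hc hx)).2.symm)

lemma volRatio_self (h : HermitianMetric (n := n) L) {φ : X → ℝ} (hφ : IsKahlerPotential h φ)
    (x : X) : volRatio h φ φ x = 1 :=
  div_self (re_det_metricMatrix_pos h hφ (chart_mem_atlas _ x) (mem_chart_source _ x)).ne'

lemma volRatio_pos (h : HermitianMetric (n := n) L) {φ Γ : X → ℝ} (hφ : IsKahlerPotential h φ)
    (hΓ : IsKahlerPotential h Γ) (x : X) : 0 < volRatio h φ Γ x :=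
  div_pos (re_det_metricMatrix_pos h hΓ (chart_mem_atlas _ x) (mem_chart_source _ x))
    (re_det_metricMatrix_pos h hφ (chart_mem_atlas _ x) (mem_chart_source _ x))

/-- By `complexHess_log_weight` the frame around x can be used at all points near x, so the entries
are second derivatives of fixed smooth functions there. -/
lemma contDiffAt_metricMatrix (h : HermitianMetric (n := n) L) {u : ℝ → X → ℝ}
    (hu : JointSmooth (n := n) u) {c : OpenPartialHomeomorph X (Fin n → ℂ)}
    (hc : c ∈ atlas (Fin n → ℂ) X) {x : X} (hx : x ∈ c.source) (t : ℝ) (i j : Fin n) :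
    ContDiffAt ℝ ∞ (fun p : ℝ × (Fin n → ℂ) => metricMatrix h (u p.1) c (c.symm p.2) i j)
      (t, c x) := by
  have h1 : ContDiffAt ℝ ∞
      (fun z => complexHess c (fun y => Real.log (h.weight x y)) (c.symm z) i j) (c x) := by
    have := (smoothAt_iff hc hx).1 (h.smoothAt_log_weight (mem_baseSet_self (L := L) x))
    refine (contDiffAt_hessMat this i j).congr_of_eventuallyEq ?_
    filter_upwards [c.open_target.mem_nhds (c.map_source hx)] with z hz
    rw [complexHess_eq_hessMat, c.right_inv hz]
  have h2 : ContDiffAt ℝ ∞ (fun p : ℝ × (Fin n → ℂ) =>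
      complexHess c (fun y => Real.log (h.weight x y)) (c.symm p.2) i j) (t, c x) :=
    ContDiffAt.comp (t, c x) h1 contDiffAt_snd
  refine (h2.neg.add (hu.contDiffAt_complexHess hc hx t i j)).congr_of_eventuallyEq ?_
  have hcont : Tendsto c.symm (𝓝 (c x)) (𝓝 x) := by
    have := c.symm.continuousAt (c.map_source hx)
    rwa [ContinuousAt, c.left_inv hx] at this
  have e1 : ∀ᶠ p : ℝ × (Fin n → ℂ) in 𝓝 (t, c x), p.2 ∈ c.target :=
    continuousAt_snd.eventually (c.open_target.mem_nhds (c.map_source hx))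
  have e3 : ∀ᶠ z in 𝓝 (c x), c.symm z ∈ (trivializationAt ℂ L x).baseSet :=
    hcont.eventually ((trivializationAt ℂ L x).open_baseSet.mem_nhds (mem_baseSet_self x))
  have e2 : ∀ᶠ p : ℝ × (Fin n → ℂ) in 𝓝 (t, c x),
      c.symm p.2 ∈ (trivializationAt ℂ L x).baseSet :=
    (continuousAt_snd (p := (t, c x))).tendsto.eventually e3
  filter_upwards [e1, e2] with p hp hp'
  rw [metricMatrix, complexHess_log_weight h hc (c.map_target hp) hp' (mem_baseSet_self _)]
  rfl

lemma hasDerivAt_metricMatrix (h : HermitianMetric (n := n) L) {u : ℝ → X → ℝ}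
    (hu : JointSmooth (n := n) u) {c : OpenPartialHomeomorph X (Fin n → ℂ)}
    (hc : c ∈ atlas (Fin n → ℂ) X) {x : X} (hx : x ∈ c.source) (t : ℝ) (i j : Fin n) :
    HasDerivAt (fun s => metricMatrix h (u s) c x i j)
      (complexHess c (SigmaBalanced.tderiv u t) x i j) t :=
  (hu.hasDerivAt_complexHess hc hx t i j).const_add _

lemma contDiffAt_det_metricMatrix (h : HermitianMetric (n := n) L) {u : ℝ → X → ℝ}
    (hu : JointSmooth (n := n) u) {c : OpenPartialHomeomorph X (Fin n → ℂ)}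
    (hc : c ∈ atlas (Fin n → ℂ) X) {x : X} (hx : x ∈ c.source) (t : ℝ) :
    ContDiffAt ℝ ∞ (fun p : ℝ × (Fin n → ℂ) => (metricMatrix h (u p.1) c (c.symm p.2)).det)
      (t, c x) :=
  contDiffAt_matrix_det fun k l => contDiffAt_metricMatrix h hu hc hx t k l

/-- The ratio of volume forms of a smooth family is a smooth family. -/
lemma jointSmooth_volRatio (h : HermitianMetric (n := n) L) {φ : X → ℝ}
    (hφ : IsKahlerPotential h φ) {u : ℝ → X → ℝ} (hu : JointSmooth (n := n) u) :
    JointSmooth (n := n) fun t x => volRatio h φ (u t) x := by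
  rw [jointSmooth_iff]
  intro t x
  set c := chartAt (Fin n → ℂ) x
  have hc : c ∈ atlas (Fin n → ℂ) X := chart_mem_atlas _ x
  have hx : x ∈ c.source := mem_chart_source _ x
  have h1 : ContDiffAt ℝ ∞
      (fun p : ℝ × (Fin n → ℂ) => (metricMatrix h (u p.1) c (c.symm p.2)).det.re) (t, c x) :=
    Complex.reCLM.contDiff.contDiffAt.comp _ (contDiffAt_det_metricMatrix h hu hc hx t)
  have h2 : ContDiffAt ℝ ∞
      (fun p : ℝ × (Fin n → ℂ) => (metricMatrix h φ c (c.symm p.2)).det.re) (t, c x) :=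
    Complex.reCLM.contDiff.contDiffAt.comp _
      (contDiffAt_det_metricMatrix h (IsSmooth.jointSmooth hφ.1) hc hx t)
  have h3 := h1.div h2 (by
    simp only [c.left_inv hx]
    exact (re_det_metricMatrix_pos h hφ hc hx).ne')
  refine h3.congr_of_eventuallyEq ?_
  have e1 : ∀ᶠ p : ℝ × (Fin n → ℂ) in 𝓝 (t, c x), p.2 ∈ c.target :=
    continuousAt_snd.eventually (c.open_target.mem_nhds (c.map_source hx))
  filter_upwards [e1] with p hp
  exact volRatio_eq h hc (c.map_target hp) (hφ.1 _) (hu.isSmooth p.1 _)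

/-- The adjugate is polynomial in the entries. This form exhibits smoothness, matches Jacobi's
formula, and cancels the determinant in the volume density. -/
lemma trace_inv_mul (A B : Matrix (Fin n) (Fin n) ℂ) :
    (A⁻¹ * B).trace = A.det⁻¹ * (A.adjugate * B).trace := by
  rw [Matrix.inv_def, Ring.inverse_eq_inv', Matrix.smul_mul, Matrix.trace_smul, smul_eq_mul]

lemma hasDerivAt_det {A : ℝ → Matrix (Fin n) (Fin n) ℂ} {A' : Matrix (Fin n) (Fin n) ℂ} {t : ℝ}
    (hA : ∀ k l, HasDerivAt (fun s => A s k l) (A' k l) t) :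
    HasDerivAt (fun s => (A s).det) ((A t).adjugate * A').trace t := by
  have := (hasFDerivAt_det fun k l => (hA k l).hasFDerivAt).hasDerivAt
  refine this.congr_deriv ?_
  simp only [sum_apply, smul_apply, ContinuousLinearMap.toSpanSingleton_apply, one_smul,
    smul_eq_mul]
  rw [Matrix.trace, Finset.sum_comm]
  refine Finset.sum_congr rfl fun l _ => ?_
  rw [Matrix.diag_apply, Matrix.mul_apply]

/-- The first variation of the volume form is minus the Laplacian of the variation. -/
lemma tderiv_volRatio (h : HermitianMetric (n := n) L) {φ : X → ℝ}
    (hφ : IsKahlerPotential h φ) {u : ℝ → X → ℝ} (hu : JointSmooth (n := n) u) {t : ℝ}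
    (ht : u t = φ) (x : X) :
    tderiv (fun t x => volRatio h φ (u t) x) t x = -laplacian h φ (tderiv u t) x := by
  set c := chartAt (Fin n → ℂ) x with hcdef
  have hc : c ∈ atlas (Fin n → ℂ) X := chart_mem_atlas _ x
  have hx : x ∈ c.source := mem_chart_source _ x
  have h1 := hasDerivAt_det fun k l => hasDerivAt_metricMatrix h hu hc hx t k l
  have h2 := (Complex.reCLM.hasFDerivAt.comp_hasDerivAt t h1).div_const
    ((metricMatrix h φ c x).det.re)
  have h3 := h2.deriv
  rw [tderiv]
  refine Eq.trans h3 ?_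
  rw [laplacian_eq h hc hx (hφ.1 x) (hu.tderiv.isSmooth t x), trace_inv_mul, neg_neg, ht]
  rw [det_metricMatrix_eq_re h hφ hc hx, ← Complex.ofReal_inv, Complex.re_ofReal_mul,
    Complex.ofReal_re, div_eq_inv_mul]
  rfl

/-- The Laplacian of a smooth family with respect to a smooth family of metrics is continuous. -/
lemma continuous_laplacian (h : HermitianMetric (n := n) L) {Γ u : ℝ → X → ℝ}
    (hΓ : JointSmooth (n := n) Γ) (hK : ∀ t, IsKahlerPotential h (Γ t))
    (hu : JointSmooth (n := n) u) :
    Continuous fun p : ℝ × X => laplacian h (Γ p.1) (u p.1) p.2 := by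
  rw [continuous_iff_continuousAt]
  rintro ⟨t, x⟩
  set c := chartAt (Fin n → ℂ) x with hcdef
  have hc : c ∈ atlas (Fin n → ℂ) X := chart_mem_atlas _ x
  have hx : x ∈ c.source := mem_chart_source _ x
  refine continuousAt_of_chart (c := c) hx (F := fun s y => laplacian h (Γ s) (u s) y) ?_
  have h1 := (contDiffAt_det_metricMatrix h hΓ hc hx t).inv (by
    simp only [c.left_inv hx]
    exact (det_metricMatrix_pos h (hK t) hc hx).ne')
  have h2 : ContDiffAt ℝ ∞ (fun p : ℝ × (Fin n → ℂ) =>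
      ((metricMatrix h (Γ p.1) c (c.symm p.2)).adjugate *
        complexHess c (u p.1) (c.symm p.2)).trace) (t, c x) := by
    simp only [Matrix.trace, Matrix.diag_apply, Matrix.mul_apply]
    exact ContDiffAt.sum fun i _ => ContDiffAt.sum fun j _ =>
      (contDiffAt_adjugate (fun k l => contDiffAt_metricMatrix h hΓ hc hx t k l) i j).mul
        (hu.contDiffAt_complexHess hc hx t j i)
  have h3 := (Complex.reCLM.contDiff.contDiffAt.comp _ (h1.mul h2)).neg.continuousAt
  refine h3.congr ?_
  have e1 : ∀ᶠ p : ℝ × (Fin n → ℂ) in 𝓝 (t, c x), p.2 ∈ c.target :=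
    continuousAt_snd.eventually (c.open_target.mem_nhds (c.map_source hx))
  filter_upwards [e1] with p hp
  rw [laplacian_eq h hc (c.map_target hp) (hΓ.isSmooth p.1 _) (hu.isSmooth p.1 _), trace_inv_mul]
  rfl

end VolumeRatio

/-! ### The volume measure -/

section VolumeMeasure

open Filter Topology

open scoped ENNReal

variable {n : ℕ} {X : Type*} [TopologicalSpace X] [ChartedSpace (Fin n → ℂ) X]
  {L : X → Type*} [∀ x, AddCommGroup (L x)] [∀ x, Module ℂ (L x)] [∀ x, TopologicalSpace (L x)]
  [TopologicalSpace (TotalSpace ℂ L)] [FiberBundle ℂ L] [VectorBundle ℂ ℂ L]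

/-- The real determinant is the norm from ℂ to ℝ of the complex one. It supplies the Jacobian in the
change of variables between charts. -/
lemma det_restrictScalars_clm (T : (Fin n → ℂ) →L[ℂ] (Fin n → ℂ)) :
    (T.restrictScalars ℝ).det =
      ‖(LinearMap.toMatrix' (T : (Fin n → ℂ) →ₗ[ℂ] (Fin n → ℂ))).det‖ ^ 2 := by
  have h1 : (T.restrictScalars ℝ).det =
      LinearMap.det ((T : (Fin n → ℂ) →ₗ[ℂ] (Fin n → ℂ)).restrictScalars ℝ) := rfl
  rw [h1, LinearMap.det_restrictScalars, Algebra.norm_complex_apply, Complex.normSq_eq_norm_sq,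
    LinearMap.det_toMatrix']

/-- The density of the volume form in the chart `c`. -/
def chartDensity (h : HermitianMetric (n := n) L) (φ : X → ℝ)
    (c : OpenPartialHomeomorph X (Fin n → ℂ)) (z : Fin n → ℂ) : ℝ :=
  2 ^ n * (metricMatrix h φ c (c.symm z)).det.re

/-- The part of the volume measure in the domain of the chart `c`. -/
def chartMeasure [MeasurableSpace X] (h : HermitianMetric (n := n) L) (φ : X → ℝ)
    (c : OpenPartialHomeomorph X (Fin n → ℂ)) : Measure X :=
  ((volume.restrict c.target).withDensity fun z => ENNReal.ofReal (chartDensity h φ c z)).map c.symm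

/-- The number of charts as an extended real number. -/
def multInv (n : ℕ) {X : Type*} [TopologicalSpace X] [ChartedSpace (Fin n → ℂ) X] [CompactSpace X]
    (x : X) : ℝ≥0∞ := ((chartMultiplicity (n := n) x : ℝ≥0∞))⁻¹

lemma volumeMeasure_eq_sum [CompactSpace X] [MeasurableSpace X] (h : HermitianMetric (n := n) L)
    (φ : X → ℝ) : volumeMeasure h φ = ∑ p ∈ chartCover n X,
      (chartMeasure h φ (chartAt (Fin n → ℂ) p)).withDensity (multInv n) := rfl

/-- In this form the multiplicity is measurable and cancels the weights `multInv` when the pieces of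
the volume measure are added. -/
lemma chartMultiplicity_eq_sum [CompactSpace X] (x : X) :
    (chartMultiplicity (n := n) x : ℝ≥0∞) =
      ∑ p ∈ chartCover n X, (chartAt (Fin n → ℂ) p).source.indicator 1 x := by
  classical
  rw [chartMultiplicity, Finset.card_filter]
  push_cast
  refine Finset.sum_congr rfl fun p _ => ?_
  by_cases hx : x ∈ (chartAt (Fin n → ℂ) p).source <;> simp [hx]

lemma chartMultiplicity_ne_zero [CompactSpace X] (x : X) : chartMultiplicity (n := n) x ≠ 0 := by
  classical
  have : x ∈ ⋃ p ∈ chartCover n X, (chartAt (Fin n → ℂ) p).source := by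
    rw [chartCover, (exists_chartCover n X).choose_spec]; trivial
  simp only [Set.mem_iUnion] at this
  obtain ⟨p, hp, hx⟩ := this
  exact Finset.card_ne_zero_of_mem (Finset.mem_filter.2 ⟨hp, hx⟩)

variable [MeasurableSpace X] [BorelSpace X]

lemma measurable_multInv [CompactSpace X] : Measurable (multInv n (X := X)) := by
  refine Measurable.inv ?_
  simp only [chartMultiplicity_eq_sum]
  exact Finset.measurable_fun_sum _ fun p _ =>
    measurable_one.indicator (chartAt (Fin n → ℂ) p).open_source.measurableSet

lemma aemeasurable_chart_symm (c : OpenPartialHomeomorph X (Fin n → ℂ)) :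
    AEMeasurable c.symm (volume.restrict c.target) :=
  c.continuousOn_symm.aemeasurable c.open_target.measurableSet

variable [IsManifold 𝓘(ℂ, Fin n → ℂ) ω X] [ContMDiffVectorBundle ω ℂ L 𝓘(ℂ, Fin n → ℂ)]

lemma continuousOn_chartDensity (h : HermitianMetric (n := n) L) {φ : X → ℝ}
    (hφ : IsSmooth (n := n) φ) {c : OpenPartialHomeomorph X (Fin n → ℂ)}
    (hc : c ∈ atlas (Fin n → ℂ) X) : ContinuousOn (chartDensity h φ c) c.target := by
  intro z hz
  have := (contDiffAt_det_metricMatrix h (IsSmooth.jointSmooth hφ) hc (c.map_target hz) 0).continuousAt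
  rw [c.right_inv hz] at this
  have h2 : ContinuousAt (fun y : Fin n → ℂ => (metricMatrix h φ c (c.symm y)).det) z :=
    ContinuousAt.comp (x := z) (f := fun y : Fin n → ℂ => ((0 : ℝ), y))
      (g := fun p : ℝ × (Fin n → ℂ) => (metricMatrix h φ c (c.symm p.2)).det) this
      (Continuous.prodMk_right (0 : ℝ)).continuousAt
  exact (continuousAt_const.mul (Complex.continuous_re.continuousAt.comp h2)).continuousWithinAt

lemma aemeasurable_chartDensity (h : HermitianMetric (n := n) L) {φ : X → ℝ}
    (hφ : IsSmooth (n := n) φ) {c : OpenPartialHomeomorph X (Fin n → ℂ)}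
    (hc : c ∈ atlas (Fin n → ℂ) X) :
    AEMeasurable (fun z => ENNReal.ofReal (chartDensity h φ c z)) (volume.restrict c.target) :=
  ((continuousOn_chartDensity h hφ hc).aemeasurable c.open_target.measurableSet).ennreal_ofReal

lemma lintegral_chartMeasure (h : HermitianMetric (n := n) L) {φ : X → ℝ}
    (hφ : IsSmooth (n := n) φ) {c : OpenPartialHomeomorph X (Fin n → ℂ)}
    (hc : c ∈ atlas (Fin n → ℂ) X) {f : X → ℝ≥0∞} (hf : Measurable f) :
    ∫⁻ x, f x ∂chartMeasure h φ c =
      ∫⁻ z in c.target, ENNReal.ofReal (chartDensity h φ c z) * f (c.symm z) := by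
  have hs := aemeasurable_chart_symm c
  rw [chartMeasure, lintegral_map' hf.aemeasurable
    (hs.mono_ac (withDensity_absolutelyContinuous _ _)),
    lintegral_withDensity_eq_lintegral_mul₀ (aemeasurable_chartDensity h hφ hc)
      (show AEMeasurable (fun z => f (c.symm z)) _ from hf.comp_aemeasurable hs)]
  rfl

lemma lintegral_chartMeasure_source (h : HermitianMetric (n := n) L) {φ : X → ℝ}
    (hφ : IsSmooth (n := n) φ) {c : OpenPartialHomeomorph X (Fin n → ℂ)}
    (hc : c ∈ atlas (Fin n → ℂ) X) {U : Set X} (hU : MeasurableSet U)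
    {f : X → ℝ≥0∞} (hf : Measurable f) :
    ∫⁻ x in U, f x ∂chartMeasure h φ c =
      ∫⁻ z in c.target ∩ c.symm ⁻¹' U, ENNReal.ofReal (chartDensity h φ c z) * f (c.symm z) := by
  -- The inverse chart is controlled only on the target, so measurability is checked for its
  -- restriction there.
  have hm : MeasurableSet (c.target ∩ c.symm ⁻¹' U) := by
    have h2 : Measurable (c.target.domRestrict c.symm) :=
      (continuousOn_iff_continuous_domRestrict.1 c.continuousOn_symm).measurable
    have h3 := MeasurableSet.subtype_image c.open_target.measurableSet (h2 hU)
    convert h3 using 1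
    ext z; simp [and_comm]
  rw [← lintegral_indicator hU, lintegral_chartMeasure h hφ hc (hf.indicator hU),
    ← lintegral_indicator c.open_target.measurableSet, ← lintegral_indicator hm]
  refine lintegral_congr fun z => ?_
  by_cases hz : z ∈ c.target <;> by_cases hz' : c.symm z ∈ U <;> simp [hz, hz']

/-- The pieces of the volume measure in two charts agree on the common domain. -/
lemma lintegral_chartMeasure_change (h : HermitianMetric (n := n) L) {φ : X → ℝ}
    (hφ : IsSmooth (n := n) φ) {c c' : OpenPartialHomeomorph X (Fin n → ℂ)}
    (hc : c ∈ atlas (Fin n → ℂ) X) (hc' : c' ∈ atlas (Fin n → ℂ) X) {f : X → ℝ≥0∞}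
    (hf : Measurable f) :
    ∫⁻ x in c'.source, f x ∂chartMeasure h φ c = ∫⁻ x in c.source, f x ∂chartMeasure h φ c' := by
  rw [lintegral_chartMeasure_source h hφ hc c'.open_source.measurableSet hf,
    lintegral_chartMeasure_source h hφ hc' c.open_source.measurableSet hf]
  set s := c.target ∩ c.symm ⁻¹' c'.source with hs
  have hso : IsOpen s := c.symm.isOpen_inter_preimage c'.open_source
  have himg : (fun z => c' (c.symm z)) '' s = c'.target ∩ c'.symm ⁻¹' c.source := by
    ext w
    constructor
    · rintro ⟨z, ⟨hz, hz'⟩, rfl⟩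
      refine ⟨c'.map_source hz', ?_⟩
      simp only [Set.mem_preimage, c'.left_inv hz']
      exact c.map_target hz
    · rintro ⟨hw, hw'⟩
      refine ⟨c (c'.symm w), ⟨c.map_source hw', ?_⟩, ?_⟩
      · simp only [Set.mem_preimage, c.left_inv hw']
        exact c'.map_target hw
      · simp only [c.left_inv hw', c'.right_inv hw]
  have hinj : Set.InjOn (fun z => c' (c.symm z)) s := by
    intro z hz w hw hzw
    have := c'.injOn hz.2 hw.2 hzw
    exact c.symm.injOn hz.1 hw.1 this
  have hder : ∀ z ∈ s, HasFDerivWithinAt (fun z => c' (c.symm z))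
      ((fderiv ℂ (fun z => c' (c.symm z)) z).restrictScalars ℝ) s z := by
    intro z hz
    have h1 := (contDiffAt_chart_comp (f := id) (m := ω) (𝕜 := ℂ) hc hc' (c.map_target hz.1) hz.2
      contMDiffAt_id).differentiableAt (by simp)
    rw [c.right_inv hz.1] at h1
    exact (h1.hasFDerivAt.restrictScalars ℝ).hasFDerivWithinAt
  -- The change of variables between the two chart images has real Jacobian |det J|², which is
  -- exactly the factor relating the two determinants of the metric.
  rw [← himg, lintegral_image_eq_lintegral_abs_det_fderiv_mul volume hso.measurableSet hder hinj]
  refine setLIntegral_congr_fun hso.measurableSet fun z hz => ?_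
  have hx := c.map_target hz.1
  simp only [c'.left_inv hz.2]
  rw [← mul_assoc, ← ENNReal.ofReal_mul (abs_nonneg _)]
  congr 2
  rw [det_restrictScalars_clm, abs_of_nonneg (by positivity), chartDensity, chartDensity,
    det_metricMatrix_chart_change h hc hc' hx hz.2 (hφ _), Complex.re_ofReal_mul, jacMat,
    c.right_inv hz.1, c'.left_inv hz.2]
  ring

lemma lintegral_volumeMeasure [CompactSpace X] (h : HermitianMetric (n := n) L) (φ : X → ℝ)
    {f : X → ℝ≥0∞} (hf : Measurable f) :
    ∫⁻ x, f x ∂volumeMeasure h φ = ∑ p ∈ chartCover n X,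
      ∫⁻ x, multInv n x * f x ∂chartMeasure h φ (chartAt (Fin n → ℂ) p) := by
  rw [volumeMeasure_eq_sum, lintegral_finsetSum_measure]
  refine Finset.sum_congr rfl fun p _ => ?_
  rw [lintegral_withDensity_eq_lintegral_mul _ measurable_multInv hf]
  rfl

/-- In the domain of a chart the volume measure is `2^n det g` times Lebesgue measure. -/
theorem restrict_volumeMeasure [CompactSpace X] (h : HermitianMetric (n := n) L) {φ : X → ℝ}
    (hφ : IsSmooth (n := n) φ) {c : OpenPartialHomeomorph X (Fin n → ℂ)}
    (hc : c ∈ atlas (Fin n → ℂ) X) :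
    (volumeMeasure h φ).restrict c.source = chartMeasure h φ c := by
  refine Measure.ext_of_lintegral _ fun f hf => ?_
  rw [← lintegral_indicator c.open_source.measurableSet,
    lintegral_volumeMeasure h φ (hf.indicator c.open_source.measurableSet)]
  -- Each piece, restricted to the domain of c, is carried over to the measure of the single chart
  -- c.
  have h1 : ∀ p ∈ chartCover n X, ∫⁻ x, multInv n x * c.source.indicator f x
      ∂chartMeasure h φ (chartAt (Fin n → ℂ) p) =
        ∫⁻ x, (chartAt (Fin n → ℂ) p).source.indicator 1 x * (multInv n x * f x)
          ∂chartMeasure h φ c := by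
    intro p _
    have e1 : (fun x => multInv n x * c.source.indicator f x) =
        c.source.indicator fun x => multInv n x * f x := by
      ext x; by_cases hx : x ∈ c.source <;> simp [hx]
    have e2 : (fun x => (chartAt (Fin n → ℂ) p).source.indicator 1 x * (multInv n x * f x)) =
        (chartAt (Fin n → ℂ) p).source.indicator fun x => multInv n x * f x := by
      ext x; by_cases hx : x ∈ (chartAt (Fin n → ℂ) p).source <;> simp [hx]
    rw [e1, e2, lintegral_indicator c.open_source.measurableSet,
      lintegral_indicator (chartAt (Fin n → ℂ) p).open_source.measurableSet,
      lintegral_chartMeasure_change h hφ hc (chart_mem_atlas _ p) (measurable_multInv.fun_mul hf)]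
  rw [Finset.sum_congr rfl h1, ← lintegral_finsetSum]
  -- The indicators of the covering charts add up to the multiplicity, which cancels its inverse.
  · refine lintegral_congr fun x => ?_
    rw [← Finset.sum_mul, ← chartMultiplicity_eq_sum, ← mul_assoc, multInv,
      ENNReal.mul_inv_cancel (by simpa using chartMultiplicity_ne_zero x) (by simp), one_mul]
  · intro p _
    exact (measurable_one.indicator (chartAt (Fin n → ℂ) p).open_source.measurableSet).mul
      (measurable_multInv.fun_mul hf)

/-- Change of the metric multiplies the volume measure by the ratio of the volume forms. -/
theorem volumeMeasure_eq_withDensity [CompactSpace X] (h : HermitianMetric (n := n) L)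
    {φ Γ : X → ℝ} (hφ : IsKahlerPotential h φ) (hΓ : IsSmooth (n := n) Γ) :
    volumeMeasure h Γ =
      (volumeMeasure h φ).withDensity fun x => ENNReal.ofReal (volRatio h φ Γ x) := by
  have hr : Measurable fun x => ENNReal.ofReal (volRatio h φ Γ x) :=
    ((jointSmooth_volRatio h hφ (IsSmooth.jointSmooth hΓ)).isSmooth
      0).continuous.measurable.ennreal_ofReal
  refine Measure.ext_of_lintegral _ fun f hf => ?_
  rw [lintegral_withDensity_eq_lintegral_mul _ hr hf]
  simp only [Pi.mul_apply]
  rw [lintegral_volumeMeasure h Γ hf, lintegral_volumeMeasure h φ (hr.fun_mul hf)]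
  refine Finset.sum_congr rfl fun p _ => ?_
  set c := chartAt (Fin n → ℂ) p
  have hc : c ∈ atlas (Fin n → ℂ) X := chart_mem_atlas _ p
  rw [lintegral_chartMeasure h hΓ hc (measurable_multInv.fun_mul hf),
    lintegral_chartMeasure h hφ.1 hc
      (f := fun x => multInv n x * (ENNReal.ofReal (volRatio h φ Γ x) * f x))
      (measurable_multInv.mul (hr.mul hf))]
  refine setLIntegral_congr_fun c.open_target.measurableSet fun z hz => ?_
  have hx := c.map_target hz
  have hpos := re_det_metricMatrix_pos h hφ hc hx
  -- The weights `multInv` do not depend on the metric, so comparing densities in each covering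
  -- chart suffices.
  have e : chartDensity h Γ c z = chartDensity h φ c z * volRatio h φ Γ (c.symm z) := by
    rw [chartDensity, chartDensity, volRatio_eq h hc hx (hφ.1 _) (hΓ _)]
    field_simp
  have hnn : 0 ≤ chartDensity h φ c z := by rw [chartDensity]; positivity
  rw [e, ENNReal.ofReal_mul hnn]
  ring

/-- In a chart the density is continuous, hence integrable on a compact neighbourhood; so the
measure is locally finite, and compactness of the manifold does the rest. -/
theorem isFiniteMeasure_volumeMeasure [CompactSpace X] (h : HermitianMetric (n := n) L)
    {φ : X → ℝ} (hφ : IsSmooth (n := n) φ) : IsFiniteMeasure (volumeMeasure h φ) := by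
  have : IsLocallyFiniteMeasure (volumeMeasure h φ) := by
    refine ⟨fun x => ?_⟩
    set c := chartAt (Fin n → ℂ) x
    have hc : c ∈ atlas (Fin n → ℂ) X := chart_mem_atlas _ x
    have hx : x ∈ c.source := mem_chart_source _ x
    obtain ⟨K, hK, hKt, hKc⟩ := exists_compact_subset c.open_target (c.map_source hx)
    have hU : IsOpen (c.source ∩ c ⁻¹' interior K) := c.isOpen_inter_preimage isOpen_interior
    refine ⟨c.source ∩ c ⁻¹' interior K, hU.mem_nhds ⟨hx, hKt⟩, ?_⟩
    have e1 : volumeMeasure h φ (c.source ∩ c ⁻¹' interior K) =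
        chartMeasure h φ c (c.source ∩ c ⁻¹' interior K) := by
      rw [← restrict_volumeMeasure h hφ hc, Measure.restrict_apply hU.measurableSet,
        Set.inter_eq_left.2 Set.inter_subset_left]
    have e2 := lintegral_chartMeasure_source h hφ hc hU.measurableSet (measurable_const (a := 1))
    rw [lintegral_const, one_mul, Measure.restrict_apply MeasurableSet.univ, Set.univ_inter] at e2
    rw [e1, e2]
    have hi : IntegrableOn (chartDensity h φ c) K :=
      ((continuousOn_chartDensity h hφ hc).mono hKc).integrableOn_compact hK
    refine lt_of_le_of_lt ?_ hi.lintegral_lt_top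
    simp only [mul_one]
    refine lintegral_mono_set ?_
    rintro z ⟨hz, hz'⟩
    have := interior_subset hz'.2
    rwa [c.right_inv hz] at this
  infer_instance

/-- The density is strictly positive, so a null open set would have a Lebesgue-null nonempty open
image in a chart. -/
theorem isOpenPosMeasure_volumeMeasure [CompactSpace X] (h : HermitianMetric (n := n) L)
    {φ : X → ℝ} (hφ : IsKahlerPotential h φ) : (volumeMeasure h φ).IsOpenPosMeasure := by
  refine ⟨fun U hU hne => ?_⟩
  obtain ⟨x, hxU⟩ := hne
  set c := chartAt (Fin n → ℂ) x
  have hc : c ∈ atlas (Fin n → ℂ) X := chart_mem_atlas _ x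
  have hx : x ∈ c.source := mem_chart_source _ x
  intro h0
  have e1 : chartMeasure h φ c U = 0 := by
    rw [← restrict_volumeMeasure h hφ.1 hc]
    exact le_antisymm ((Measure.restrict_apply_le _ _).trans h0.le) zero_le
  have e2 := lintegral_chartMeasure_source h hφ.1 hc hU.measurableSet (measurable_const (a := 1))
  rw [lintegral_const, one_mul, Measure.restrict_apply MeasurableSet.univ, Set.univ_inter, e1] at e2
  have hV : IsOpen (c.target ∩ c.symm ⁻¹' U) := c.symm.isOpen_inter_preimage hU
  have hVne : (c.target ∩ c.symm ⁻¹' U).Nonempty :=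
    ⟨c x, c.map_source hx, by simpa [c.left_inv hx] using hxU⟩
  have hpos : ∀ z ∈ c.target ∩ c.symm ⁻¹' U, 0 < chartDensity h φ c z := fun z hz => by
    have := re_det_metricMatrix_pos h hφ hc (c.map_target hz.1)
    rw [chartDensity]; positivity
  simp only [mul_one] at e2
  have hm : AEMeasurable (fun z => ENNReal.ofReal (chartDensity h φ c z))
      (volume.restrict (c.target ∩ c.symm ⁻¹' U)) :=
    (aemeasurable_chartDensity h hφ.1 hc).mono_measure
      (Measure.restrict_mono Set.inter_subset_left le_rfl)
  have e3 := (lintegral_eq_zero_iff' hm).1 e2.symm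
  have e4 : ∀ᵐ z ∂(volume.restrict (c.target ∩ c.symm ⁻¹' U)), False := by
    filter_upwards [e3, ae_restrict_mem hV.measurableSet] with z hz hz'
    have := hpos z hz'
    simp only [Pi.zero_apply, ENNReal.ofReal_eq_zero] at hz
    linarith
  have e5 : volume (c.target ∩ c.symm ⁻¹' U) = 0 := by
    have := ae_iff.1 e4
    simpa using this
  exact (hV.measure_pos volume hVne).ne' e5

lemma setIntegral_source_volumeMeasure [CompactSpace X] (h : HermitianMetric (n := n) L)
    {φ : X → ℝ} (hφ : IsKahlerPotential h φ) {c : OpenPartialHomeomorph X (Fin n → ℂ)}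
    (hc : c ∈ atlas (Fin n → ℂ) X) {f : X → ℝ} (hf : Measurable f) :
    ∫ x in c.source, f x ∂volumeMeasure h φ =
      ∫ z in c.target, chartDensity h φ c z * f (c.symm z) := by
  have hs := aemeasurable_chart_symm c
  rw [restrict_volumeMeasure h hφ.1 hc, chartMeasure, integral_map
    (hs.mono_ac (withDensity_absolutelyContinuous _ _)) hf.aestronglyMeasurable,
    integral_withDensity_eq_integral_toReal_smul₀ (aemeasurable_chartDensity h hφ.1 hc)
    (Eventually.of_forall fun _ => ENNReal.ofReal_lt_top)]
  refine setIntegral_congr_fun c.open_target.measurableSet fun z hz => ?_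
  have hpos := re_det_metricMatrix_pos h hφ hc (c.map_target hz)
  simp only [smul_eq_mul]
  rw [ENNReal.toReal_ofReal (by rw [chartDensity]; positivity)]

end VolumeMeasure

/-! ### The Green formula on a compact manifold -/

section GreenFormula

open Filter Topology

lemma hessMat_congr {n : ℕ} {F G : (Fin n → ℂ) → ℝ} {z : Fin n → ℂ} (h : F =ᶠ[𝓝 z] G) :
    hessMat F z = hessMat G z := by
  ext i j
  simp only [hessMat, Matrix.of_apply, dz_eq_wirt, dzbar_eq_wirt]
  refine wirt_congr ?_
  filter_upwards [h.eventually_nhds] with y hy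
  refine wirt_congr ?_
  filter_upwards [hy] with w hw
  rw [hw]

lemma hessMat_eq_zero_of_notMem_tsupport {n : ℕ} {u : (Fin n → ℂ) → ℝ} {z : Fin n → ℂ}
    (hz : z ∉ tsupport u) : hessMat u z = 0 := by
  rw [hessMat_congr (notMem_tsupport_iff_eventuallyEq.1 hz)]
  have e : ∀ j, dzbar j (fun _ : Fin n → ℂ => (0 : ℂ)) = fun _ => 0 := fun j => by
    ext; simp [dzbar]
  ext i j
  simp [hessMat, dz, e]

lemma contDiffAt_trace_adjugate_hessMat {n : ℕ} {P v : (Fin n → ℂ) → ℝ} {z : Fin n → ℂ}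
    (hP : ContDiffAt ℝ ∞ P z) (hv : ContDiffAt ℝ ∞ v z) :
    ContDiffAt ℝ ∞ (fun y => ((hessMat P y).adjugate * hessMat v y).trace) z := by
  simp only [Matrix.trace, Matrix.diag_apply, Matrix.mul_apply]
  exact ContDiffAt.sum fun i _ => ContDiffAt.sum fun j _ =>
    (contDiffAt_adjugate (contDiffAt_hessMat hP) i j).mul (contDiffAt_hessMat hv j i)

/-- The real form of the Green formula on `ℂⁿ`. -/
theorem integral_mul_re_trace_adjugate_hessMat {n : ℕ} {U : Set (Fin n → ℂ)} (hU : IsOpen U)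
    {P u v : (Fin n → ℂ) → ℝ} (hP : ∀ z ∈ U, ContDiffAt ℝ ∞ P z)
    (hv : ∀ z ∈ U, ContDiffAt ℝ ∞ v z) (hu : ∀ z ∈ U, ContDiffAt ℝ ∞ u z)
    (hc : HasCompactSupport u) (hsub : tsupport u ⊆ U) :
    ∫ z, u z * ((hessMat P z).adjugate * hessMat v z).trace.re =
      ∫ z, v z * ((hessMat P z).adjugate * hessMat u z).trace.re := by
  have key : ∀ F : (Fin n → ℂ) → ℂ, (∀ z ∈ U, ContDiffAt ℝ ∞ F z) →
      (∀ z, z ∉ tsupport u → F z = 0) → ∫ z, (F z).re = (∫ z, F z).re := by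
    intro F hF hF0
    have hs : tsupport F ⊆ tsupport u := closure_minimal
      (fun z hz => by by_contra h; exact hz (hF0 z h)) (isClosed_tsupport _)
    have hcont : Continuous F :=
      (contDiff_of_tsupport fun z hz => hF z (hsub (hs hz))).continuous
    have hi : Integrable F := hcont.integrable_of_hasCompactSupport
      (hc.of_isClosed_subset (isClosed_tsupport _) hs)
    exact Complex.reCLM.integral_comp_comm hi
  have h1 := key (fun z => (u z : ℂ) * ((hessMat P z).adjugate * hessMat v z).trace)
    (fun z hz => (contDiffAt_ofReal_comp (hu z hz)).mul
      (contDiffAt_trace_adjugate_hessMat (hP z hz) (hv z hz)))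
    (fun z hz => by rw [image_eq_zero_of_notMem_tsupport hz]; simp)
  have h2 := key (fun z => (v z : ℂ) * ((hessMat P z).adjugate * hessMat u z).trace)
    (fun z hz => (contDiffAt_ofReal_comp (hv z hz)).mul
      (contDiffAt_trace_adjugate_hessMat (hP z hz) (hu z hz)))
    (fun z hz => by rw [hessMat_eq_zero_of_notMem_tsupport hz]; simp)
  simp only [Complex.re_ofReal_mul] at h1 h2
  rw [h1, h2, integral_mul_trace_adjugate_hessMat hU hP hv hu hc hsub]

variable {n : ℕ} {X : Type*} [TopologicalSpace X] [ChartedSpace (Fin n → ℂ) X]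
  {L : X → Type*} [∀ x, AddCommGroup (L x)] [∀ x, Module ℂ (L x)] [∀ x, TopologicalSpace (L x)]
  [TopologicalSpace (TotalSpace ℂ L)] [FiberBundle ℂ L] [VectorBundle ℂ ℂ L]
  [IsManifold 𝓘(ℂ, Fin n → ℂ) ω X] [ContMDiffVectorBundle ω ℂ L 𝓘(ℂ, Fin n → ℂ)]

lemma laplacian_add (h : HermitianMetric (n := n) L) (φ : X → ℝ) {u v : X → ℝ}
    (hu : IsSmooth (n := n) u) (hv : IsSmooth (n := n) v) (x : X) :
    laplacian h φ (fun y => u y + v y) x = laplacian h φ u x + laplacian h φ v x := by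
  rw [laplacian, ddbar, complexHess_add (chart_mem_atlas _ x) (mem_chart_source _ x) (hu x) (hv x),
    mul_add, Matrix.trace_add, Complex.add_re, neg_add]
  rfl

lemma laplacian_const_mul (h : HermitianMetric (n := n) L) (φ : X → ℝ) {u : X → ℝ}
    (hu : IsSmooth (n := n) u) (a : ℝ) (x : X) :
    laplacian h φ (fun y => a * u y) x = a * laplacian h φ u x := by
  rw [laplacian, ddbar, complexHess_const_mul (chart_mem_atlas _ x) (mem_chart_source _ x) (hu x)]
  simp [laplacian, ddbar, Matrix.trace_smul]

lemma laplacian_eq_zero_of_notMem_tsupport (h : HermitianMetric (n := n) L) (φ : X → ℝ)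
    {u : X → ℝ} (hu : IsSmooth (n := n) u) {x : X} (hx : x ∉ tsupport u) :
    laplacian h φ u x = 0 := by
  rw [laplacian, ddbar, complexHess_congr (chart_mem_atlas _ x) (mem_chart_source _ x) (hu x)
    (notMem_tsupport_iff_eventuallyEq.1 hx)]
  have := complexHess_const (n := n) (chart_mem_atlas (Fin n → ℂ) x) (mem_chart_source _ x) 0
  simp only [Pi.zero_def]
  rw [this]
  simp

lemma continuous_laplacian_of_isSmooth (h : HermitianMetric (n := n) L) {φ u : X → ℝ}
    (hφ : IsKahlerPotential h φ) (hu : IsSmooth (n := n) u) : Continuous (laplacian h φ u) := by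
  have := continuous_laplacian h (Γ := fun _ => φ) (u := fun _ => u) (IsSmooth.jointSmooth hφ.1)
    (fun _ => hφ) (IsSmooth.jointSmooth hu)
  have h0 : Continuous fun x : X => ((0 : ℝ), x) := Continuous.prodMk_right 0
  exact (continuous_iff_continuousAt.2 fun x => (this.continuousAt (x := (0, x))).comp_of_eq
    (f := fun x : X => ((0 : ℝ), x)) h0.continuousAt rfl :)

/-- The determinant in the density cancels the one in the inverse matrix, which leaves the operator
of the Green formula on ℂⁿ with the local potential as P. -/
lemma chartDensity_mul_laplacian (h : HermitianMetric (n := n) L) {φ v : X → ℝ}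
    (hφ : IsKahlerPotential h φ) (hv : IsSmooth (n := n) v)
    {c : OpenPartialHomeomorph X (Fin n → ℂ)} (hc : c ∈ atlas (Fin n → ℂ) X) {p : X}
    {z : Fin n → ℂ} (hz : z ∈ c.target) (hp : c.symm z ∈ (trivializationAt ℂ L p).baseSet) :
    chartDensity h φ c z * laplacian h φ v (c.symm z) =
      -2 ^ n * ((hessMat (fun y => localPotential h φ p (c.symm y)) z).adjugate *
        hessMat (fun y => v (c.symm y)) z).trace.re := by
  have hx := c.map_target hz
  have hd := re_det_metricMatrix_pos h hφ hc hx
  rw [laplacian_eq h hc hx (hφ.1 _) (hv _), trace_inv_mul, det_metricMatrix_eq_re h hφ hc hx,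
    ← Complex.ofReal_inv, Complex.re_ofReal_mul, chartDensity,
    metricMatrix_eq h hc hx (hφ.1 _) hp]
  rw [metricMatrix_eq h hc hx (hφ.1 _) hp] at hd
  simp only [complexHess_eq_hessMat, c.right_inv hz] at hd ⊢
  have := hd.ne'
  field_simp

variable [T2Space X] [CompactSpace X] [MeasurableSpace X] [BorelSpace X]

/-- When the support of u lies in one chart and one frame domain, a single local potential describes
the metric where it matters. The Green formula on ℂⁿ needs compact support of u only, so v is left
untouched. -/
lemma integral_mul_laplacian_of_tsupport (h : HermitianMetric (n := n) L) {φ u v : X → ℝ}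
    (hφ : IsKahlerPotential h φ) (hu : IsSmooth (n := n) u) (hv : IsSmooth (n := n) v)
    {c : OpenPartialHomeomorph X (Fin n → ℂ)} (hc : c ∈ atlas (Fin n → ℂ) X) {p : X}
    (hs : tsupport u ⊆ c.source ∩ (trivializationAt ℂ L p).baseSet) :
    ∫ x, u x * laplacian h φ v x ∂volumeMeasure h φ =
      ∫ x, v x * laplacian h φ u x ∂volumeMeasure h φ := by
  have hlu := continuous_laplacian_of_isSmooth h hφ hu
  have hlv := continuous_laplacian_of_isSmooth h hφ hv
  have hU : IsOpen (c.target ∩ c.symm ⁻¹' (trivializationAt ℂ L p).baseSet) :=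
    c.symm.isOpen_inter_preimage (trivializationAt ℂ L p).open_baseSet
  set U := c.target ∩ c.symm ⁻¹' (trivializationAt ℂ L p).baseSet with hUdef
  -- Extension by zero is needed because the inverse chart has arbitrary values outside the target.
  set ut : (Fin n → ℂ) → ℝ := c.target.indicator fun z => u (c.symm z) with hut
  have hK : IsCompact (c '' tsupport u) :=
    (isClosed_tsupport u).isCompact.image_of_continuousOn
      (c.continuousOn.mono fun x hx => (hs hx).1)
  have hutK : tsupport ut ⊆ c '' tsupport u := by
    refine closure_minimal (fun z hz => ?_) hK.isClosed
    have hzt : z ∈ c.target := Set.mem_of_indicator_ne_zero hz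
    rw [Function.mem_support, hut, Set.indicator_of_mem hzt] at hz
    exact ⟨c.symm z, subset_tsupport _ hz, c.right_inv hzt⟩
  have hKU : c '' tsupport u ⊆ U := by
    rintro _ ⟨x, hx, rfl⟩
    refine ⟨c.map_source (hs hx).1, ?_⟩
    rw [Set.mem_preimage, c.left_inv (hs hx).1]
    exact (hs hx).2
  have hev : ∀ z ∈ c.target, ut =ᶠ[𝓝 z] fun z => u (c.symm z) := fun z hz => by
    filter_upwards [c.open_target.mem_nhds hz] with y hy
    exact Set.indicator_of_mem hy _
  have hsm : ∀ {w : X → ℝ} {z : Fin n → ℂ}, z ∈ c.target → SmoothAt (n := n) w (c.symm z) →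
      ContDiffAt ℝ ∞ (fun z => w (c.symm z)) z := fun {w z} hz hw => by
    have := (smoothAt_iff hc (c.map_target hz)).1 hw
    rwa [c.right_inv hz] at this
  have green := integral_mul_re_trace_adjugate_hessMat hU
    (P := fun z => localPotential h φ p (c.symm z)) (u := ut) (v := fun z => v (c.symm z))
    (fun z hz => hsm hz.1 (smoothAt_localPotential h (hφ.1 _) hz.2))
    (fun z hz => hsm hz.1 (hv _))
    (fun z hz => (hsm hz.1 (hu _)).congr_of_eventuallyEq (hev z hz.1))
    (hK.of_isClosed_subset (isClosed_tsupport _) hutK) (hutK.trans hKU)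
  have h0 : ∀ x, x ∉ c.source → u x = 0 ∧ laplacian h φ u x = 0 := fun x hx => by
    have : x ∉ tsupport u := fun hx' => hx (hs hx').1
    exact ⟨image_eq_zero_of_notMem_tsupport this, laplacian_eq_zero_of_notMem_tsupport h φ hu this⟩
  rw [← setIntegral_eq_integral_of_forall_compl_eq_zero (s := c.source)
      (f := fun x => u x * laplacian h φ v x) (fun x hx => by rw [(h0 x hx).1, zero_mul]),
    ← setIntegral_eq_integral_of_forall_compl_eq_zero (s := c.source)
      (f := fun x => v x * laplacian h φ u x) (fun x hx => by rw [(h0 x hx).2, mul_zero]),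
    setIntegral_source_volumeMeasure h hφ hc (hu.continuous.fun_mul hlv).measurable,
    setIntegral_source_volumeMeasure h hφ hc (hv.continuous.fun_mul hlu).measurable]
  have e1 : ∫ z in c.target, chartDensity h φ c z * (u (c.symm z) * laplacian h φ v (c.symm z)) =
      ∫ z, -2 ^ n * (ut z * ((hessMat (fun y => localPotential h φ p (c.symm y)) z).adjugate *
        hessMat (fun y => v (c.symm y)) z).trace.re) := by
    rw [← integral_indicator c.open_target.measurableSet]
    refine integral_congr_ae (Eventually.of_forall fun z => ?_)
    simp only
    by_cases hz : z ∈ c.target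
    · rw [Set.indicator_of_mem hz, hut, Set.indicator_of_mem hz]
      by_cases hp : c.symm z ∈ (trivializationAt ℂ L p).baseSet
      · rw [mul_left_comm, chartDensity_mul_laplacian h hφ hv hc hz hp]
        ring
      · have : u (c.symm z) = 0 :=
          image_eq_zero_of_notMem_tsupport fun hx' => hp (hs hx').2
        simp [this]
    · rw [Set.indicator_of_notMem hz, hut, Set.indicator_of_notMem hz]
      simp
  have e2 : ∫ z in c.target, chartDensity h φ c z * (v (c.symm z) * laplacian h φ u (c.symm z)) =
      ∫ z, -2 ^ n * (v (c.symm z) * ((hessMat (fun y => localPotential h φ p (c.symm y))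
        z).adjugate * hessMat ut z).trace.re) := by
    rw [← integral_indicator c.open_target.measurableSet]
    refine integral_congr_ae (Eventually.of_forall fun z => ?_)
    simp only
    by_cases hz : z ∈ U
    · rw [Set.indicator_of_mem hz.1, mul_left_comm, chartDensity_mul_laplacian h hφ hu hc hz.1 hz.2,
        hessMat_congr (hev z hz.1)]
      ring
    · rw [hessMat_eq_zero_of_notMem_tsupport fun hz' => hz (hKU (hutK hz'))]
      by_cases hzt : z ∈ c.target
      · have : laplacian h φ u (c.symm z) = 0 :=
          laplacian_eq_zero_of_notMem_tsupport h φ hu fun hx' => hz ⟨hzt, (hs hx').2⟩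
        rw [Set.indicator_of_mem hzt, this]
        simp
      · rw [Set.indicator_of_notMem hzt]
        simp
  rw [e1, e2, integral_const_mul, integral_const_mul, green]

/-- The Laplacian of a Kähler metric on a compact manifold is symmetric. -/
theorem integral_mul_laplacian (h : HermitianMetric (n := n) L) {φ u v : X → ℝ}
    (hφ : IsKahlerPotential h φ) (hu : IsSmooth (n := n) u) (hv : IsSmooth (n := n) v) :
    ∫ x, u x * laplacian h φ v x ∂volumeMeasure h φ =
      ∫ x, v x * laplacian h φ u x ∂volumeMeasure h φ := by
  have := isManifold_real n X
  have := isFiniteMeasure_volumeMeasure h hφ.1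
  -- The sets of the cover lie both in a chart domain and in a frame domain, as the local Green
  -- formula requires.
  set W : X → Set X := fun p =>
    (chartAt (Fin n → ℂ) p).source ∩ (trivializationAt ℂ L p).baseSet with hW
  have hWo : ∀ p, IsOpen (W p) := fun p =>
    (chartAt (Fin n → ℂ) p).open_source.inter (trivializationAt ℂ L p).open_baseSet
  obtain ⟨t, ht⟩ := isCompact_univ.elim_finite_subcover W hWo
    (fun x _ => Set.mem_iUnion.2 ⟨x, mem_chart_source _ x, mem_baseSet_self x⟩)
  obtain ⟨f, hf⟩ := SmoothPartitionOfUnity.exists_isSubordinate 𝓘(ℝ, Fin n → ℂ) isClosed_univ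
    (fun p : t => W p) (fun p => hWo p) (fun x hx => by
      obtain ⟨p, hp, hx'⟩ := Set.mem_iUnion₂.1 (ht hx)
      exact Set.mem_iUnion.2 ⟨⟨p, hp⟩, hx'⟩)
  have hint : ∀ w : X → ℝ, Continuous w → Integrable w (volumeMeasure h φ) := fun w hw =>
    hw.integrable_of_hasCompactSupport (HasCompactSupport.of_compactSpace w)
  have hfs : ∀ p, IsSmooth (n := n) fun x => f p x * u x := fun p => (f p).contMDiff.mul hu
  -- Only u is cut by the partition of unity. Smoothness is carried through the induction because
  -- additivity of the Laplacian and integrability depend on it.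
  have main : IsSmooth (n := n) (∑ p, fun x => f p x * u x) ∧
      ∫ x, (∑ p, fun x => f p x * u x) x * laplacian h φ v x ∂volumeMeasure h φ =
        ∫ x, v x * laplacian h φ (∑ p, fun x => f p x * u x) x ∂volumeMeasure h φ := by
    refine Finset.sum_induction _ (fun w : X → ℝ => IsSmooth (n := n) w ∧
      ∫ x, w x * laplacian h φ v x ∂volumeMeasure h φ =
        ∫ x, v x * laplacian h φ w x ∂volumeMeasure h φ) ?_ ?_ ?_
    · rintro w₁ w₂ ⟨h₁, e₁⟩ ⟨h₂, e₂⟩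
      refine ⟨h₁.add h₂, ?_⟩
      have c0 := continuous_laplacian_of_isSmooth h hφ hv
      have c1 := continuous_laplacian_of_isSmooth h hφ h₁
      have c2 := continuous_laplacian_of_isSmooth h hφ h₂
      have a1 : ∀ x, laplacian h φ (w₁ + w₂) x = laplacian h φ w₁ x + laplacian h φ w₂ x :=
        laplacian_add h φ h₁ h₂
      simp only [a1, Pi.add_apply, add_mul, mul_add]
      rw [integral_add (hint _ (h₁.continuous.fun_mul c0)) (hint _ (h₂.continuous.fun_mul c0)),
        integral_add (hint _ (hv.continuous.fun_mul c1)) (hint _ (hv.continuous.fun_mul c2)), e₁, e₂]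
    · refine ⟨contMDiff_const, ?_⟩
      have : ∀ x, laplacian h φ (0 : X → ℝ) x = 0 := fun x =>
        laplacian_eq_zero_of_notMem_tsupport h φ (u := 0) contMDiff_const (by simp [tsupport])
      simp [this]
    · intro p _
      refine ⟨hfs p, integral_mul_laplacian_of_tsupport h hφ (hfs p) hv
        (chart_mem_atlas (Fin n → ℂ) (p : X)) (p := p) (subset_trans ?_ (hf p))⟩
      exact tsupport_mul_subset_left
  have hsum : (∑ p, fun x => f p x * u x) = u := by
    ext x
    have h1 := f.sum_eq_one (Set.mem_univ x)
    rw [finsum_eq_sum_of_fintype] at h1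
    rw [Finset.sum_apply, ← Finset.sum_mul, h1, one_mul]
  rw [hsum] at main
  exact main.2

end GreenFormula

/-! ### Hermitian forms and their determinants -/

section HermitianForms

open Filter Topology

variable {V : Type*} [AddCommGroup V] [Module ℂ V]

/-- Hermitian forms, linear in the first variable. -/
structure IsHermitianForm (H : V → V → ℂ) : Prop where
  add_left : ∀ s s' t, H (s + s') t = H s t + H s' t
  smul_left : ∀ (c : ℂ) s t, H (c • s) t = c * H s t
  conj_symm : ∀ s t, (starRingEnd ℂ) (H s t) = H t s

lemma IsHermitianForm.add_right {H : V → V → ℂ} (hH : IsHermitianForm H) (s t t' : V) :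
    H s (t + t') = H s t + H s t' := by
  rw [← hH.conj_symm, hH.add_left, map_add, hH.conj_symm, hH.conj_symm]

lemma IsHermitianForm.smul_right {H : V → V → ℂ} (hH : IsHermitianForm H) (c : ℂ) (s t : V) :
    H s (c • t) = (starRingEnd ℂ) c * H s t := by
  rw [← hH.conj_symm, hH.smul_left, map_mul, hH.conj_symm]

lemma IsHermitianForm.zero_left {H : V → V → ℂ} (hH : IsHermitianForm H) (t : V) : H 0 t = 0 := by
  have := hH.smul_left 0 0 t
  rwa [zero_smul, zero_mul] at this

lemma IsHermitianForm.sum_left {ι : Type*} {H : V → V → ℂ} (hH : IsHermitianForm H)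
    (S : Finset ι) (c : ι → ℂ) (s : ι → V) (t : V) :
    H (∑ i ∈ S, c i • s i) t = ∑ i ∈ S, c i * H (s i) t := by
  classical
  induction S using Finset.induction_on with
  | empty => simp [hH.zero_left]
  | insert a S ha ih => rw [Finset.sum_insert ha, hH.add_left, ih, hH.smul_left,
      Finset.sum_insert ha]

lemma IsHermitianForm.sum_right {ι : Type*} {H : V → V → ℂ} (hH : IsHermitianForm H)
    (S : Finset ι) (c : ι → ℂ) (s : V) (t : ι → V) :
    H s (∑ i ∈ S, c i • t i) = ∑ i ∈ S, (starRingEnd ℂ) (c i) * H s (t i) := by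
  rw [← hH.conj_symm, hH.sum_left, map_sum]
  refine Finset.sum_congr rfl fun i _ => ?_
  rw [map_mul, hH.conj_symm]

/-- A positive definite Hermitian form has an orthonormal basis. -/
theorem IsHermitianForm.exists_orthonormal [Module.Finite ℂ V] {H : V → V → ℂ}
    (hH : IsHermitianForm H) (hpos : ∀ s, s ≠ 0 → 0 < (H s s).re) :
    ∃ s : Module.Basis (Fin (Module.finrank ℂ V)) ℂ V,
      ∀ α β, H (s α) (s β) = if α = β then 1 else 0 := by
  -- The arguments are exchanged because `inner` is linear in the second variable while H is linear
  -- in the first.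
  let core : InnerProductSpace.Core ℂ V :=
    { inner := fun x y => H y x
      conj_inner_symm := fun x y => hH.conj_symm x y
      re_inner_nonneg := fun x => by
        by_cases hx : x = 0
        · simp [hx, hH.zero_left]
        · exact (hpos x hx).le
      add_left := fun x y z => hH.add_right z x y
      smul_left := fun x y r => hH.smul_right r y x
      definite := fun x hx => by
        by_contra h
        have h1 := hpos x h
        have h2 : H x x = 0 := hx
        rw [h2] at h1
        exact lt_irrefl _ h1 }
  let _ : NormedAddCommGroup V := core.toNormedAddCommGroup
  let _ : InnerProductSpace ℂ V := InnerProductSpace.ofCore core.toCore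
  refine ⟨(stdOrthonormalBasis ℂ V).toBasis, fun α β => ?_⟩
  have := orthonormal_iff_ite.1 (stdOrthonormalBasis ℂ V).orthonormal β α
  simp only [eq_comm (a := α) (b := β)]
  rw [OrthonormalBasis.coe_toBasis]
  exact this

/-- The Gram matrix transforms with the same shape Jᵀ A J̄ as a metric. The factor does not depend
on H, so a change of basis only adds a constant to log det. -/
lemma IsHermitianForm.det_basis_change {N : ℕ} {H : V → V → ℂ} (hH : IsHermitianForm H)
    (b s : Module.Basis (Fin N) ℂ V) :
    (Matrix.of fun α β => H (b α) (b β)).det =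
      ((‖(s.toMatrix b).det‖ ^ 2 : ℝ) : ℂ) * (Matrix.of fun α β => H (s α) (s β)).det := by
  have e : (Matrix.of fun α β => H (b α) (b β)) = (s.toMatrix b).transpose *
      (Matrix.of fun α β => H (s α) (s β)) * (s.toMatrix b).map (starRingEnd ℂ) := by
    ext α β
    conv_lhs => rw [Matrix.of_apply, ← s.sum_repr (b α), ← s.sum_repr (b β), hH.sum_left]
    simp only [hH.sum_right, Matrix.mul_apply, Matrix.transpose_apply, Matrix.map_apply,
      Matrix.of_apply, Finset.sum_mul, Finset.mul_sum, Module.Basis.toMatrix_apply]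
    rw [Finset.sum_comm]
    refine Finset.sum_congr rfl fun i _ => Finset.sum_congr rfl fun j _ => by ring
  rw [e, det_transpose_mul_mul_conj]

/-- The derivative of `log det` at a form with an orthonormal basis `s`. -/
theorem hasDerivAt_log_det {N : ℕ} {H : ℝ → V → V → ℂ} (hH : ∀ t, IsHermitianForm (H t))
    (b s : Module.Basis (Fin N) ℂ V) {t : ℝ}
    (hs : ∀ α β, H t (s α) (s β) = if α = β then 1 else 0) {H' : Fin N → Fin N → ℂ}
    (hd : ∀ α β, HasDerivAt (fun r => H r (s α) (s β)) (H' α β) t) :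
    HasDerivAt (fun r => Real.log (Matrix.of fun α β => H r (b α) (b β)).det.re)
      (∑ α, (H' α α).re) t := by
  have h1 : HasDerivAt (fun r => (Matrix.of fun α β => H r (s α) (s β)).det)
      (∑ α, H' α α) t := by
    have := hasDerivAt_det (A := fun r => Matrix.of fun α β => H r (s α) (s β))
      (A' := Matrix.of H') (t := t) (fun α β => hd α β)
    -- At the parameter t the Gram matrix is the identity, so its adjugate is 1 and Jacobi's formula
    -- reduces to a trace.
    have e : (Matrix.of fun α β => H t (s α) (s β)) = 1 := by
      ext α β; rw [Matrix.of_apply, hs, Matrix.one_apply]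
    rw [e, Matrix.adjugate_one, one_mul] at this
    exact this
  have hdet : (s.toMatrix b).det ≠ 0 := by
    intro h0
    have := congrArg Matrix.det (s.toMatrix_mul_toMatrix_flip b)
    rw [Matrix.det_mul, h0, zero_mul, Matrix.det_one] at this
    exact zero_ne_one this
  have hc : (0 : ℝ) < ‖(s.toMatrix b).det‖ ^ 2 := by positivity
  have h2 := (Complex.reCLM.hasFDerivAt.comp_hasDerivAt t h1).const_mul
    (‖(s.toMatrix b).det‖ ^ 2)
  have e1 : (Matrix.of fun α β => H t (s α) (s β)).det.re = 1 := by
    have e : (Matrix.of fun α β => H t (s α) (s β)) = 1 := by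
      ext α β; rw [Matrix.of_apply, hs, Matrix.one_apply]
    rw [e, Matrix.det_one, Complex.one_re]
  have h3 := h2.log (by
    simp only [Function.comp, Complex.reCLM_apply, e1]
    simpa using hdet)
  simp only [Function.comp_apply, Complex.reCLM_apply, e1, mul_one, mul_div_cancel_left₀ _ hc.ne',
    Complex.re_sum] at h3
  refine h3.congr_of_eventuallyEq (Eventually.of_forall fun r => ?_)
  simp only
  rw [(hH r).det_basis_change b s, Complex.re_ofReal_mul]

end HermitianForms

/-! ### The Hermitian forms Hilb_k(φ) and their positivity -/

section HilbForms

open Filter Topology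

variable {n : ℕ} {X : Type*} [TopologicalSpace X] [ChartedSpace (Fin n → ℂ) X]
  {L : X → Type*} [∀ x, AddCommGroup (L x)] [∀ x, Module ℂ (L x)] [∀ x, TopologicalSpace (L x)]
  [TopologicalSpace (TotalSpace ℂ L)] [FiberBundle ℂ L] [VectorBundle ℂ ℂ L]

lemma isHermitianForm_pairing (h : HermitianMetric (n := n) L) (k : ℕ) (φ : X → ℝ) (x : X) :
    IsHermitianForm fun s t : holSections n L k => pairing h k φ s t x where
  add_left s s' t := by
    simp only [pairing, Submodule.coe_add, Pi.add_apply, map_add]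
    ring
  smul_left c s t := by
    simp only [pairing, Submodule.coe_smul, Pi.smul_apply, map_smul, smul_eq_mul]
    ring
  conj_symm s t := by
    simp only [pairing, map_mul, Complex.conj_conj, Complex.conj_ofReal]
    ring

/-- All dependence on φ sits in a scalar factor, so varying φ requires differentiating only e^{-kφ};
the product for φ = 0 stays fixed. -/
lemma pairing_eq_exp_mul (h : HermitianMetric (n := n) L) (k : ℕ) (φ : X → ℝ)
    (s t : holSections n L k) (x : X) :
    pairing h k φ s t x = (Real.exp (-(k * φ x)) : ℂ) * pairing h k 0 s t x := by
  rw [pairing, pairing, mul_pow, mul_pow, ← Real.exp_nat_mul]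
  simp only [Pi.zero_apply, neg_zero, Real.exp_zero, one_pow, one_mul, mul_neg]
  push_cast
  ring

lemma re_pairing_self (h : HermitianMetric (n := n) L) (k : ℕ) (φ : X → ℝ)
    (s : holSections n L k) {p x : X} (hp : x ∈ (trivializationAt ℂ L p).baseSet) :
    (pairing h k φ s s x).re =
      ‖powCoord k p x (s.1 x)‖ ^ 2 * (Real.exp (-φ x) * h.weight p x) ^ k := by
  rw [pairing_eq h k φ s s hp, Complex.mul_conj, ← Complex.ofReal_mul, Complex.ofReal_re,
    Complex.normSq_eq_norm_sq]

lemma re_pairing_self_nonneg (h : HermitianMetric (n := n) L) (k : ℕ) (φ : X → ℝ)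
    (s : holSections n L k) (x : X) : 0 ≤ (pairing h k φ s s x).re := by
  rw [re_pairing_self h k φ s (mem_baseSet_self x)]
  have := h.weight_pos (mem_baseSet_self (L := L) x)
  positivity

lemma re_pairing_self_pos (h : HermitianMetric (n := n) L) (k : ℕ) (φ : X → ℝ)
    {s : holSections n L k} {x : X} (hs : s.1 x ≠ 0) : 0 < (pairing h k φ s s x).re := by
  rw [re_pairing_self h k φ s (mem_baseSet_self x)]
  have := h.weight_pos (mem_baseSet_self (L := L) x)
  have h1 : powCoord k x x (s.1 x) ≠ 0 := fun h0 =>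
    hs (powCoord_injective k (mem_baseSet_self x) (by rw [h0, map_zero]))
  positivity

variable [IsManifold 𝓘(ℂ, Fin n → ℂ) ω X] [ContMDiffVectorBundle ω ℂ L 𝓘(ℂ, Fin n → ℂ)]

lemma contMDiffAt_powCoord {k : ℕ} (s : holSections n L k) {p x : X}
    (hp : x ∈ (trivializationAt ℂ L p).baseSet) :
    ContMDiffAt 𝓘(ℂ, Fin n → ℂ) 𝓘(ℂ, ℂ) ω (fun x => powCoord k p x (s.1 x)) x :=
  (s.2 p).contMDiffAt ((trivializationAt ℂ L p).open_baseSet.mem_nhds hp)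

/-- The defining formula uses a different frame at every point. Near x it is rewritten in the frame
around x, where every factor is continuous. -/
lemma continuous_pairing (h : HermitianMetric (n := n) L) (k : ℕ) {φ : X → ℝ} (hφ : Continuous φ)
    (s t : holSections n L k) : Continuous (pairing h k φ s t) := by
  rw [continuous_iff_continuousAt]
  intro x
  have hx := mem_baseSet_self (L := L) x
  have h1 : ContinuousAt (fun y => powCoord k x y (s.1 y) *
      (starRingEnd ℂ) (powCoord k x y (t.1 y)) *
      (((Real.exp (-φ y) * h.weight x y) ^ k : ℝ) : ℂ)) x :=
    ((contMDiffAt_powCoord s hx).continuousAt.mul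
      (Complex.continuous_conj.continuousAt.comp (contMDiffAt_powCoord t hx).continuousAt)).mul
      (Complex.continuous_ofReal.continuousAt.comp
        (((Real.continuous_exp.comp hφ.neg).continuousAt.mul
          (h.smoothAt_weight hx).continuousAt).pow k))
  refine h1.congr ?_
  filter_upwards [(trivializationAt ℂ L x).open_baseSet.mem_nhds hx] with y hy
  exact (pairing_eq h k φ s t hy).symm

lemma isSmooth_re_pairing_self (h : HermitianMetric (n := n) L) (k : ℕ) {φ : X → ℝ}
    (hφ : IsSmooth (n := n) φ) (s : holSections n L k) :
    IsSmooth (n := n) fun x => (pairing h k φ s s x).re := by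
  intro x
  have hx := mem_baseSet_self (L := L) x
  have h1 : SmoothAt (n := n) (fun y => ‖powCoord k x y (s.1 y)‖ ^ 2) x :=
    smoothAt_comp (V := ℂ) (g := fun w => ‖w‖ ^ 2) (contDiff_norm_sq ℝ).contDiffAt
      (contMDiffAt_restrictScalars (contMDiffAt_powCoord s hx))
  have h2 : SmoothAt (n := n) (fun y => Real.exp (-φ y)) x :=
    smoothAt_comp (V := ℝ) (g := fun w => Real.exp (-w)) (Real.contDiff_exp.comp
      contDiff_neg).contDiffAt (hφ x)
  refine (h1.mul ((h2.mul (h.smoothAt_weight hx)).pow k)).congr_of_eventuallyEq ?_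
  filter_upwards [(trivializationAt ℂ L x).open_baseSet.mem_nhds hx] with y hy
  exact re_pairing_self h k φ s hy

variable [CompactSpace X] [T2Space X] [MeasurableSpace X] [BorelSpace X]

lemma integrable_volumeMeasure {E : Type*} [NormedAddCommGroup E] (h : HermitianMetric (n := n) L)
    {φ : X → ℝ} (hφ : IsSmooth (n := n) φ) {f : X → E} (hf : Continuous f) :
    Integrable f (volumeMeasure h φ) := by
  have := isFiniteMeasure_volumeMeasure h hφ
  exact hf.integrable_of_hasCompactSupport (HasCompactSupport.of_compactSpace f)

lemma isHermitianForm_Hilb (h : HermitianMetric (n := n) L) (k : ℕ) {φ : X → ℝ}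
    (hφ : IsSmooth (n := n) φ) : IsHermitianForm (Hilb h k φ) where
  add_left s s' t := by
    have hi := fun s t : holSections n L k =>
      integrable_volumeMeasure h hφ (continuous_pairing h k hφ.continuous s t)
    rw [Hilb, Hilb, Hilb, ← integral_add (hi s t) (hi s' t)]
    exact integral_congr_ae (Eventually.of_forall fun x =>
      (isHermitianForm_pairing h k φ x).add_left s s' t)
  smul_left c s t := by
    rw [Hilb, Hilb, ← integral_const_mul]
    exact integral_congr_ae (Eventually.of_forall fun x =>
      (isHermitianForm_pairing h k φ x).smul_left c s t)
  conj_symm s t := by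
    rw [Hilb, Hilb, ← integral_conj]
    exact integral_congr_ae (Eventually.of_forall fun x =>
      (isHermitianForm_pairing h k φ x).conj_symm s t)

lemma re_Hilb (h : HermitianMetric (n := n) L) (k : ℕ) {φ : X → ℝ}
    (hφ : IsSmooth (n := n) φ) (s t : holSections n L k) :
    (Hilb h k φ s t).re = ∫ x, (pairing h k φ s t x).re ∂volumeMeasure h φ :=
  (Complex.reCLM.integral_comp_comm
    (integrable_volumeMeasure h hφ (continuous_pairing h k hφ.continuous s t))).symm

lemma integral_pos_of_continuous (h : HermitianMetric (n := n) L) {φ : X → ℝ}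
    (hφ : IsKahlerPotential h φ) {f : X → ℝ} (hf : Continuous f) (h0 : ∀ x, 0 ≤ f x) {x : X}
    (hx : f x ≠ 0) : 0 < ∫ x, f x ∂volumeMeasure h φ := by
  have := isOpenPosMeasure_volumeMeasure h hφ
  have := isFiniteMeasure_volumeMeasure h hφ.1
  exact hf.integral_pos_of_hasCompactSupport_nonneg_nonzero (HasCompactSupport.of_compactSpace f)
    h0 hx

lemma re_Hilb_self_pos (h : HermitianMetric (n := n) L) (k : ℕ) {φ : X → ℝ}
    (hφ : IsKahlerPotential h φ) {s : holSections n L k} (hs : s ≠ 0) :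
    0 < (Hilb h k φ s s).re := by
  obtain ⟨x, hx⟩ : ∃ x, s.1 x ≠ 0 := by
    by_contra! hcon
    exact hs (Subtype.ext (funext hcon))
  rw [re_Hilb h k hφ.1]
  exact integral_pos_of_continuous h hφ
    (Complex.continuous_re.comp (continuous_pairing h k hφ.1.continuous s s))
    (re_pairing_self_nonneg h k φ s) (re_pairing_self_pos h k φ hx).ne'

/-- The chosen basis is orthonormal. -/
theorem isOrthonormalBasis_orthonormalBasis (h : HermitianMetric (n := n) L) {k : ℕ}
    [Module.Finite ℂ (holSections n L k)] {φ : X → ℝ} (hφ : IsKahlerPotential h φ) :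
    IsOrthonormalBasis (Hilb h k φ) (orthonormalBasis (Hilb h k φ)) := by
  obtain ⟨s, hs⟩ := (isHermitianForm_Hilb h k hφ.1).exists_orthonormal
    fun s hs => re_Hilb_self_pos h k hφ hs
  have : IsOrthonormalBasis (Hilb h k φ) s := ⟨hs, s.linearIndependent, s.span_eq⟩
  exact Classical.epsilon_spec ⟨_, this⟩

end HilbForms

/-! ### Uniqueness of potentials and the Bergman function of a balanced metric -/

section Uniqueness

open Filter Topology

variable {n : ℕ} {X : Type*} [TopologicalSpace X] [ChartedSpace (Fin n → ℂ) X]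
  [IsManifold 𝓘(ℂ, Fin n → ℂ) ω X]

lemma hermForm_zero (v w : Fin n → ℂ) : hermForm 0 v w = 0 := by simp [hermForm]

/-- The hypothesis speaks of the preferred chart at each point only; the maximum principle needs the
vanishing on a whole ball in one chart. -/
lemma complexHess_eq_zero_of_ddbar {u : X → ℝ} (hu : IsSmooth (n := n) u)
    (h0 : ddbar (n := n) u = 0) {c : OpenPartialHomeomorph X (Fin n → ℂ)}
    (hc : c ∈ atlas (Fin n → ℂ) X) {x : X} (hx : x ∈ c.source) : complexHess c u x = 0 := by
  have h1 : complexHess (chartAt (Fin n → ℂ) x) u x = 0 := congrFun h0 x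
  rw [complexHess_chart_change hc (chart_mem_atlas _ x) hx (mem_chart_source _ x) (hu x), h1]
  simp

/-- A pluriharmonic function on a compact connected manifold is constant. -/
theorem eq_const_of_ddbar_eq_zero [CompactSpace X] [ConnectedSpace X] {u : X → ℝ}
    (hu : IsSmooth (n := n) u) (h0 : ddbar (n := n) u = 0) : ∃ a : ℝ, ∀ x, u x = a := by
  have hcont : Continuous u := hu.continuous
  obtain ⟨m, -, hm⟩ := isCompact_univ.exists_isMaxOn Set.univ_nonempty hcont.continuousOn
  have hmax : ∀ y, u y ≤ u m := fun y => hm (Set.mem_univ y)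
  -- The set where u attains its maximum is closed, and it is open by the maximum principle on
  -- coordinate balls; connectedness makes it everything.
  have hclosed : IsClosed {x | u x = u m} := isClosed_eq hcont continuous_const
  have hopen : IsOpen {x | u x = u m} := by
    rw [isOpen_iff_mem_nhds]
    intro x hx
    set c := chartAt (Fin n → ℂ) x with hcdef
    have hc : c ∈ atlas (Fin n → ℂ) X := chart_mem_atlas _ x
    have hxs : x ∈ c.source := mem_chart_source _ x
    obtain ⟨r, hr, hball⟩ := Metric.isOpen_iff.1 c.open_target (c x) (c.map_source hxs)
    have key := eqOn_ball_of_leviForm_eq_zero (F := fun z => u (c.symm z)) (z := c x) (r := r)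
      (fun y hy => by
        have := (smoothAt_iff hc (c.map_target (hball hy))).1 (hu _)
        rw [c.right_inv (hball hy)] at this
        exact this.of_le two_le_infty)
      (fun y hy v w => by
        have := leviForm_eq_hermForm hc (c.map_target (hball hy)) (hu _) v w
        rw [c.right_inv (hball hy)] at this
        rw [this, complexHess_eq_zero_of_ddbar hu h0 hc (c.map_target (hball hy)), hermForm_zero])
      (fun y _ => by
        simp only [c.left_inv hxs]
        exact (hmax _).trans_eq (Eq.symm hx))
    filter_upwards [c.open_source.mem_nhds hxs,
      (c.continuousAt hxs).preimage_mem_nhds (Metric.ball_mem_nhds _ hr)] with y hy hyb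
    have := key (c y) hyb
    simp only [c.left_inv hxs, c.left_inv hy] at this
    exact this.trans hx
  have huniv := IsClopen.eq_univ ⟨hclosed, hopen⟩ ⟨m, rfl⟩
  exact ⟨u m, fun x => (huniv ▸ Set.mem_univ x : x ∈ {x | u x = u m})⟩

lemma ddbar_add {u v : X → ℝ} (hu : IsSmooth (n := n) u) (hv : IsSmooth (n := n) v) :
    ddbar (n := n) (fun x => u x + v x) = ddbar u + ddbar v :=
  funext fun x => complexHess_add (chart_mem_atlas _ x) (mem_chart_source _ x) (hu x) (hv x)

lemma ddbar_const_mul {u : X → ℝ} (hu : IsSmooth (n := n) u) (a : ℝ) :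
    ddbar (n := n) (fun x => a * u x) = (a : ℂ) • ddbar u :=
  funext fun x => complexHess_const_mul (chart_mem_atlas _ x) (mem_chart_source _ x) (hu x) a

lemma ddbar_const (a : ℝ) : ddbar (n := n) (fun _ : X => a) = 0 :=
  funext fun x => complexHess_const (chart_mem_atlas _ x) (mem_chart_source _ x) a

/-- Potentials of the same form differ by a constant. -/
lemma eq_add_const_of_ddbar_eq [CompactSpace X] [ConnectedSpace X] {u v : X → ℝ}
    (hu : IsSmooth (n := n) u) (hv : IsSmooth (n := n) v) (h : ddbar (n := n) u = ddbar v) :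
    ∃ a : ℝ, ∀ x, u x = v x + a := by
  have hv' : IsSmooth (n := n) fun x => (-1) * v x := contMDiff_const.mul hv
  obtain ⟨a, ha⟩ := eq_const_of_ddbar_eq_zero (n := n) (u := fun x => u x + (-1) * v x)
    (hu.add hv') (by
      rw [ddbar_add hu hv', ddbar_const_mul hv, h]
      simp)
  exact ⟨a, fun x => by linarith [ha x]⟩

variable {L : X → Type*} [∀ x, AddCommGroup (L x)] [∀ x, Module ℂ (L x)]
  [∀ x, TopologicalSpace (L x)]
  [TopologicalSpace (TotalSpace ℂ L)] [FiberBundle ℂ L] [VectorBundle ℂ ℂ L]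

lemma curvForm_eq (h : HermitianMetric (n := n) L) (φ : X → ℝ) :
    curvForm h φ = curvForm h 0 + ddbar φ := by
  funext x
  have := complexHess_const (n := n) (chart_mem_atlas (Fin n → ℂ) x) (mem_chart_source _ x) 0
  simp only [curvForm, metricMatrix, Pi.add_apply, ddbar, Pi.zero_def, this, add_zero]

/-- The normalized potential is unique. -/
theorem IsNormalizedPotential.unique [CompactSpace X] [ConnectedSpace X] [MeasurableSpace X]
    {h : HermitianMetric (n := n) L} {k : ℕ} {σ : OneParamSubgroup n L} {φ ψ ψ' : X → ℝ}
    (hψ : IsNormalizedPotential h k σ φ ψ) (hψ' : IsNormalizedPotential h k σ φ ψ')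
    (hN : (numSections n L k : ℝ) / (k : ℝ) ^ n ≠ 0) : ψ = ψ' := by
  obtain ⟨a, ha⟩ := eq_add_const_of_ddbar_eq hψ.1 hψ'.1
    (add_left_cancel (hψ.2.1.symm.trans hψ'.2.1))
  have h1 := hψ.2.2
  simp only [ha, Real.exp_add] at h1
  rw [integral_mul_const, hψ'.2.2] at h1
  -- Two potentials differ by a constant a, and the equal normalizations force e^a = 1 because the
  -- common integral is nonzero.
  have h2 : Real.exp a = 1 := mul_left_cancel₀ hN (h1.trans (mul_one _).symm)
  have h3 : a = 0 := (Real.exp_eq_one_iff a).1 h2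
  funext x
  rw [ha x, h3, add_zero]

end Uniqueness

/-! ### The Bergman function and the normalized potential -/

section Bergman

open Filter Topology

variable {n : ℕ} {X : Type*} [TopologicalSpace X] [ChartedSpace (Fin n → ℂ) X]
  {L : X → Type*} [∀ x, AddCommGroup (L x)] [∀ x, Module ℂ (L x)] [∀ x, TopologicalSpace (L x)]
  [TopologicalSpace (TotalSpace ℂ L)] [FiberBundle ℂ L] [VectorBundle ℂ ℂ L]
  [IsManifold 𝓘(ℂ, Fin n → ℂ) ω X] [ContMDiffVectorBundle ω ℂ L 𝓘(ℂ, Fin n → ℂ)]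

/-- If the bundle has no base points, a spanning family has no common zeros. -/
lemma sum_re_pairing_pos (h : HermitianMetric (n := n) L) (k : ℕ) (φ : X → ℝ) {ι : Type*}
    [Fintype ι] {s : ι → holSections n L k} (hs : Submodule.span ℂ (Set.range s) = ⊤) {x : X}
    (hx : ∃ t : holSections n L k, t.1 x ≠ 0) : 0 < ∑ α, (pairing h k φ (s α) (s α) x).re := by
  obtain ⟨α, hα⟩ : ∃ α, (s α).1 x ≠ 0 := by
    by_contra! hcon
    obtain ⟨t, ht⟩ := hx
    -- Sections vanishing at x form a subspace, the kernel of evaluation. If it contained the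
    -- spanning family it would contain every section.
    have hle : Submodule.span ℂ (Set.range s) ≤
        LinearMap.ker ((LinearMap.proj x : (∀ x, ⨂[ℂ]^k (L x)) →ₗ[ℂ] _).comp
          (holSections n L k).subtype) := by
      rw [Submodule.span_le]
      rintro _ ⟨α, rfl⟩
      exact hcon α
    rw [hs] at hle
    exact ht (hle Submodule.mem_top)
  exact Finset.sum_pos' (fun α _ => re_pairing_self_nonneg h k φ (s α) x)
    ⟨α, Finset.mem_univ α, re_pairing_self_pos h k φ hα⟩

variable [CompactSpace X] [T2Space X] [MeasurableSpace X] [BorelSpace X]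

lemma isSmooth_sum_re_pairing (h : HermitianMetric (n := n) L) (k : ℕ) {φ : X → ℝ}
    (hφ : IsSmooth (n := n) φ) {ι : Type*} [Fintype ι] (s : ι → holSections n L k) :
    IsSmooth (n := n) fun x => ∑ α, (pairing h k φ (s α) (s α) x).re :=
  fun x => ContMDiffAt.sum fun α _ => isSmooth_re_pairing_self h k hφ (s α) x

lemma isSmooth_bergman (h : HermitianMetric (n := n) L) (k : ℕ) {φ : X → ℝ}
    (hφ : IsSmooth (n := n) φ) : IsSmooth (n := n) (bergman h k φ) :=
  isSmooth_sum_re_pairing h k hφ _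

lemma IsSmooth.log {f : X → ℝ} (hf : IsSmooth (n := n) f) (h0 : ∀ x, f x ≠ 0) :
    IsSmooth (n := n) fun x => Real.log (f x) :=
  fun x => smoothAt_comp (V := ℝ) (Real.contDiffAt_log.2 (h0 x)) (hf x)

lemma numSections_pos [Nonempty X] {k : ℕ} [Module.Finite ℂ (holSections n L k)]
    (hbpf : ∀ x : X, ∃ s : holSections n L k, s.1 x ≠ 0) : 0 < numSections n L k := by
  obtain ⟨x⟩ := ‹Nonempty X›
  obtain ⟨s, hs⟩ := hbpf x
  have : Nontrivial (holSections n L k) := ⟨s, 0, fun h => hs (by rw [h]; rfl)⟩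
  exact Module.finrank_pos

variable (h : HermitianMetric (n := n) L) {k : ℕ} [Module.Finite ℂ (holSections n L k)]
  {φ : X → ℝ}

lemma bergman_pos (hφ : IsKahlerPotential h φ)
    (hbpf : ∀ x : X, ∃ s : holSections n L k, s.1 x ≠ 0) (x : X) : 0 < bergman h k φ x :=
  sum_re_pairing_pos h k φ (isOrthonormalBasis_orthonormalBasis h hφ).2.2 (hbpf x)

/-- Each of the N_k terms integrates to the squared norm of a unit vector. -/
lemma integral_bergman (hφ : IsKahlerPotential h φ) :
    ∫ x, bergman h k φ x ∂volumeMeasure h φ = numSections n L k := by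
  simp only [bergman]
  rw [integral_finsetSum _ fun α _ => integrable_volumeMeasure (E := ℝ) h hφ.1
    (f := fun x => (pairing h k φ (orthonormalBasis (Hilb h k φ) α)
      (orthonormalBasis (Hilb h k φ) α) x).re)
    (Complex.continuous_re.comp (continuous_pairing h k hφ.1.continuous _ _))]
  have hs := (isOrthonormalBasis_orthonormalBasis (k := k) h hφ).1
  simp [← re_Hilb h k hφ.1, hs]

/-- `log ρ_k(φ) = k FS_k(Hilb_k(φ)) + log N_k - k φ`. -/
lemma log_bergman [Nonempty X] (hk : 1 ≤ k) (hφ : IsKahlerPotential h φ)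
    (hbpf : ∀ x : X, ∃ s : holSections n L k, s.1 x ≠ 0) (x : X) :
    Real.log (bergman h k φ x) = k * FS h k (Hilb h k φ) x + Real.log (numSections n L k) +
      (-(k : ℝ)) * φ x := by
  have hk0 : (k : ℝ) ≠ 0 := by positivity
  have hN : (0 : ℝ) < numSections n L k := Nat.cast_pos.2 (numSections_pos (n := n) hbpf)
  have hS := sum_re_pairing_pos h k 0 (isOrthonormalBasis_orthonormalBasis h hφ).2.2 (hbpf x)
  have e : bergman h k φ x = Real.exp (-(k * φ x)) * ∑ α, (pairing h k 0
      (orthonormalBasis (Hilb h k φ) α) (orthonormalBasis (Hilb h k φ) α) x).re := by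
    rw [bergman, Finset.mul_sum]
    refine Finset.sum_congr rfl fun α _ => ?_
    rw [pairing_eq_exp_mul, Complex.re_ofReal_mul]
  rw [e, Real.log_mul (Real.exp_pos _).ne' hS.ne', Real.log_exp, FS,
    Real.log_mul (by positivity) hS.ne', one_div (numSections n L k : ℝ), Real.log_inv]
  field_simp
  ring

lemma isSmooth_FS [Nonempty X] (hφ : IsKahlerPotential h φ)
    (hbpf : ∀ x : X, ∃ s : holSections n L k, s.1 x ≠ 0) :
    IsSmooth (n := n) (FS h k (Hilb h k φ)) := by
  have hN : (0 : ℝ) < numSections n L k := Nat.cast_pos.2 (numSections_pos (n := n) hbpf)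
  have h1 : IsSmooth (n := n) fun x => (1 / (numSections n L k : ℝ)) * ∑ α, (pairing h k 0
      (orthonormalBasis (Hilb h k φ) α) (orthonormalBasis (Hilb h k φ) α) x).re :=
    contMDiff_const.mul (isSmooth_sum_re_pairing h k contMDiff_const _)
  refine contMDiff_const.mul (IsSmooth.log h1 fun x => ?_)
  have := sum_re_pairing_pos h k 0 (isOrthonormalBasis_orthonormalBasis h hφ).2.2 (hbpf x)
  positivity

/-- For a balanced metric, `log (ρ_k / k^n)` is the normalized potential. -/
theorem isNormalizedPotential_log_bergman [Nonempty X] {σ : OneParamSubgroup n L} (hk : 1 ≤ k)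
    (hbpf : ∀ x : X, ∃ s : holSections n L k, s.1 x ≠ 0) (hbal : IsBalanced h k σ φ) :
    IsNormalizedPotential h k σ φ
      fun x => Real.log (bergman h k φ x) + -Real.log ((k : ℝ) ^ n) := by
  have hφ := hbal.1
  have hpos := bergman_pos h hφ hbpf
  have hk0 : (0 : ℝ) < (k : ℝ) ^ n := by positivity
  have hF := isSmooth_FS h hφ hbpf
  have hF' : IsSmooth (n := n) fun x => (k : ℝ) * FS h k (Hilb h k φ) x := contMDiff_const.mul hF
  have hφ' : IsSmooth (n := n) fun x => (-(k : ℝ)) * φ x := contMDiff_const.mul hφ.1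
  have hc : ∀ a : ℝ, IsSmooth (n := n) fun _ : X => a := fun a => contMDiff_const
  have hF1 : IsSmooth (n := n) fun x =>
    (k : ℝ) * FS h k (Hilb h k φ) x + Real.log (numSections n L k) := hF'.add (hc _)
  have hF2 : IsSmooth (n := n) fun x =>
    (k : ℝ) * FS h k (Hilb h k φ) x + Real.log (numSections n L k) + (-(k : ℝ)) * φ x := hF1.add hφ'
  refine ⟨((isSmooth_bergman h k hφ.1).log fun x => (hpos x).ne').add contMDiff_const, ?_, ?_⟩
  · simp only [log_bergman h hk hφ hbpf]
    -- The additive constants disappear under ∂∂̄, and k ∂∂̄(FS - φ) is the difference of the two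
    -- curvature forms, which the balanced condition identifies.
    rw [ddbar_add hF2 (hc _), ddbar_add hF1 hφ',
      ddbar_add hF' (hc _), ddbar_const, ddbar_const, ddbar_const_mul hF, ddbar_const_mul hφ.1,
      ← hbal.2, curvForm_eq h φ, curvForm_eq h (FS h k (Hilb h k φ))]
    simp only [smul_add, add_zero, Complex.ofReal_natCast, Complex.ofReal_neg, neg_smul]
    abel
  · simp only [Real.exp_add, Real.exp_log (hpos _), Real.exp_neg, Real.exp_log hk0]
    rw [integral_mul_const, integral_bergman h hφ, div_eq_mul_inv]

/-- The Bergman function of a balanced metric is `k^n e^ψ`. -/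
theorem bergman_eq_of_isBalanced [ConnectedSpace X] {σ : OneParamSubgroup n L} (hk : 1 ≤ k)
    (hbpf : ∀ x : X, ∃ s : holSections n L k, s.1 x ≠ 0) (hbal : IsBalanced h k σ φ) (x : X) :
    bergman h k φ x = (k : ℝ) ^ n * Real.exp (psi h k σ φ x) := by
  have hN : (0 : ℝ) < numSections n L k := Nat.cast_pos.2 (numSections_pos (n := n) hbpf)
  have hk0 : (0 : ℝ) < (k : ℝ) ^ n := by positivity
  have h1 := isNormalizedPotential_log_bergman h hk hbpf hbal
  -- The function `psi` is an arbitrary choice, so it is meaningful only once a solution is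
  -- exhibited; log(ρ / k^n) is that solution.
  have h2 : IsNormalizedPotential h k σ φ (psi h k σ φ) := Classical.epsilon_spec ⟨_, h1⟩
  rw [h2.unique h1 (by positivity), Real.exp_add, Real.exp_log (bergman_pos h hbal.1 hbpf x),
    Real.exp_neg, Real.exp_log hk0]
  field_simp

end Bergman

/-! ### The first variation of `log det ∘ Hilb_k` -/

section FirstVariation

open Filter Topology

variable {n : ℕ} {X : Type*} [TopologicalSpace X] [ChartedSpace (Fin n → ℂ) X]
  {L : X → Type*} [∀ x, AddCommGroup (L x)] [∀ x, Module ℂ (L x)] [∀ x, TopologicalSpace (L x)]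
  [TopologicalSpace (TotalSpace ℂ L)] [FiberBundle ℂ L] [VectorBundle ℂ ℂ L]
  [IsManifold 𝓘(ℂ, Fin n → ℂ) ω X] [ContMDiffVectorBundle ω ℂ L 𝓘(ℂ, Fin n → ℂ)]
  [CompactSpace X] [T2Space X] [MeasurableSpace X] [BorelSpace X]

/-- Differentiation under the integral sign for smooth families on a compact manifold. -/
lemma hasDerivAt_integral_mul (μ : Measure X) [IsFiniteMeasure μ] {a : X → ℂ} (ha : Continuous a)
    {G : ℝ → X → ℝ} (hG : JointSmooth (n := n) G) (t : ℝ) :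
    HasDerivAt (fun r => ∫ x, a x * (G r x : ℂ) ∂μ) (∫ x, a x * (tderiv G t x : ℂ) ∂μ) t := by
  have hc' : Continuous fun p : ℝ × X => a p.2 * (tderiv G p.1 p.2 : ℂ) :=
    (ha.comp continuous_snd).mul (Complex.continuous_ofReal.comp hG.tderiv.continuous)
  have hc : Continuous fun p : ℝ × X => a p.2 * (G p.1 p.2 : ℂ) :=
    (ha.comp continuous_snd).mul (Complex.continuous_ofReal.comp hG.continuous)
  -- The parameter derivative is jointly continuous, so its bound on the compact set [t - 1, t + 1]
  -- × X serves as a constant dominating function.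
  obtain ⟨C, hC⟩ := ((isCompact_Icc (a := t - 1) (b := t + 1)).prod
    (isCompact_univ (X := X))).exists_bound_of_continuousOn hc'.continuousOn
  have hs : ∀ {F : ℝ × X → ℂ}, Continuous F → ∀ r, AEStronglyMeasurable (fun x => F (r, x)) μ :=
    fun hF r => (hF.comp (Continuous.prodMk_right r)).aestronglyMeasurable
  refine (hasDerivAt_integral_of_dominated_loc_of_deriv_le (bound := fun _ => C)
    (F := fun r x => a x * (G r x : ℂ)) (F' := fun r x => a x * (tderiv G r x : ℂ))
    (s := Set.Icc (t - 1) (t + 1)) (Icc_mem_nhds (by linarith) (by linarith))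
    (Eventually.of_forall fun r => hs hc r) ?_ (hs hc' t) ?_ (integrable_const C) ?_).2
  · exact (hc.comp (Continuous.prodMk_right t)).integrable_of_hasCompactSupport
      (HasCompactSupport.of_compactSpace _)
  · exact Eventually.of_forall fun x r hr => hC (r, x) ⟨hr, Set.mem_univ x⟩
  · exact Eventually.of_forall fun x r _ => (hG.hasDerivAt r x).ofReal_comp.const_mul (a x)

/-- Nonnegativity of the ratio suffices to undo the truncation in `ENNReal.ofReal`; Γ itself need
not be a Kähler potential. -/
lemma integral_volumeMeasure_eq (h : HermitianMetric (n := n) L) {φ Γ : X → ℝ}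
    (hφ : IsKahlerPotential h φ) (hΓ : IsSmooth (n := n) Γ) (hr : ∀ x, 0 ≤ volRatio h φ Γ x)
    {E : Type*} [NormedAddCommGroup E] [NormedSpace ℝ E] (f : X → E) :
    ∫ x, f x ∂volumeMeasure h Γ = ∫ x, volRatio h φ Γ x • f x ∂volumeMeasure h φ := by
  have hm : Measurable fun x => ENNReal.ofReal (volRatio h φ Γ x) :=
    ((jointSmooth_volRatio h hφ (IsSmooth.jointSmooth hΓ)).isSmooth
      0).continuous.measurable.ennreal_ofReal
  rw [volumeMeasure_eq_withDensity h hφ hΓ, integral_withDensity_eq_integral_toReal_smul hm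
    (Eventually.of_forall fun _ => ENNReal.ofReal_lt_top)]
  refine integral_congr_ae (Eventually.of_forall fun x => ?_)
  simp only
  rw [ENNReal.toReal_ofReal (hr x)]

/-- The ratio is 1 at the parameter t, and compactness makes positivity uniform nearby. This covers
families such as φ + t δφ, whose members are not assumed to be Kähler potentials for t ≠ 0. -/
lemma eventually_volRatio_pos (h : HermitianMetric (n := n) L) {φ : X → ℝ} {Γ : ℝ → X → ℝ}
    (hφ : IsKahlerPotential h φ) (hΓ : JointSmooth (n := n) Γ) {t : ℝ} (ht : Γ t = φ) :
    ∀ᶠ r in 𝓝 t, ∀ x, 0 < volRatio h φ (Γ r) x := by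
  have hc := (jointSmooth_volRatio h hφ hΓ).continuous
  have := isCompact_univ.eventually_forall_of_forall_eventually (x₀ := t) (K := Set.univ)
    (P := fun r x => 0 < volRatio h φ (Γ r) x) (fun x _ => by
      have h1 : 0 < volRatio h φ (Γ t) x := by rw [ht, volRatio_self h hφ]; exact one_pos
      exact (hc.tendsto (t, x)).eventually (lt_mem_nhds h1))
  simpa using this

variable (h : HermitianMetric (n := n) L) {k : ℕ}

/-- Against the fixed measure dμ_φ, the integrand varies only through e^{-kΓ} times the volume
ratio. The product rule gives -k times the variation from the first factor and minus its Laplacian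
from the second. -/
lemma hasDerivAt_Hilb {φ : X → ℝ} {Γ : ℝ → X → ℝ} (hφ : IsKahlerPotential h φ)
    (hΓ : JointSmooth (n := n) Γ) {t : ℝ} (ht : Γ t = φ) (s s' : holSections n L k) :
    HasDerivAt (fun r => Hilb h k (Γ r) s s')
      (∫ x, pairing h k φ s s' x * ((-(k * tderiv Γ t x + laplacian h φ (tderiv Γ t) x) : ℝ) : ℂ)
        ∂volumeMeasure h φ) t := by
  have := isFiniteMeasure_volumeMeasure h hφ.1
  set G : ℝ → X → ℝ := fun r x => Real.exp ((-(k : ℝ)) * Γ r x) * volRatio h φ (Γ r) x with hGdef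
  have hE : JointSmooth (n := n) fun r x => Real.exp ((-(k : ℝ)) * Γ r x) :=
    (hΓ.const_mul (-(k : ℝ))).exp
  have hV := jointSmooth_volRatio h hφ hΓ
  have hG : JointSmooth (n := n) G := hE.mul hV
  have h1 := hasDerivAt_integral_mul (volumeMeasure h φ)
    (continuous_pairing h k (φ := 0) continuous_const s s') hG t
  have h2 : ∀ x, tderiv G t x = Real.exp (-(k * φ x)) *
      -(k * tderiv Γ t x + laplacian h φ (tderiv Γ t) x) := by
    intro x
    have d1 := ((hΓ.hasDerivAt t x).const_mul (-(k : ℝ))).exp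
    have d2 := hV.hasDerivAt t x
    rw [tderiv_volRatio h hφ hΓ ht] at d2
    have := (d1.mul d2).deriv
    rw [tderiv]
    refine Eq.trans this ?_
    rw [ht, volRatio_self h hφ, neg_mul]
    ring
  refine (h1.congr_of_eventuallyEq ?_).congr_deriv ?_
  · filter_upwards [eventually_volRatio_pos h hφ hΓ ht] with r hr
    rw [Hilb, integral_volumeMeasure_eq h hφ (hΓ.isSmooth r) fun x => (hr x).le]
    refine integral_congr_ae (Eventually.of_forall fun x => ?_)
    simp only [hGdef]
    rw [pairing_eq_exp_mul, Complex.real_smul, neg_mul]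
    push_cast
    ring
  · refine integral_congr_ae (Eventually.of_forall fun x => ?_)
    simp only
    rw [h2, pairing_eq_exp_mul h k φ]
    push_cast
    ring

/-- The first variation of `log det ∘ Hilb_k`. -/
theorem hasDerivAt_logDet_Hilb
    (b : Module.Basis (Fin (numSections n L k)) ℂ (holSections n L k)) {φ : X → ℝ}
    {Γ : ℝ → X → ℝ} (hφ : IsKahlerPotential h φ) (hΓ : JointSmooth (n := n) Γ) {t : ℝ}
    (ht : Γ t = φ) :
    HasDerivAt (fun r => logDet b (Hilb h k (Γ r)))
      (-∫ x, bergman h k φ x * (k * tderiv Γ t x + laplacian h φ (tderiv Γ t) x)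
        ∂volumeMeasure h φ) t := by
  have : Module.Finite ℂ (holSections n L k) := Module.Finite.of_basis b
  obtain ⟨hs, hli, hspan⟩ := isOrthonormalBasis_orthonormalBasis (k := k) h hφ
  -- The derivative is computed in an orthonormal basis of Hilb_k(φ), where it is a trace; summing
  -- the integrands pointwise then produces the Bergman function.
  set s := Module.Basis.mk hli hspan.ge with hsdef
  have hsα : ∀ α, s α = orthonormalBasis (Hilb h k φ) α := fun α => Module.Basis.mk_apply hli _ α
  have hd := hasDerivAt_log_det (H := fun r => Hilb h k (Γ r)) (t := t)
    (fun r => isHermitianForm_Hilb h k (hΓ.isSmooth r)) b s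
    (fun α β => by rw [ht, hsα, hsα]; exact hs α β)
    (fun α β => hasDerivAt_Hilb h hφ hΓ ht (s α) (s β))
  refine hd.congr_deriv ?_
  have hcl := continuous_laplacian_of_isSmooth h hφ (hΓ.tderiv.isSmooth t)
  have hcd := (hΓ.tderiv.isSmooth t).continuous
  have hcw : Continuous fun x => -(k * tderiv Γ t x + laplacian h φ (tderiv Γ t) x) :=
    ((continuous_const.mul hcd).add hcl).neg
  have hcp : ∀ α, Continuous (pairing h k φ (s α) (s α)) := fun α =>
    continuous_pairing h k hφ.1.continuous _ _
  have e : ∀ α, (∫ x, pairing h k φ (s α) (s α) x *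
      ((-(k * tderiv Γ t x + laplacian h φ (tderiv Γ t) x) : ℝ) : ℂ) ∂volumeMeasure h φ).re =
      ∫ x, (pairing h k φ (s α) (s α) x).re *
        -(k * tderiv Γ t x + laplacian h φ (tderiv Γ t) x) ∂volumeMeasure h φ := by
    intro α
    have := Complex.reCLM.integral_comp_comm (integrable_volumeMeasure h hφ.1
      ((hcp α).fun_mul (Complex.continuous_ofReal.comp hcw)))
    refine this.symm.trans ?_
    simp
  simp only [e]
  rw [← integral_finsetSum _ fun α _ => integrable_volumeMeasure (E := ℝ) h hφ.1
    (f := fun x => (pairing h k φ (s α) (s α) x).re *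
        -(k * tderiv Γ t x + laplacian h φ (tderiv Γ t) x))
    ((Complex.continuous_re.comp (hcp α)).mul hcw), ← integral_neg]
  refine integral_congr_ae (Eventually.of_forall fun x => ?_)
  simp only [hsα]
  rw [← Finset.sum_mul, bergman, mul_neg]

/-- Symmetry of the Laplacian moves it from e^ψ to u. The smooth function ρ stands in for k^n e^ψ,
so regularity of `psi` is never needed separately. -/
lemma deltaI_eq (σ : OneParamSubgroup n L) {φ u : X → ℝ} (hφ : IsKahlerPotential h φ)
    (hu : IsSmooth (n := n) u) (hk : 1 ≤ k) {ρ : X → ℝ} (hρ : IsSmooth (n := n) ρ)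
    (he : ∀ x, ρ x = (k : ℝ) ^ n * Real.exp (psi h k σ φ x)) :
    deltaI h k σ φ u = ∫ x, ρ x * (k * u x + laplacian h φ u x) ∂volumeMeasure h φ := by
  have hk0 : (k : ℝ) ≠ 0 := by positivity
  have hexp : ∀ x, Real.exp (psi h k σ φ x) = ((k : ℝ) ^ n)⁻¹ * ρ x := fun x => by
    rw [he x]; field_simp
  have hlap : ∀ x, laplacian h φ (fun y => Real.exp (psi h k σ φ y)) x =
      ((k : ℝ) ^ n)⁻¹ * laplacian h φ ρ x := fun x => by
    simp only [hexp]
    exact laplacian_const_mul h φ hρ _ x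
  have c1 := continuous_laplacian_of_isSmooth h hφ hu
  have c2 := continuous_laplacian_of_isSmooth h hφ hρ
  have c3 := hu.continuous
  have c4 := hρ.continuous
  have hint : ∀ {f : X → ℝ}, Continuous f → Integrable f (volumeMeasure h φ) :=
    fun hf => integrable_volumeMeasure h hφ.1 hf
  have e1 : deltaI h k σ φ u =
      ∫ x, (k * (u x * ρ x) + u x * laplacian h φ ρ x) ∂volumeMeasure h φ := by
    refine integral_congr_ae (Eventually.of_forall fun x => ?_)
    simp only
    rw [hlap, hexp]
    field_simp
  have e2 : ∫ x, ρ x * (k * u x + laplacian h φ u x) ∂volumeMeasure h φ =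
      ∫ x, (k * (u x * ρ x) + ρ x * laplacian h φ u x) ∂volumeMeasure h φ := by
    refine integral_congr_ae (Eventually.of_forall fun x => ?_)
    simp only
    ring
  rw [e1, e2, integral_add (hint (continuous_const.fun_mul (c3.fun_mul c4))) (hint (c3.fun_mul c2)),
    integral_add (hint (continuous_const.fun_mul (c3.fun_mul c4))) (hint (c4.fun_mul c1)),
    integral_mul_laplacian h hφ hu hρ]

/-- The first variation of `log det ∘ Hilb_k` at a balanced metric is `-δI`. -/
theorem hasDerivAt_logDet_Hilb_of_isBalanced [ConnectedSpace X] {σ : OneParamSubgroup n L}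
    (hk : 1 ≤ k) (hbpf : ∀ x : X, ∃ s : holSections n L k, s.1 x ≠ 0)
    (b : Module.Basis (Fin (numSections n L k)) ℂ (holSections n L k)) {φ : X → ℝ}
    (hbal : IsBalanced h k σ φ) {Γ : ℝ → X → ℝ} (hΓ : JointSmooth (n := n) Γ) {t : ℝ}
    (ht : Γ t = φ) :
    HasDerivAt (fun r => logDet b (Hilb h k (Γ r))) (-deltaI h k σ φ (tderiv Γ t)) t := by
  have : Module.Finite ℂ (holSections n L k) := Module.Finite.of_basis b
  rw [deltaI_eq h σ hbal.1 (hΓ.tderiv.isSmooth t) hk (isSmooth_bergman h k hbal.1.1)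
    (bergman_eq_of_isBalanced h hk hbpf hbal)]
  exact hasDerivAt_logDet_Hilb h b hbal.1 hΓ ht

end FirstVariation

/-! ### Pull-back of the curvature form by an automorphism -/

section Automorphisms

open Filter Topology

variable {n : ℕ} {X : Type*} [TopologicalSpace X] [ChartedSpace (Fin n → ℂ) X]
  [IsManifold 𝓘(ℂ, Fin n → ℂ) ω X]

lemma mfderiv_eq_fderiv {f : X → X}
    {x : X} (hf : ContMDiffAt 𝓘(ℂ, Fin n → ℂ) 𝓘(ℂ, Fin n → ℂ) ω f x) :
    mfderiv 𝓘(ℂ, Fin n → ℂ) 𝓘(ℂ, Fin n → ℂ) f x =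
      fderiv ℂ (fun z => chartAt (Fin n → ℂ) (f x) (f ((chartAt (Fin n → ℂ) x).symm z)))
        (chartAt (Fin n → ℂ) x x) := by
  have h1 : MDifferentiableAt 𝓘(ℂ, Fin n → ℂ) 𝓘(ℂ, Fin n → ℂ) f x :=
    hf.mdifferentiableAt (by simp)
  refine h1.mfderiv.trans ?_
  rw [ModelWithCorners.range_eq_univ]
  exact congrFun (fderivWithin_univ (𝕜 := ℂ) (E := Fin n → ℂ) (F := Fin n → ℂ)
    (f := fun z => chartAt (Fin n → ℂ) (f x) (f ((chartAt (Fin n → ℂ) x).symm z)))) _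

/-- Pull-back of `√-1 ∂∂̄ u` by a holomorphic map. -/
lemma pullback_apply {f : X → X} {α : Form11 n X} {x : X}
    (hf : ContMDiffAt 𝓘(ℂ, Fin n → ℂ) 𝓘(ℂ, Fin n → ℂ) ω f x) {u : X → ℝ}
    (hu : SmoothAt (n := n) u (f x))
    (hα : α (f x) = complexHess (chartAt (Fin n → ℂ) (f x)) u (f x)) :
    pullback f α x = complexHess (chartAt (Fin n → ℂ) x) (fun y => u (f y)) x := by
  ext i j
  rw [complexHess_comp (chart_mem_atlas _ x) (chart_mem_atlas _ (f x)) (mem_chart_source _ x)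
    (mem_chart_source _ (f x)) hf hu, ← hα, pullback, Matrix.of_apply, mfderiv_eq_fderiv hf]
  rfl

lemma pullback_smul (f : X → X) (a : ℂ) (α : Form11 n X) :
    pullback f (a • α) = a • pullback f α := by
  funext x
  ext i j
  simp only [pullback, Matrix.of_apply, Pi.smul_apply, Matrix.smul_apply, hermForm, smul_eq_mul,
    Finset.mul_sum, mul_assoc]

lemma JointSmooth.comp_holomorphic {u : ℝ → X → ℝ} (hu : JointSmooth (n := n) u) {f : X → X}
    (hf : ContMDiff 𝓘(ℂ, Fin n → ℂ) 𝓘(ℂ, Fin n → ℂ) ω f) :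
    JointSmooth (n := n) fun t x => u t (f x) := by
  rw [jointSmooth_iff]
  intro t x
  set c := chartAt (Fin n → ℂ) x
  set c' := chartAt (Fin n → ℂ) (f x)
  have hc : c ∈ atlas (Fin n → ℂ) X := chart_mem_atlas _ x
  have hc' : c' ∈ atlas (Fin n → ℂ) X := chart_mem_atlas _ (f x)
  have hx : x ∈ c.source := mem_chart_source _ x
  have hfx : f x ∈ c'.source := mem_chart_source _ (f x)
  have hT : ContDiffAt ℝ ∞ (fun z => c' (f (c.symm z))) (c x) :=
    ((contDiffAt_chart_comp hc hc' hx hfx (hf x)).of_le le_top).restrict_scalars ℝ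
  have h1 : ContDiffAt ℝ ∞ (fun p : ℝ × (Fin n → ℂ) => (p.1, c' (f (c.symm p.2)))) (t, c x) :=
    contDiffAt_fst.prodMk (ContDiffAt.comp (t, c x) (f := Prod.snd) hT contDiffAt_snd)
  have h2 : ContDiffAt ℝ ∞ (fun p : ℝ × (Fin n → ℂ) => u p.1 (c'.symm (c' (f (c.symm p.2)))))
      (t, c x) := by
    refine ContDiffAt.comp (t, c x) (g := fun p : ℝ × (Fin n → ℂ) => u p.1 (c'.symm p.2)) ?_ h1
    simp only [c.left_inv hx]
    exact (jointSmoothAt_iff hc' hfx).1 (hu (t, f x))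
  refine h2.congr_of_eventuallyEq ?_
  have hcont : ContinuousAt (fun p : ℝ × (Fin n → ℂ) => f (c.symm p.2)) (t, c x) := by
    have h3 := (c.symm.continuousAt (c.map_source hx))
    have h4 : ContinuousAt (fun p : ℝ × (Fin n → ℂ) => c.symm p.2) (t, c x) :=
      ContinuousAt.comp (g := c.symm) (f := Prod.snd) h3 continuousAt_snd
    exact ContinuousAt.comp (g := f) (hf.continuous.continuousAt) h4
  have hmem : c'.source ∈ 𝓝 (f (c.symm (c x))) := by
    rw [c.left_inv hx]; exact c'.open_source.mem_nhds hfx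
  filter_upwards [hcont.preimage_mem_nhds hmem] with p hp
  rw [c'.left_inv hp]

variable {L : X → Type*} [∀ x, AddCommGroup (L x)] [∀ x, Module ℂ (L x)]
  [∀ x, TopologicalSpace (L x)]
  [TopologicalSpace (TotalSpace ℂ L)] [FiberBundle ℂ L] [VectorBundle ℂ ℂ L]
  [ContMDiffVectorBundle ω ℂ L 𝓘(ℂ, Fin n → ℂ)]

variable {F : TotalSpace ℂ L → TotalSpace ℂ L}
  {f : X → X} {l : ∀ x, L x →ₗ[ℂ] L (f x)}

/-- The base map is the bundle map preceded by the zero section and followed by the projection. -/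
lemma contMDiff_base
    (hF : ContMDiff (𝓘(ℂ, Fin n → ℂ).prod 𝓘(ℂ, ℂ)) (𝓘(ℂ, Fin n → ℂ).prod 𝓘(ℂ, ℂ)) ω F)
    (hfl : ∀ x (v : L x), F ⟨x, v⟩ = ⟨f x, l x v⟩) :
    ContMDiff 𝓘(ℂ, Fin n → ℂ) 𝓘(ℂ, Fin n → ℂ) ω f := by
  have h1 : ContMDiff 𝓘(ℂ, Fin n → ℂ) 𝓘(ℂ, Fin n → ℂ) ω
      fun x => (F (zeroSection ℂ L x)).proj :=
    (contMDiff_proj L).comp (hF.comp (contMDiff_zeroSection ℂ L))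
  have h2 : (fun x => (F (zeroSection ℂ L x)).proj) = f := by
    funext x
    rw [zeroSection, hfl]
  rwa [h2] at h1

/-- The matrix coefficient of a bundle map in the local frames around `x` and `f x`. -/
lemma contMDiffAt_coeff
    (hF : ContMDiff (𝓘(ℂ, Fin n → ℂ).prod 𝓘(ℂ, ℂ)) (𝓘(ℂ, Fin n → ℂ).prod 𝓘(ℂ, ℂ)) ω F)
    (hfl : ∀ x (v : L x), F ⟨x, v⟩ = ⟨f x, l x v⟩) (x : X) :
    ContMDiffAt 𝓘(ℂ, Fin n → ℂ) 𝓘(ℂ, ℂ) ω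
      (fun y => (trivializationAt ℂ L (f x)).linearMapAt ℂ (f y) (l y (frame L x y))) x := by
  have hx := mem_baseSet_self (L := L) x
  have hs : ContMDiffAt 𝓘(ℂ, Fin n → ℂ) (𝓘(ℂ, Fin n → ℂ).prod 𝓘(ℂ, ℂ)) ω
      (fun y => (⟨y, frame L x y⟩ : TotalSpace ℂ L)) x := by
    refine (contMDiffAt_section x).2 ?_
    refine (contMDiffAt_const (c := (1 : ℂ))).congr_of_eventuallyEq ?_
    filter_upwards [(trivializationAt ℂ L x).open_baseSet.mem_nhds hx] with y hy
    have := linearMapAt_frame (L := L) hy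
    rwa [(trivializationAt ℂ L x).coe_linearMapAt_of_mem (R := ℂ) hy] at this
  have hg : ContMDiffAt 𝓘(ℂ, Fin n → ℂ) (𝓘(ℂ, Fin n → ℂ).prod 𝓘(ℂ, ℂ)) ω
      (fun y => F ⟨y, frame L x y⟩) x := ContMDiffAt.comp x (hF _) hs
  have h2 := ((contMDiffAt_totalSpace (F := ℂ) (E := L)).1 hg).2
  have hfc := (contMDiff_base hF hfl).continuous
  refine h2.congr_of_eventuallyEq ?_
  filter_upwards [hfc.continuousAt.preimage_mem_nhds
    ((trivializationAt ℂ L (f x)).open_baseSet.mem_nhds (mem_baseSet_self (L := L) (f x)))]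
    with y hy
  rw [(trivializationAt ℂ L (f x)).coe_linearMapAt_of_mem (R := ℂ) hy]
  simp only [hfl]

/-- The function `log (F^* h / h)` for a bundle map `F`. -/
def logRatio (h : HermitianMetric (n := n) L) (l : ∀ x, L x →ₗ[ℂ] L (f x)) (x : X) : ℝ :=
  Real.log (h.normSq (f x) (l x (frame L x x)) / h.weight x x)

/-- In fixed frames around x and f(x), the transition function between the frames around y and x
enters numerator and denominator equally and cancels. What remains is smooth in y, with a
holomorphic coefficient inside the first logarithm. -/
lemma logRatio_eq (h : HermitianMetric (n := n) L) {x y : X}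
    (hinj : Function.Injective (l y)) (hy : y ∈ (trivializationAt ℂ L x).baseSet)
    (hfy : f y ∈ (trivializationAt ℂ L (f x)).baseSet) :
    logRatio h l y = Real.log
        (‖(trivializationAt ℂ L (f x)).linearMapAt ℂ (f y) (l y (frame L x y))‖ ^ 2) +
      Real.log (h.weight (f x) (f y)) - Real.log (h.weight x y) := by
  set a := (trivializationAt ℂ L (f x)).linearMapAt ℂ (f y) (l y (frame L x y)) with ha
  have h1 : l y (frame L x y) = a • frame L (f x) (f y) := eq_smul_frame hfy _
  have ha0 : a ≠ 0 := by
    intro h0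
    rw [h0, zero_smul] at h1
    exact frame_ne_zero hy (hinj (h1.trans (map_zero _).symm))
  have h2 : frame L y y = transition L x y y • frame L x y :=
    frame_eq_transition_smul hy (mem_baseSet_self y)
  have ht : transition L x y y ≠ 0 := transition_ne_zero hy (mem_baseSet_self y)
  have hw := h.weight_pos hy
  have hw' := h.weight_pos hfy
  have h3 : h.normSq (f y) (frame L (f x) (f y)) = h.weight (f x) (f y) := rfl
  have h4 : h.normSq (f y) (l y (frame L y y)) / h.weight y y =
      ‖a‖ ^ 2 * h.weight (f x) (f y) / h.weight x y := by
    rw [h2, map_smul, h1, h.normSq_smul, h.normSq_smul, h3, h.weight_eq hy (mem_baseSet_self y)]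
    have : ‖transition L x y y‖ ≠ 0 := by simpa using ht
    field_simp
  have hna : ‖a‖ ^ 2 ≠ 0 := by simpa using ha0
  rw [logRatio, h4, Real.log_div (mul_ne_zero hna hw'.ne') hw.ne', Real.log_mul hna hw'.ne']

lemma coeff_ne_zero {x y : X}
    (hinj : Function.Injective (l y)) (hy : y ∈ (trivializationAt ℂ L x).baseSet)
    (hfy : f y ∈ (trivializationAt ℂ L (f x)).baseSet) :
    (trivializationAt ℂ L (f x)).linearMapAt ℂ (f y) (l y (frame L x y)) ≠ 0 := by
  intro h0
  have h1 := eq_smul_frame hfy (l y (frame L x y))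
  rw [h0, zero_smul] at h1
  exact frame_ne_zero hy (hinj (h1.trans (map_zero _).symm))

lemma IsSmooth.comp_holomorphic {u : X → ℝ} (hu : IsSmooth (n := n) u)
    (hf : ContMDiff 𝓘(ℂ, Fin n → ℂ) 𝓘(ℂ, Fin n → ℂ) ω f) :
    IsSmooth (n := n) fun x => u (f x) :=
  ((IsSmooth.jointSmooth hu).comp_holomorphic hf).isSmooth 0

lemma smoothAt_comp_holomorphic {u : X → ℝ} {x : X} (hu : SmoothAt (n := n) u (f x))
    (hf : ContMDiffAt 𝓘(ℂ, Fin n → ℂ) 𝓘(ℂ, Fin n → ℂ) ω f x) :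
    SmoothAt (n := n) (fun y => u (f y)) x := by
  have := isManifold_real n X
  set c := chartAt (Fin n → ℂ) x
  set c' := chartAt (Fin n → ℂ) (f x)
  have hc : c ∈ atlas (Fin n → ℂ) X := chart_mem_atlas _ x
  have hc' : c' ∈ atlas (Fin n → ℂ) X := chart_mem_atlas _ (f x)
  have hx : x ∈ c.source := mem_chart_source _ x
  have hfx : f x ∈ c'.source := mem_chart_source _ (f x)
  have hT : ContMDiffAt 𝓘(ℝ, Fin n → ℂ) 𝓘(ℝ, Fin n → ℂ) ∞ (fun y => c' (f y)) x :=
    contMDiffAt_restrictScalars (ContMDiffAt.comp x (I' := 𝓘(ℂ, Fin n → ℂ)) (g := c')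
      (contMDiffAt_chart hc' hfx) hf)
  have h1 := smoothAt_comp (g := fun z => u (c'.symm z)) (f := fun y => c' (f y)) ((smoothAt_iff hc' hfx).1 hu) hT
  refine h1.congr_of_eventuallyEq ?_
  filter_upwards [hf.continuousAt.preimage_mem_nhds (c'.open_source.mem_nhds hfx)] with y hy
  rw [c'.left_inv hy]

lemma eventually_logRatio_eq (h : HermitianMetric (n := n) L) (hf : Continuous f) (hinj : ∀ x, Function.Injective (l x)) (x : X) :
    logRatio h l =ᶠ[𝓝 x] fun y => Real.log
        (‖(trivializationAt ℂ L (f x)).linearMapAt ℂ (f y) (l y (frame L x y))‖ ^ 2) +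
      Real.log (h.weight (f x) (f y)) - Real.log (h.weight x y) := by
  filter_upwards [hf.continuousAt.preimage_mem_nhds ((trivializationAt ℂ L
      (f x)).open_baseSet.mem_nhds (mem_baseSet_self (L := L) (f x))),
    (trivializationAt ℂ L x).open_baseSet.mem_nhds (mem_baseSet_self x)] with y hfy hy
  exact logRatio_eq h (hinj y) hy hfy

lemma isSmooth_logRatio
    (hF : ContMDiff (𝓘(ℂ, Fin n → ℂ).prod 𝓘(ℂ, ℂ)) (𝓘(ℂ, Fin n → ℂ).prod 𝓘(ℂ, ℂ)) ω F)
    (hfl : ∀ x (v : L x), F ⟨x, v⟩ = ⟨f x, l x v⟩) (hinj : ∀ x, Function.Injective (l x))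
    (h : HermitianMetric (n := n) L) :
    IsSmooth (n := n) (logRatio h l) := by
  intro x
  have hf := contMDiff_base hF hfl
  have hx := mem_baseSet_self (L := L) x
  have hfx := mem_baseSet_self (L := L) (f x)
  refine ContMDiffAt.congr_of_eventuallyEq ?_
    (eventually_logRatio_eq h hf.continuous hinj x)
  exact ((smoothAt_log_norm_sq (contMDiffAt_coeff hF hfl x) (coeff_ne_zero (hinj x) hx hfx)).add
    (smoothAt_comp_holomorphic (h.smoothAt_log_weight hfx) (hf x))).sub (h.smoothAt_log_weight hx)

/-- The pull-back of the curvature form by an automorphism of the pair. -/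
theorem pullback_curvForm
    (hF : ContMDiff (𝓘(ℂ, Fin n → ℂ).prod 𝓘(ℂ, ℂ)) (𝓘(ℂ, Fin n → ℂ).prod 𝓘(ℂ, ℂ)) ω F)
    (hfl : ∀ x (v : L x), F ⟨x, v⟩ = ⟨f x, l x v⟩) (hinj : ∀ x, Function.Injective (l x))
    (h : HermitianMetric (n := n) L)
    {φ : X → ℝ} (hφ : IsSmooth (n := n) φ) :
    pullback f (curvForm h φ) =
      curvForm h φ + ddbar (n := n) (fun x => φ (f x) + (-1) * φ x + (-1) * logRatio h l x) := by
  have hf := contMDiff_base hF hfl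
  have hR := isSmooth_logRatio hF hfl hinj h
  funext x
  have hx := mem_baseSet_self (L := L) x
  have hfx := mem_baseSet_self (L := L) (f x)
  set c := chartAt (Fin n → ℂ) x
  have hc : c ∈ atlas (Fin n → ℂ) X := chart_mem_atlas _ x
  have hxc : x ∈ c.source := mem_chart_source _ x
  set a : X → ℂ := fun y =>
    (trivializationAt ℂ L (f x)).linearMapAt ℂ (f y) (l y (frame L x y)) with ha
  have ha1 := contMDiffAt_coeff hF hfl x
  have ha0 : a x ≠ 0 := coeff_ne_zero (hinj x) hx hfx
  have hw : IsSmooth (n := n) fun x => φ (f x) + (-1) * φ x + (-1) * logRatio h l x :=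
    ((hφ.comp_holomorphic hf).add (contMDiff_const.mul hφ)).add (contMDiff_const.mul hR)
  have s1 := smoothAt_localPotential h (hφ x) hx
  have s2 := smoothAt_localPotential h (hφ (f x)) hfx
  have s3 := smoothAt_comp_holomorphic s2 (hf x)
  have s4 := smoothAt_log_norm_sq ha1 ha0
  rw [pullback_apply (α := curvForm h φ) (hf x) s2 (metricMatrix_eq h (chart_mem_atlas _ _) (mem_chart_source _ _)
    (hφ (f x)) hfx), Pi.add_apply, curvForm, metricMatrix_eq h hc hxc (hφ x) hx, ddbar,
    ← complexHess_add hc hxc s1 (hw x)]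
  -- The two local potentials differ by log |a|² for the nowhere zero holomorphic matrix coefficient
  -- a, so they have the same complex Hessian.
  have e : (fun y => localPotential h φ x y + (φ (f y) + (-1) * φ y + (-1) * logRatio h l y))
      =ᶠ[𝓝 x] fun y => localPotential h φ (f x) (f y) + (-1) * Real.log (‖a y‖ ^ 2) := by
    filter_upwards [eventually_logRatio_eq h hf.continuous hinj x] with y hy
    rw [hy, localPotential, localPotential]
    ring
  have s5 : SmoothAt (n := n) (fun y => localPotential h φ x y +
    (φ (f y) + (-1) * φ y + (-1) * logRatio h l y)) x := s1.add (hw x)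
  rw [complexHess_congr hc hxc s5 e,
    complexHess_add hc hxc s3 (s4.const_mul (-1)), complexHess_const_mul hc hxc s4,
    complexHess_log_norm_sq hc hxc ha1 ha0, smul_zero, add_zero]

/-- Automorphisms of the pair change the curvature form by `√-1 ∂∂̄` of a smooth function. -/
theorem exists_pullback_curvForm (h : HermitianMetric (n := n) L) (g : autGroup n L) :
    ContMDiff 𝓘(ℂ, Fin n → ℂ) 𝓘(ℂ, Fin n → ℂ) ω (baseMap g) ∧
    ∃ w : X → ℝ, IsSmooth (n := n) w ∧ ∀ φ : X → ℝ, IsSmooth (n := n) φ →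
      pullback (baseMap g) (curvForm h φ) =
        curvForm h φ + ddbar (n := n) (fun x => φ (baseMap g x) + (-1) * φ x + (-1) * w x) := by
  obtain ⟨⟨hF, f, l, hfl⟩, -⟩ := g.2
  have hb : baseMap g = f := by
    funext x
    rw [baseMap, hfl]
  -- An automorphism is injective on the total space, hence on every fibre; so its coefficient in
  -- local frames has no zeros.
  have hinj : ∀ x, Function.Injective (l x) := by
    intro x v v' hv
    have h1 : (g.1 : TotalSpace ℂ L → TotalSpace ℂ L) ⟨x, v⟩ = g.1 ⟨x, v'⟩ := by
      rw [hfl, hfl, hv]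
    have h2 := g.1.injective h1
    simpa using h2
  rw [hb]
  exact ⟨contMDiff_base hF hfl, logRatio h l, isSmooth_logRatio hF hfl hinj h,
    fun φ hφ => pullback_curvForm hF hfl hinj h hφ⟩

end Automorphisms

/-! ### The one-form `δI_k^σ` along paths -/

section Paths

open Filter Topology

variable {n : ℕ} {X : Type*} [TopologicalSpace X] [ChartedSpace (Fin n → ℂ) X]
  {L : X → Type*} [∀ x, AddCommGroup (L x)] [∀ x, Module ℂ (L x)] [∀ x, TopologicalSpace (L x)]
  [TopologicalSpace (TotalSpace ℂ L)] [FiberBundle ℂ L] [VectorBundle ℂ ℂ L]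
  [IsManifold 𝓘(ℂ, Fin n → ℂ) ω X] [ContMDiffVectorBundle ω ℂ L 𝓘(ℂ, Fin n → ℂ)]
  [CompactSpace X] [T2Space X] [MeasurableSpace X] [BorelSpace X]

lemma continuous_integral_of_continuous (μ : Measure X) [IsFiniteMeasure μ] {F : ℝ × X → ℝ}
    (hF : Continuous F) : Continuous fun s => ∫ x, F (s, x) ∂μ := by
  have := continuous_parametric_integral_of_continuous (μ := μ) (f := fun s x => F (s, x))
    hF isCompact_univ
  simpa only [Measure.restrict_univ] using this

/-- The normalized potential exists for every Kähler potential; it is explicit up to the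
normalizing constant. -/
theorem exists_exp_psi_eq [ConnectedSpace X] (h : HermitianMetric (n := n) L) {k : ℕ} (hk : 1 ≤ k)
    (hN : 0 < numSections n L k) (σ : OneParamSubgroup n L) :
    ∃ w : X → ℝ, IsSmooth (n := n) w ∧ ∀ φ : X → ℝ, IsKahlerPotential h φ → ∀ x,
      Real.exp (psi h k σ φ x) =
        ((numSections n L k : ℝ) / (k : ℝ) ^ n / ∫ y, Real.exp (k * (φ (baseMap (σ.toFun 1) y) +
          (-1) * φ y + (-1) * w y)) ∂volumeMeasure h φ) *
        Real.exp (k * (φ (baseMap (σ.toFun 1) x) + (-1) * φ x + (-1) * w x)) := by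
  obtain ⟨hf, w, hw, hpull⟩ := exists_pullback_curvForm h (σ.toFun 1)
  refine ⟨w, hw, fun φ hφ x => ?_⟩
  set f := baseMap (σ.toFun 1)
  set u : X → ℝ := fun x => φ (f x) + (-1) * φ x + (-1) * w x with hu_def
  have hu : IsSmooth (n := n) u :=
    ((hφ.1.comp_holomorphic hf).add (contMDiff_const.mul hφ.1)).add (contMDiff_const.mul hw)
  have hku : IsSmooth (n := n) fun x => (k : ℝ) * u x := contMDiff_const.mul hu
  have hN' : (0 : ℝ) < numSections n L k := Nat.cast_pos.2 hN
  have hk0 : (0 : ℝ) < (k : ℝ) ^ n := by positivity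
  have hJ : 0 < ∫ y, Real.exp (k * u y) ∂volumeMeasure h φ :=
    integral_pos_of_continuous h hφ (Real.continuous_exp.comp hku.continuous)
      (fun _ => (Real.exp_pos _).le) (x := x) (Real.exp_pos _).ne'
  -- The constant A rescales e^{ku} to total mass N_k / k^n, so ku + log A is the normalized
  -- potential.
  set A := (numSections n L k : ℝ) / (k : ℝ) ^ n / ∫ y, Real.exp (k * u y) ∂volumeMeasure h φ
    with hA
  have hApos : 0 < A := by positivity
  have h1 : IsNormalizedPotential h k σ φ fun x => k * u x + Real.log A := by
    refine ⟨hku.add contMDiff_const, ?_, ?_⟩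
    · rw [pullback_smul, hpull φ hφ.1, ddbar_add hku contMDiff_const, ddbar_const, add_zero,
        ddbar_const_mul hu, smul_add, Complex.ofReal_natCast]
    · simp only [Real.exp_add, Real.exp_log hApos]
      rw [integral_mul_const, hA]
      field_simp
  have h2 : IsNormalizedPotential h k σ φ (psi h k σ φ) := Classical.epsilon_spec ⟨_, h1⟩
  rw [h2.unique h1 (by positivity), Real.exp_add, Real.exp_log hApos, mul_comm]

/-- The one-form is continuous along smooth paths of Kähler potentials. -/
theorem continuous_deltaI [ConnectedSpace X] (h : HermitianMetric (n := n) L) {k : ℕ} (hk : 1 ≤ k)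
    (hN : 0 < numSections n L k) (σ : OneParamSubgroup n L) {γ : ℝ → X → ℝ}
    (hγ : JointSmooth (n := n) γ) (hK : ∀ s, IsKahlerPotential h (γ s)) :
    Continuous fun s => deltaI h k σ (γ s) (tderiv γ s) := by
  obtain ⟨w, hw, hψ⟩ := exists_exp_psi_eq h hk hN σ
  have hf := (exists_pullback_curvForm h (σ.toFun 1)).1
  set f := baseMap (σ.toFun 1)
  have := isFiniteMeasure_volumeMeasure h (hK 0).1
  set E : ℝ → X → ℝ := fun s x => Real.exp (k * (γ s (f x) + (-1) * γ s x + (-1) * w x)) with hE_def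
  have hE : JointSmooth (n := n) E :=
    ((((hγ.comp_holomorphic hf).add (hγ.const_mul (-1))).add
      ((IsSmooth.jointSmooth hw).const_mul (-1))).const_mul k).exp
  -- Every integral over the moving measure is rewritten over the fixed measure of γ_0, with the
  -- volume ratio as density, so that continuity in the parameter becomes that of a parametric
  -- integral.
  have hV := jointSmooth_volRatio h (hK 0) hγ
  have hVpos : ∀ s x, 0 < volRatio h (γ 0) (γ s) x := fun s x => volRatio_pos h (hK 0) (hK s) x
  have hvol : ∀ s (g : X → ℝ), ∫ x, g x ∂volumeMeasure h (γ s) =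
      ∫ x, volRatio h (γ 0) (γ s) x * g x ∂volumeMeasure h (γ 0) := fun s g =>
    integral_volumeMeasure_eq h (hK 0) (hK s).1 (fun x => (hVpos s x).le) g
  set J : ℝ → ℝ := fun s => ∫ x, E s x ∂volumeMeasure h (γ s) with hJ_def
  have hJpos : ∀ s, 0 < J s := by
    intro s
    obtain ⟨x⟩ : Nonempty X := inferInstance
    exact integral_pos_of_continuous h (hK s) (hE.isSmooth s).continuous
      (fun _ => (Real.exp_pos _).le) (x := x) (Real.exp_pos _).ne'
  have hJ : Continuous J := by
    rw [show J = fun s => ∫ x, volRatio h (γ 0) (γ s) x * E s x ∂volumeMeasure h (γ 0) from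
      funext fun s => hvol s _]
    exact continuous_integral_of_continuous _
      (F := fun p => volRatio h (γ 0) (γ p.1) p.2 * E p.1 p.2) (hV.continuous.mul hE.continuous)
  set K : ℝ → ℝ := fun s => ∫ x, (k : ℝ) * tderiv γ s x *
    (E s x + laplacian h (γ s) (E s) x / k) * (k : ℝ) ^ n ∂volumeMeasure h (γ s) with hK_def
  have hKc : Continuous K := by
    rw [show K = fun s => ∫ x, volRatio h (γ 0) (γ s) x * ((k : ℝ) * tderiv γ s x *
      (E s x + laplacian h (γ s) (E s) x / k) * (k : ℝ) ^ n) ∂volumeMeasure h (γ 0) from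
      funext fun s => hvol s _]
    refine continuous_integral_of_continuous _
      (F := fun p => volRatio h (γ 0) (γ p.1) p.2 * ((k : ℝ) * tderiv γ p.1 p.2 *
        (E p.1 p.2 + laplacian h (γ p.1) (E p.1) p.2 / k) * (k : ℝ) ^ n)) ?_
    exact hV.continuous.mul (((continuous_const.mul hγ.tderiv.continuous).mul
      (hE.continuous.add ((continuous_laplacian h hγ hK hE).div_const _))).mul continuous_const)
  -- The normalizing factor depends on s but not on the point of X, so it passes through the
  -- Laplacian and the integral.
  have key : ∀ s, deltaI h k σ (γ s) (tderiv γ s) =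
      (numSections n L k : ℝ) / (k : ℝ) ^ n / J s * K s := by
    intro s
    have hψs : ∀ x, Real.exp (psi h k σ (γ s) x) =
        (numSections n L k : ℝ) / (k : ℝ) ^ n / J s * E s x := hψ (γ s) (hK s)
    simp only [hK_def]
    rw [← integral_const_mul, deltaI]
    refine integral_congr_ae (Eventually.of_forall fun x => ?_)
    simp only [hψs]
    rw [laplacian_const_mul h (γ s) (hE.isSmooth s)]
    ring
  simp only [key]
  exact (continuous_const.div hJ fun s => (hJpos s).ne').mul hKc

/-- The derivative of the functional along a path through a balanced metric vanishes. -/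
theorem isCriticalPoint_of_isBalanced [ConnectedSpace X] (h : HermitianMetric (n := n) L) {k : ℕ}
    (hk : 1 ≤ k) (hbpf : ∀ x : X, ∃ s : holSections n L k, s.1 x ≠ 0)
    (b : Module.Basis (Fin (numSections n L k)) ℂ (holSections n L k))
    (G : Subgroup (autGroup n L)) (σ : OneParamSubgroup n L) {φ : X → ℝ}
    (hbal : IsBalanced h k σ φ) : IsCriticalPoint G h k σ b φ := by
  have : Module.Finite ℂ (holSections n L k) := Module.Finite.of_basis b
  rintro γ ⟨hγ, hK, -⟩ t ht
  have hN := numSections_pos (n := n) hbpf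
  have h1 := hasDerivAt_logDet_Hilb_of_isBalanced h hk hbpf b hbal hγ ht
  -- Continuity of the integrand lets the fundamental theorem of calculus give the derivative of the
  -- path integral as the one-form at φ, opposite to the derivative of log det.
  have hc := continuous_deltaI h hk hN σ hγ fun s => (hK s).1
  have h2 := (hc.integral_hasStrictDerivAt 0 t).hasDerivAt
  have h3 := h1.add h2
  rw [ht, neg_add_cancel] at h3
  exact h3

/-- The first variation of the functional at a balanced metric vanishes. -/
theorem firstVariation_eq_zero_of_isBalanced [ConnectedSpace X] (h : HermitianMetric (n := n) L)
    {k : ℕ} (hk : 1 ≤ k) (hbpf : ∀ x : X, ∃ s : holSections n L k, s.1 x ≠ 0)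
    (b : Module.Basis (Fin (numSections n L k)) ℂ (holSections n L k)) (σ : OneParamSubgroup n L)
    {φ : X → ℝ} (hbal : IsBalanced h k σ φ) {u : X → ℝ} (hu : IsSmooth (n := n) u) :
    HasDerivAt (fun t : ℝ => logDet b (Hilb h k fun x => φ x + t * u x)) (-deltaI h k σ φ u) 0 := by
  have ht : JointSmooth (n := n) fun t (_ : X) => t := contMDiff_fst
  have hΓ : JointSmooth (n := n) fun t x => φ x + t * u x :=
    (IsSmooth.jointSmooth hbal.1.1).add (ht.mul (IsSmooth.jointSmooth hu))
  have h1 := hasDerivAt_logDet_Hilb_of_isBalanced h hk hbpf b hbal hΓ (t := 0) (by simp)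
  have h2 : tderiv (fun t x => φ x + t * u x) 0 = u := by
    funext x
    simp [tderiv]
  rwa [h2] at h1

end Paths

end SigmaBalanced

end

/-! ### The Bergman function identity, the first variation and criticality -/

theorem mainTheorem8 {n : ℕ} {X : Type*} [TopologicalSpace X] [T2Space X] [CompactSpace X]
    [ConnectedSpace X] [MeasurableSpace X] [BorelSpace X]
    [ChartedSpace (Fin n → ℂ) X] [IsManifold 𝓘(ℂ, Fin n → ℂ) ω X]
    {L : X → Type*} [∀ x, AddCommGroup (L x)] [∀ x, Module ℂ (L x)]
    [∀ x, TopologicalSpace (L x)] [TopologicalSpace (Bundle.TotalSpace ℂ L)] [FiberBundle ℂ L]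
    [VectorBundle ℂ ℂ L] [ContMDiffVectorBundle ω ℂ L 𝓘(ℂ, Fin n → ℂ)]
    -- the base metric, with positive curvature form
    (h₀ : SigmaBalanced.HermitianMetric (n := n) L)
    (hpos : ∀ x, (SigmaBalanced.curvForm h₀ 0 x).PosDef)
    -- the base form is invariant under the group `G`
    (G : Subgroup (SigmaBalanced.autGroup n L))
    (hG : ∀ g ∈ G, SigmaBalanced.pullback (SigmaBalanced.baseMap g)
      (SigmaBalanced.curvForm h₀ 0) = SigmaBalanced.curvForm h₀ 0)
    -- `L^{⊗k}` has no base points, so that `FS_k` is defined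
    (k : ℕ) (hk : 1 ≤ k)
    (hbpf : ∀ x : X, ∃ s : SigmaBalanced.holSections n L k, s.1 x ≠ 0)
    -- the basis in which `I_k = log ∘ det` is computed
    (b : Module.Basis (Fin (SigmaBalanced.numSections n L k)) ℂ
      (SigmaBalanced.holSections n L k))
    (σ : SigmaBalanced.OneParamSubgroup n L)
    (φ : X → ℝ) (hφ : SigmaBalanced.IsInvariantPotential G h₀ φ)
    (hbal : SigmaBalanced.IsBalanced h₀ k σ φ) :
    -- `ρ_k(φ) = k^n e^{ψ_k(φ)}`
    (∀ x, SigmaBalanced.bergman h₀ k φ x =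
      (k : ℝ) ^ n * Real.exp (SigmaBalanced.psi h₀ k σ φ x)) ∧
    -- `δ(I_k ∘ Hilb_k)_φ(δφ) + δI_k^σ(φ)(δφ) = 0`
    (∀ δφ : X → ℝ, SigmaBalanced.IsSmooth (n := n) δφ →
      (∀ g ∈ G, ∀ x, δφ (SigmaBalanced.baseMap g x) = δφ x) →
      ∃ D : ℝ, HasDerivAt (fun t : ℝ => SigmaBalanced.logDet b
          (SigmaBalanced.Hilb h₀ k fun x => φ x + t * δφ x)) D 0 ∧
        D + SigmaBalanced.deltaI h₀ k σ φ δφ = 0) ∧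
    SigmaBalanced.IsCriticalPoint G h₀ k σ b φ := by
  -- Finite dimensionality of the space of sections comes from the basis in which the determinant is
  -- taken.
  have hfin : Module.Finite ℂ (SigmaBalanced.holSections n L k) := Module.Finite.of_basis b
  refine ⟨SigmaBalanced.bergman_eq_of_isBalanced h₀ hk hbpf hbal, fun δφ hδ _ =>
    ⟨_, SigmaBalanced.firstVariation_eq_zero_of_isBalanced h₀ hk hbpf b σ hbal hδ,
      neg_add_cancel _⟩, SigmaBalanced.isCriticalPoint_of_isBalanced h₀ hk hbpf b G σ hbal⟩
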